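/- **Conventions.** Let $D\subset\mathbb C$ be a connected open set with $0\in D$, $z=x+iy$, and let $H\neq0$ be real. A smooth map $r:D\to\mathbb R^3$ is an affine sphere with data $(H,\psi,U)$ if (with centre $0$, $\psi,U$ smooth on $D$) its affine metric $|\det\Lambda|^{-1/4}\Lambda$, $\Lambda_{ij}=\det(\partial_i\partial_jr,r_x,r_y)$, equals $e^\psi|dz|^2$, its affine normal $\xi=\frac12\Delta_gr$ satisfies $\xi=-Hr$ (so the affine shape operator is $H\cdot\mathrm{Id}$), and its affine cubic form $g(\nabla_XY-\nabla^g_XY,Z)$ ($\nabla$ the Blaschke connection) is $\frac12(U\,dz^3+\bar U\,d\bar z^3)$, i.e. $r_{zz}=\psi_zr_z+Ue^{-\psi}r_{\bar z}$. It is hyperbolic if $H<0$, elliptic if $H>0$. Put $k=\frac12\sqrt{-2H}$ (with $\sqrt{-2H}=i\sqrt{2H}$ if $H>0$) and let $\alpha_\lambda=\alpha_\lambda[\psi,U,H]$ be $$\begin{pmatrix}\frac12(\psi_zdz-\psi_{\bar z}d\bar z)&\lambda^{-1}\bar Ue^{-\psi}d\bar z&\lambda ke^{\psi/2}dz\\ \lambda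 Ue^{-\psi}dz&\frac12(\psi_{\bar z}d\bar z-\psi_zdz)&\lambda^{-1}ke^{\psi/2}d\bar z\\ \lambda^{-1}ke^{\psi/2}d\bar z&\lambda ke^{\psi/2}dz&0\end{pmatrix}.$$ Let $\epsilon=e^{\pi i/3}$, $\sigma(g)=P(g^t)^{-1}P^{-1}$ with $P=\begin{pmatrix}0&\epsilon^4&0\\ \epsilon^2&0&0\\0&0&1\end{pmatrix}$, and $\tau(g)=T\bar gT^{-1}$ with $T=\begin{pmatrix}0&1&0\\1&0&0\\0&0&\kappa\end{pmatrix}$, $\kappa=1$ if $H<0$, $\kappa=-1$ if $H>0$. $\Lambda^{\sigma}_{\mathbb C^\times}SL_3$ is the group of holomorphic $g:\mathbb C^\times\to SL(3,\mathbb C)$ with $\sigma(g(\lambda))=g(\epsilon\lambda)$; $\Lambda^{\sigma}_IGL_3$ is that of the maps, holomorphic and invertible near $0$ and $\infty$, with the same symmetry; $\Lambda^{\sigma,\tau}$ means that moreover $\tau(g(1/\bar\lambda))=g(\lambda)$. A normalized frame on $D$ is a solution $E(z,\bar z,\lambda)$, $\lambda\in\mathbb C^\times$, smooth in $z$, of $E^{-1}dE=\alpha_\lambda$,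 $E(0,0,\lambda)=I$, with $E(z,\bar z,\cdot)\in\Lambda^{\sigma,\tau}_{\mathbb C^\times}SL_3$; put $r^E_\lambda=-H^{-1}E_3(\cdot,\lambda)$ ($E_3$ the third column). For $R:D\to\mathbb R^3$ let $F_\lambda^R=(\lambda^{-1}\sqrt{-2H}e^{-\psi/2}R_z,\ \lambda\sqrt{-2H}e^{-\psi/2}R_{\bar z},\ -HR)$. For $l=(b,c,1)$ with $2bc\ne1$, $\ell=\mathbb Cl$, $A=\mathrm{diag}(d,d^{-1},1)$ let $$Am_{\alpha,\ell}(\lambda)=A\Big[I+\tfrac2{\lambda^3-\alpha^3}\begin{pmatrix}\frac{\alpha^3(bc-1)}{2bc-1}&\frac{-\alpha\lambda^2c^2}{2bc-1}&\frac{\alpha^2\lambda c}{2bc-1}\\ \alpha^2\lambda b^2&\alpha^3(1-bc)&-\alpha\lambda^2b\\-\alpha\lambda^2b&\alpha^2\lambda c&0\end{pmatrix}\Big],$$ $$Ag_{\alpha,\ell}(\lambda)=A\Big[I+\tfrac2{\lambda^3-\alpha^3}\begin{pmatrix}\frac{\alpha^3bc}{2bc-1}&\frac{\alpha\lambda^2c^2}{2bc-1}&\frac{\alpha^2\lambda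 c}{2bc-1}\\ \alpha^2\lambda b^2&\alpha^3bc&\alpha\lambda^2b\\ \alpha\lambda^2b&\alpha^2\lambda c&\alpha^3\end{pmatrix}\Big],$$ $\Delta=\{v\in\mathbb C^3:2v_1v_2=v_3^2\text{ or }v_3=0\}$, and for functions $\phi$, $\rho$ put $$\mathcal T_{\alpha,\lambda}[\phi,\rho]=\frac{-H(\lambda^3+\alpha^3)\rho e^\psi-4\alpha^3(\ln\phi)_{\bar z}\rho_z-4\lambda^3(\ln\phi)_z\rho_{\bar z}}{(\lambda^3+\alpha^3)e^\psi},\qquad (\ln\phi)_z:=\phi_z/\phi.$$ **Theorem.** Let $r$ be an affine sphere on $D$ with data $(H,\psi,U)$, $H\ne0$. (1) On every open $V\subset D$ star-shaped about $0$ there are a normalized frame $E$ and a family $r_\lambda$ ($|\lambda|=1$), $r_1=r$, of affine spheres with data $(H,\psi,\lambda^3U)$ and $F^{r_\lambda}_\lambda(z)=F^{r_\lambda}_\lambda(0)E(z,\bar z,\lambda)$. (2) Let $H<0$, $E$ a normalized frame on $D$, $|\alpha|=1$ and $Am_{\alpha,\ell}\in\Lambda_I^{\sigma,\tau}GL_3$.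 Let $\tilde\ell=\ell E(z,\bar z,-\alpha)=\mathbb C(\tilde b,\tilde c,1)$, let $W$ be the set of $z\in D$ with $\tilde\ell\not\subset\Delta$ and $2|\tilde b|^2-1>0$, and $\tilde d=\sqrt{2|\tilde b|^2-1}$, $\tilde A=\mathrm{diag}(\tilde d,\tilde d^{-1},1)$, $\tilde\psi=\psi+\ln\tilde d^2$, $\phi=(b,\bar b,1)r^E_{-\alpha}$. Then $W$ is open, $0\in W$, and on $W$: $\tilde c=\bar{\tilde b}$, $\phi\neq0$, and $$Am_{\alpha,\ell}\,E=\tilde E\cdot\tilde Am_{\alpha,\tilde\ell}\in\Lambda^{\sigma,\tau}_{\mathbb C^\times}SL_3\cdot\Lambda_I^{\sigma,\tau}GL_3,$$ where $\tilde E^{-1}d\tilde E=\alpha_\lambda[\tilde\psi,U,H]$, and for $\lambda\in\mathbb C^\times$, $\lambda^3\ne\pm\alpha^3$, $(Am_{\alpha,\ell}(\lambda))^{-1}\tilde E_3(\cdot,\lambda)=\mathcal T_{\alpha,\lambda}[\phi,r^E_\lambda]$. If $|\lambda|=1$ and $R$ is an affine sphere on $D$ with data $(H,\psi,\lambda^3U)$,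 then $-H^{-1}F_\lambda^R(0)\tilde E_3(\cdot,\lambda)$ is a (real) hyperbolic affine sphere on $W$ with affine metric $\tilde d^2e^\psi|dz|^2$ and the same mean curvature and cubic form, i.e. with data $(H,\tilde\psi,\lambda^3U)$. If moreover $\lambda^3\neq\pm\alpha^3$, then $\hat r=\mathcal T_{\alpha,\lambda}[\phi,R]$ is real, and its constant multiple $H^{-1}\left|\frac{\lambda^3+\alpha^3}{\lambda^3-\alpha^3}\right|^{2/3}\hat r$ is an affine sphere on $W$ with these same data. (3) Let $H>0$, $E$ a normalized frame on $D$, $|\alpha|=1$, $2bc\ne1$, $d\neq0$. Let $\tilde\ell=\ell E(z,\bar z,\alpha)=\mathbb C(\tilde b,\tilde c,1)\not\subset\Delta$ for $z$ in an open $V\subset D$, let $\tilde d:V\to\mathbb C$ be smooth with $\tilde d^2=2\tilde b\tilde c-1$, and $\phi=(b,c,1)r^E_\alpha$. Then on $V$: $\phi\ne0$ and $Ag_{\alpha,\ell}E=\tilde E\cdot\tilde Ag_{\alpha,\tilde\ell}\in\Lambda^{\sigma}_{\mathbb C^\times}SL_3\cdot\Lambda^\sigma_IGL_3$, where $\tilde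 E^{-1}d\tilde E$ is $\alpha_\lambda$ with $e^{\psi/2}$ replaced by $\tilde de^{\psi/2}$ (and the same $U$, $H$), and for $\lambda^3\neq\pm\alpha^3$ one has $(Ag_{\alpha,\ell}(\lambda))^{-1}\tilde E_3=\frac{\lambda^3-\alpha^3}{\lambda^3+\alpha^3}\mathcal T_{-\alpha,\lambda}[\phi,r^E_\lambda]$. If $Ag_{\alpha,\ell}\in\Lambda_I^{\sigma,\tau}GL_3$, then wherever $2|\tilde b|^2-1>0$ and $\tilde d=\sqrt{2|\tilde b|^2-1}$ one has $\tilde c=\bar{\tilde b}$ and both factors satisfy the $\tau$-condition as well. If $c=-\bar b$, then $\tilde c=-\bar{\tilde b}$, so $\tilde d^2=-(2|\tilde b|^2+1)<0$. If $V$ is connected and $|\lambda|=1$, then: if $\tilde d>0$ on $V$, the image of $\tilde E_3(\cdot,\lambda)$ under some constant $M\in GL(3,\mathbb C)$ is a real elliptic affine sphere with affine metric $\tilde d^2e^\psi|dz|^2$ and the data $H$, $\lambda^3U$; if $\tilde d=i\delta$ with $\delta>0$, the image under some constant $M\in GL(3,\mathbb C)$ is a real affine sphere with affine metric $\delta^2e^{\psi}|dz|^2=-\tilde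 d^2e^\psi|dz|^2$ and data $-H$, $-\lambda^3U$ (that is, $H$ and $\lambda^3U$ with respect to the negative definite metric $\tilde d^2e^\psi|dz|^2$). -/

import Mathlib

open scoped Matrix ContDiff

noncomputable section

namespace DefiniteAffine

/-! ### Derivatives on a planar domain, with `z = x + i y` -/

/-- The partial derivatives `∂/∂x` (`i = 0`) and `∂/∂y` (`i = 1`). -/
def pd {F : Type*} [NormedAddCommGroup F] [NormedSpace ℝ F] (i : Fin 2) (f : ℂ → F) (z : ℂ) : F :=
  fderiv ℝ f z (![1, Complex.I] i)

/-- The Wirtinger derivative `∂/∂z`. -/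
def wz {F : Type*} [NormedAddCommGroup F] [NormedSpace ℂ F] (f : ℂ → F) (z : ℂ) : F :=
  (1 / 2 : ℂ) • (fderiv ℝ f z 1 - Complex.I • fderiv ℝ f z Complex.I)

/-- The Wirtinger derivative `∂/∂z̄`. -/
def wzb {F : Type*} [NormedAddCommGroup F] [NormedSpace ℂ F] (f : ℂ → F) (z : ℂ) : F :=
  (1 / 2 : ℂ) • (fderiv ℝ f z 1 + Complex.I • fderiv ℝ f z Complex.I)

/-! ### Equiaffine invariants of an immersed surface `r : D → ℝ³` -/

/-- The coefficients `Λ i j = det (∂ᵢ∂ⱼ r, ∂ₓ r, ∂ᵧ r)`. -/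
def fundForm (r : ℂ → Fin 3 → ℝ) (z : ℂ) : Matrix (Fin 2) (Fin 2) ℝ :=
  Matrix.of fun i j => Matrix.det (Matrix.of ![pd i (pd j r) z, pd 0 r z, pd 1 r z])

/-- The affine metric `|det Λ|^(-1/4) Λ`; surfaces are oriented so that a definite `Λ` is positive
for the orientation `dx ∧ dy`. -/
def affineMetric (r : ℂ → Fin 3 → ℝ) (z : ℂ) : Matrix (Fin 2) (Fin 2) ℝ :=
  |(fundForm r z).det| ^ (-(1 / 4) : ℝ) • fundForm r z

/-- The Laplace–Beltrami operator of a metric `g`, on vector-valued functions. -/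
def laplaceBeltrami (g : ℂ → Matrix (Fin 2) (Fin 2) ℝ) (f : ℂ → Fin 3 → ℝ) (z : ℂ) : Fin 3 → ℝ :=
  (Real.sqrt (g z).det)⁻¹ •
    ∑ i, pd i (fun w => ∑ j, (Real.sqrt (g w).det * (g w)⁻¹ i j) • pd j f w) z

/-- The affine normal `ξ = ½ Δ_g r`. -/
def affineNormal (r : ℂ → Fin 3 → ℝ) (z : ℂ) : Fin 3 → ℝ :=
  (1 / 2 : ℝ) • laplaceBeltrami (affineMetric r) r z

/-- The Christoffel symbols `Γᵏᵢⱼ` of the Levi-Civita connection of `g`. -/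
def christoffel (g : ℂ → Matrix (Fin 2) (Fin 2) ℝ) (k i j : Fin 2) (z : ℂ) : ℝ :=
  (1 / 2) * ∑ l, (g z)⁻¹ k l *
    (pd i (fun w => g w j l) z + pd j (fun w => g w i l) z - pd l (fun w => g w i j) z)

/-- `C` is the affine cubic form of `r` at `z`: in the Gauss formula
`∂ᵢ∂ⱼ r = r_*(∇ᵢ ∂ⱼ) + g(∂ᵢ, ∂ⱼ) ξ` the Blaschke connection `∇` satisfies
`g(∇ᵢ ∂ⱼ - ∇ᵍᵢ ∂ⱼ, ∂ₗ) = C i j l`. -/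
def IsCubicFormAt (r : ℂ → Fin 3 → ℝ) (C : Fin 2 → Fin 2 → Fin 2 → ℝ) (z : ℂ) : Prop :=
  ∀ i j : Fin 2, pd i (pd j r) z =
    (∑ k, (christoffel (affineMetric r) k i j z + ∑ l, C i j l * (affineMetric r z)⁻¹ l k) •
      pd k r z) + affineMetric r z i j • affineNormal r z

/-- The symmetric cubic form `½ (u dz³ + ū dz̄³) = Re (u dz³)` in the coordinates `x, y`. -/
def cubicOfCoeff (u : ℂ) (i j k : Fin 2) : ℝ :=
  (u * ![1, Complex.I] i * ![1, Complex.I] j * ![1, Complex.I] k).re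

/-- `r : D → ℝ³` is a positive definite affine sphere with centre `0` and affine mean curvature
`H`, in a conformal coordinate `z`, with affine metric `e^ψ |dz|²` and affine cubic form
`½ (U dz³ + Ū dz̄³)`, i.e. `r_zz = ψ_z r_z + U e^(-ψ) r_z̄`. It is hyperbolic if `H < 0` and
elliptic if `H > 0`. -/
structure IsAffineSphere (D : Set ℂ) (r : ℂ → Fin 3 → ℝ) (H : ℝ) (ψ : ℂ → ℝ) (U : ℂ → ℂ) :
    Prop where
  smooth : ContDiffOn ℝ ∞ r D
  smooth_psi : ContDiffOn ℝ ∞ ψ D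
  smooth_U : ContDiffOn ℝ ∞ U D
  /-- the affine metric is `e^ψ |dz|²` (so `r` is a locally strongly convex immersion) -/
  metric : ∀ z ∈ D, affineMetric r z = Real.exp (ψ z) • (1 : Matrix (Fin 2) (Fin 2) ℝ)
  /-- the affine shape operator, defined by `dξ = - dr ∘ S`, is `H • Id` -/
  shape : ∀ z ∈ D, ∀ i, pd i (affineNormal r) z = -(H • pd i r z)
  /-- the centre is the origin -/
  center : ∀ z ∈ D, affineNormal r z = -(H • r z)
  cubic : ∀ z ∈ D, IsCubicFormAt r (cubicOfCoeff (U z)) z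

/-! ### Loop groups -/

/-- `ε = e^(π i / 3)`. -/
def eps : ℂ := Complex.exp (Real.pi * Complex.I / 3)

def matP : Matrix (Fin 3) (Fin 3) ℂ := !![0, eps ^ 4, 0; eps ^ 2, 0, 0; 0, 0, 1]

/-- The matrix `T` of the reality condition: `T₁` for hyperbolic spheres (`H < 0`), `T₋₁` for
elliptic ones. -/
def matT (H : ℝ) : Matrix (Fin 3) (Fin 3) ℂ :=
  !![0, 1, 0; 1, 0, 0; 0, 0, if H < 0 then 1 else -1]

/-- `σ(g) = P (gᵗ)⁻¹ P⁻¹`. -/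
def sigma (g : Matrix (Fin 3) (Fin 3) ℂ) : Matrix (Fin 3) (Fin 3) ℂ := matP * (gᵀ)⁻¹ * matP⁻¹

/-- `τ(g) = T ḡ T⁻¹`. -/
def tau (H : ℝ) (g : Matrix (Fin 3) (Fin 3) ℂ) : Matrix (Fin 3) (Fin 3) ℂ :=
  matT H * g.map (starRingEnd ℂ) * (matT H)⁻¹

/-- `g ∈ Λ^σ_{ℂ^×} SL(3, ℂ)`: holomorphic on `ℂ \ {0}`, with `σ(g(λ)) = g(ε λ)`. -/
structure IsSigmaLoop (g : ℂ → Matrix (Fin 3) (Fin 3) ℂ) : Prop where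
  holo : ∀ i j, DifferentiableOn ℂ (fun lam => g lam i j) {0}ᶜ
  det : ∀ lam, lam ≠ 0 → (g lam).det = 1
  sigma_real : ∀ lam, lam ≠ 0 → sigma (g lam) = g (eps * lam)

/-- `g ∈ Λ^{σ,τ}_{ℂ^×} SL(3, ℂ)`: moreover `τ(g(1/λ̄)) = g(λ)`. -/
def IsTwistedLoop (H : ℝ) (g : ℂ → Matrix (Fin 3) (Fin 3) ℂ) : Prop :=
  IsSigmaLoop g ∧ ∀ lam, lam ≠ 0 → tau H (g ((starRingEnd ℂ) lam)⁻¹) = g lam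

/-- `g ∈ Λ^σ_I GL(3, ℂ)` with `I = {|λ| < ρ} ∪ {|λ| > 1/ρ}`, a neighbourhood of `0` and `∞` in the
Riemann sphere; `G μ = g (1/μ)` is `g` in the coordinate at infinity. -/
structure IsSigmaLoopI (ρ : ℝ) (g : ℂ → Matrix (Fin 3) (Fin 3) ℂ) : Prop where
  zero : ∀ i j, DifferentiableOn ℂ (fun lam => g lam i j) (Metric.ball 0 ρ)
  det_zero : ∀ lam ∈ Metric.ball (0 : ℂ) ρ, (g lam).det ≠ 0
  infty : ∃ G : ℂ → Matrix (Fin 3) (Fin 3) ℂ,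
    (∀ i j, DifferentiableOn ℂ (fun mu => G mu i j) (Metric.ball 0 ρ)) ∧
    (∀ mu ∈ Metric.ball (0 : ℂ) ρ, (G mu).det ≠ 0) ∧
    ∀ mu ∈ Metric.ball (0 : ℂ) ρ, mu ≠ 0 → G mu = g mu⁻¹
  sigma_real : ∀ lam : ℂ, ‖lam‖ < ρ ∨ ρ⁻¹ < ‖lam‖ → sigma (g lam) = g (eps * lam)

/-- `g ∈ Λ^σ_I GL(3, ℂ)` for a sufficiently small `I`. -/
def IsSigmaGerm (g : ℂ → Matrix (Fin 3) (Fin 3) ℂ) : Prop :=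
  ∃ ρ : ℝ, 0 < ρ ∧ ρ < 1 ∧ IsSigmaLoopI ρ g

/-- `g ∈ Λ^{σ,τ}_I GL(3, ℂ)` for a sufficiently small `I`. -/
def IsTwistedGerm (H : ℝ) (g : ℂ → Matrix (Fin 3) (Fin 3) ℂ) : Prop :=
  ∃ ρ : ℝ, 0 < ρ ∧ ρ < 1 ∧ IsSigmaLoopI ρ g ∧
    ∀ lam : ℂ, lam ≠ 0 → (‖lam‖ < ρ ∨ ρ⁻¹ < ‖lam‖) →
      tau H (g ((starRingEnd ℂ) lam)⁻¹) = g lam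

/-! ### Frames -/

/-- `√(-2H)`. -/
def rootH (H : ℝ) : ℂ :=
  if H < 0 then (Real.sqrt (-2 * H) : ℂ) else Complex.I * (Real.sqrt (2 * H) : ℂ)

/-- The `dz`-part of the Maurer–Cartan form `α_λ`, with `p = e^(ψ/2)` (so `½ ψ_z = p_z / p`). For
`H = ∓2` the factor `½ √(-2H)` is `1`, respectively `i`. -/
def connZ (H : ℝ) (p U : ℂ → ℂ) (lam z : ℂ) : Matrix (Fin 3) (Fin 3) ℂ :=
  !![wz p z / p z, 0, lam * (rootH H / 2) * p z;
     lam * U z / p z ^ 2, -(wz p z / p z), 0;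
     0, lam * (rootH H / 2) * p z, 0]

/-- The `dz̄`-part of `α_λ`. -/
def connZbar (H : ℝ) (p U : ℂ → ℂ) (lam z : ℂ) : Matrix (Fin 3) (Fin 3) ℂ :=
  !![-(wzb p z / p z), lam⁻¹ * (starRingEnd ℂ) (U z) / p z ^ 2, 0;
     0, wzb p z / p z, lam⁻¹ * (rootH H / 2) * p z;
     lam⁻¹ * (rootH H / 2) * p z, 0, 0]

/-- `e^(ψ/2)` as a complex-valued function. -/
def expHalf (ψ : ℂ → ℝ) (z : ℂ) : ℂ := (Real.exp (ψ z / 2) : ℂ)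

/-- `E(z, z̄, λ)` solves `E⁻¹ dE = α_λ` on `D`, for all `λ ∈ ℂ \ {0}`. -/
structure IsFrame (D : Set ℂ) (H : ℝ) (p U : ℂ → ℂ)
    (E : ℂ → ℂ → Matrix (Fin 3) (Fin 3) ℂ) : Prop where
  smooth : ∀ lam, lam ≠ 0 → ∀ i j, ContDiffOn ℝ ∞ (fun w => E w lam i j) D
  eqZ : ∀ lam, lam ≠ 0 → ∀ z ∈ D,
    Matrix.of (fun i j => wz (fun w => E w lam i j) z) = E z lam * connZ H p U lam z
  eqZbar : ∀ lam, lam ≠ 0 → ∀ z ∈ D,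
    Matrix.of (fun i j => wzb (fun w => E w lam i j) z) = E z lam * connZbar H p U lam z

/-- The extended frame with values in `Λ^{σ,τ}_{ℂ^×} SL(3, ℂ)`, normalized by `E(0, 0, λ) = I`. -/
structure IsNormalizedFrame (D : Set ℂ) (H : ℝ) (ψ : ℂ → ℝ) (U : ℂ → ℂ)
    (E : ℂ → ℂ → Matrix (Fin 3) (Fin 3) ℂ) : Prop where
  frame : IsFrame D H (expHalf ψ) U E
  loop : ∀ z ∈ D, IsTwistedLoop H (E z)
  normalized : ∀ lam, lam ≠ 0 → E 0 lam = 1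

/-- A real immersion regarded as a map to `ℂ³`. -/
def cx (r : ℂ → Fin 3 → ℝ) (z : ℂ) : Fin 3 → ℂ := fun i => (r z i : ℂ)

/-- The affine frame `(λ⁻¹ √(-2H) e^(-ψ/2) r_z, λ √(-2H) e^(-ψ/2) r_z̄, -H r)` of `r`. -/
def sphereFrame (H : ℝ) (ψ : ℂ → ℝ) (r : ℂ → Fin 3 → ℝ) (lam z : ℂ) :
    Matrix (Fin 3) (Fin 3) ℂ :=
  (Matrix.of ![(lam⁻¹ * rootH H / expHalf ψ z) • wz (cx r) z,
    (lam * rootH H / expHalf ψ z) • wzb (cx r) z, (-(H : ℂ)) • cx r z])ᵀ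

/-- The third column of a matrix. -/
def thirdCol (X : Matrix (Fin 3) (Fin 3) ℂ) : Fin 3 → ℂ := fun i => X i 2

/-- The position vector `r_λ = -H⁻¹ E₃(·, λ)` of a frame `E`. -/
def framePos (H : ℝ) (E : ℂ → ℂ → Matrix (Fin 3) (Fin 3) ℂ) (lam z : ℂ) : Fin 3 → ℂ :=
  (-(H : ℂ))⁻¹ • thirdCol (E z lam)

/-! ### Simple elements -/

/-- The simple element `A g_{α,ℓ}` of rank 1 type, `ℓ = ℂ (b, c, 1)`, `A = diag(d, d⁻¹, 1)`. -/
def simpleG (α b c d lam : ℂ) : Matrix (Fin 3) (Fin 3) ℂ :=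
  Matrix.diagonal ![d, d⁻¹, 1] * (1 + (2 / (lam ^ 3 - α ^ 3)) •
    !![α ^ 3 * b * c / (2 * b * c - 1), α * lam ^ 2 * c ^ 2 / (2 * b * c - 1),
        α ^ 2 * lam * c / (2 * b * c - 1);
       α ^ 2 * lam * b ^ 2, α ^ 3 * b * c, α * lam ^ 2 * b;
       α * lam ^ 2 * b, α ^ 2 * lam * c, α ^ 3])

/-- The simple element `A m_{α,ℓ}` of rank 2 type, `ℓ = ℂ (b, c, 1)`, `A = diag(d, d⁻¹, 1)`. -/
def simpleM (α b c d lam : ℂ) : Matrix (Fin 3) (Fin 3) ℂ :=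
  Matrix.diagonal ![d, d⁻¹, 1] * (1 + (2 / (lam ^ 3 - α ^ 3)) •
    !![α ^ 3 * (b * c - 1) / (2 * b * c - 1), -(α * lam ^ 2 * c ^ 2) / (2 * b * c - 1),
        α ^ 2 * lam * c / (2 * b * c - 1);
       α ^ 2 * lam * b ^ 2, α ^ 3 * (1 - b * c), -(α * lam ^ 2 * b);
       -(α * lam ^ 2 * b), α ^ 2 * lam * c, 0])

/-- The cone `Δ`; a line `ℂ v` is contained in `Δ` iff `v ∈ Δ`. -/
def coneDelta : Set (Fin 3 → ℂ) := {v | 2 * v 0 * v 1 = v 2 ^ 2 ∨ v 2 = 0}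

/-! ### Dressing -/

/-- The spanning vector `(b, c, 1) E(z, z̄, β)` of the line `ℓ̃ = ℓ E(z, z̄, β)`. -/
def lineVec (b c β : ℂ) (E : ℂ → ℂ → Matrix (Fin 3) (Fin 3) ℂ) (z : ℂ) : Fin 3 → ℂ :=
  ![b, c, 1] ᵥ* E z β

/-- `b̃`, where `ℓ̃ = ℂ (b̃, c̃, 1)`. -/
def bTilde (b c β : ℂ) (E : ℂ → ℂ → Matrix (Fin 3) (Fin 3) ℂ) (z : ℂ) : ℂ :=
  lineVec b c β E z 0 / lineVec b c β E z 2

/-- `c̃`, where `ℓ̃ = ℂ (b̃, c̃, 1)`. -/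
def cTilde (b c β : ℂ) (E : ℂ → ℂ → Matrix (Fin 3) (Fin 3) ℂ) (z : ℂ) : ℂ :=
  lineVec b c β E z 1 / lineVec b c β E z 2

/-- `d̃ = √(2|b̃|² - 1)`. -/
def dTilde (b c β : ℂ) (E : ℂ → ℂ → Matrix (Fin 3) (Fin 3) ℂ) (z : ℂ) : ℝ :=
  Real.sqrt (2 * ‖bTilde b c β E z‖ ^ 2 - 1)

/-- The points `z` of `D` with `ℓ E(z, z̄, β) ⊄ Δ` and `2|b̃|² - 1 > 0`. -/
def dressingDomain (D : Set ℂ) (b c β : ℂ) (E : ℂ → ℂ → Matrix (Fin 3) (Fin 3) ℂ) : Set ℂ :=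
  {z ∈ D | lineVec b c β E z ∉ coneDelta ∧ 0 < 2 * ‖bTilde b c β E z‖ ^ 2 - 1}

/-- The scalar function `φ = (b, c, 1) r_β`. -/
def scalarSol (H : ℝ) (b c β : ℂ) (E : ℂ → ℂ → Matrix (Fin 3) (Fin 3) ℂ) (z : ℂ) : ℂ :=
  ![b, c, 1] ⬝ᵥ framePos H E β z

/-- The transformation formula
`[-H (λ³+α³) r e^ψ - 4 α³ (ln φ)_z̄ r_z - 4 λ³ (ln φ)_z r_z̄] / ((λ³+α³) e^ψ)`. -/
def tzitzeica (H : ℝ) (ψ : ℂ → ℝ) (φ : ℂ → ℂ) (r : ℂ → Fin 3 → ℂ) (α lam z : ℂ) : Fin 3 → ℂ :=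
  ((lam ^ 3 + α ^ 3) * (Real.exp (ψ z) : ℂ))⁻¹ •
    ((-(H : ℂ) * (lam ^ 3 + α ^ 3) * (Real.exp (ψ z) : ℂ)) • r z
      - (4 * α ^ 3 * (wzb φ z / φ z)) • wz r z
      - (4 * lam ^ 3 * (wz φ z / φ z)) • wzb r z)

end DefiniteAffine

end

open DefiniteAffine

noncomputable section

namespace DefiniteAffine

/-! ### Wirtinger calculus -/

/-! An affine sphere is treated as a solution of a linear system. For `|λ| = 1`, the Gauss equations
with data `(H, ψ, λ³U)` and the normalisation `-H det(r, r_x, r_y) = e^ψ` mean that the frame of the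
sphere solves `X⁻¹ dX = α_λ`, is real with respect to `matT`, and has determinant `-iH`
(`IsAffineSphere.solves`, `exists_isAffineSphere_of_solves`).

Every entry of the zero curvature equation is homogeneous in `λ`. Flatness at `λ = 1`, which the
given sphere supplies, therefore spreads to all `λ ≠ 0` (`FlatAt.of_one`). Integrating along rays of
a star-shaped set yields a frame (`hasFDerivAt_of_flat`), and comparison with the variational
equation shows that it is holomorphic in `λ`. The symmetries `σ` and `τ` of the connection pass to
the frame because two solutions with the same initial value agree. Multiplying the frame by the
initial frame of `r` produces the associated family.

For dressing, both kinds of simple element are scalar multiples of one polynomial matrix `numG`,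
with `β = α` for rank 1 and `β = -α` for rank 2. Its inverse is `adjG` up to the scalar `β⁶ - λ⁶`.
The dressed frame can only be the product of `numG`, `E` and the new `adjG`, divided by `β⁶ - λ⁶`,
and the question is whether this product vanishes at the six roots. At `λ³ = β³` the left factor has
all rows on the translated line `ℓ`; at `λ³ = -β³` the right factor has all columns on the
translated new line. The twisting transports the single relation `ℓ E(β) = ℓ̃` to all six roots and
gives the vanishing (`numerator_eq_zero`). The roots are simple, so the quotient is holomorphic on
`ℂ \ {0}`; the remaining loop conditions follow off the roots by cancellation and at the roots by
continuity.

The coordinates `b̃`, `c̃` of the moving line satisfy Riccati equations. Together with `d̃² = 2 b̃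
c̃ - 1` these make the adjoint a gauge transformation that replaces `p = e^(ψ/2)` by `d̃ p` and
leaves `U`, `H` alone (`gauge_adjE`, `gauge_bar_adjE`). At the six roots the frame equation is
recovered from circle averages (`solves_center`). The transformation formula comes from the third
column of the adjoint, which contains only `b̃` and `c̃`, and these are the logarithmic derivatives
of `φ` up to explicit factors.

In the hyperbolic case the reality condition forces `c = b̄` and `|d|² = 2bc - 1`, both of which
persist along `z`; a real cube root of a determinant gives the constant in front of the transformed
sphere. In the elliptic case no rank 1 element with `|α| = 1` is real, so real forms are found by
normalising at one point of a connected set (`exists_real_form`). A purely imaginary `d̃` amounts to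
reversing the signs of `H` and `U` (`Solves.mul_I`). -/

/-- The real-linear map `h ↦ a h + b h̄`. -/
def wlin (a b : ℂ) : ℂ →L[ℝ] ℂ :=
  a • (ContinuousLinearMap.id ℝ ℂ) + b • (Complex.conjCLE : ℂ →L[ℝ] ℂ)

theorem wlin_apply (a b h : ℂ) : wlin a b h = a * h + b * (starRingEnd ℂ) h := by
  simp [wlin]

theorem clm_ext_one_I {F : Type*} [NormedAddCommGroup F] [NormedSpace ℝ F] {L L' : ℂ →L[ℝ] F}
    (h1 : L 1 = L' 1) (hI : L Complex.I = L' Complex.I) : L = L' := by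
  ext h
  have hh : h = h.re • (1 : ℂ) + h.im • Complex.I := by
    simp [Complex.re_add_im]
  rw [hh, map_add, map_add, map_smul, map_smul, map_smul, map_smul, h1, hI]

/-- The values at `1` and `I` determine a real-linear map, so real differentiability alone supplies
a pair of Wirtinger coefficients, and `HasW` can carry all later calculus. -/
theorem eq_wlin (L : ℂ →L[ℝ] ℂ) :
    L = wlin ((1 / 2) * (L 1 - Complex.I * L Complex.I))
      ((1 / 2) * (L 1 + Complex.I * L Complex.I)) := by
  apply clm_ext_one_I
  · rw [wlin_apply]; simp; ring
  · rw [wlin_apply]; simp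
    linear_combination (L Complex.I) * Complex.I_sq

/-- `f` is real differentiable at `z` with `f_z = a` and `f_z̄ = b`. -/
def HasW (f : ℂ → ℂ) (a b z : ℂ) : Prop := HasFDerivAt f (wlin a b) z

theorem HasW.wz_eq {f : ℂ → ℂ} {a b z : ℂ} (h : HasW f a b z) : wz f z = a := by
  unfold wz
  rw [h.fderiv, wlin_apply, wlin_apply]
  simp only [smul_eq_mul, map_one, Complex.conj_I]
  linear_combination (1 / 2 * (b - a)) * Complex.I_sq

theorem HasW.wzb_eq {f : ℂ → ℂ} {a b z : ℂ} (h : HasW f a b z) : wzb f z = b := by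
  unfold wzb
  rw [h.fderiv, wlin_apply, wlin_apply]
  simp only [smul_eq_mul, map_one, Complex.conj_I]
  linear_combination (1 / 2 * (a - b)) * Complex.I_sq

theorem hasW_of_differentiableAt {f : ℂ → ℂ} {z : ℂ} (h : DifferentiableAt ℝ f z) :
    HasW f (wz f z) (wzb f z) z := by
  have := h.hasFDerivAt
  rw [eq_wlin (fderiv ℝ f z)] at this
  exact this

theorem HasW.differentiableAt {f : ℂ → ℂ} {a b z : ℂ} (h : HasW f a b z) :
    DifferentiableAt ℝ f z := HasFDerivAt.differentiableAt h

theorem HasW.congr {f g : ℂ → ℂ} {a b z : ℂ} (h : HasW f a b z) (e : g =ᶠ[nhds z] f) :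
    HasW g a b z := HasFDerivAt.congr_of_eventuallyEq h e

theorem HasW.of_eq {f : ℂ → ℂ} {a b a' b' z : ℂ} (h : HasW f a b z) (ha : a = a') (hb : b = b') :
    HasW f a' b' z := by rw [← ha, ← hb]; exact h

/-- Two computations of one derivative become two algebraic identities; relations between
coefficients are extracted this way throughout. -/
theorem HasW.unique {f : ℂ → ℂ} {a b a' b' z : ℂ} (h : HasW f a b z) (h' : HasW f a' b' z) :
    a = a' ∧ b = b' := ⟨h.wz_eq.symm.trans h'.wz_eq, h.wzb_eq.symm.trans h'.wzb_eq⟩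

theorem hasW_const (c z : ℂ) : HasW (fun _ => c) 0 0 z := by
  unfold HasW
  convert hasFDerivAt_const c z using 1
  refine ContinuousLinearMap.ext fun x => ?_
  simp [wlin]

theorem HasW.add {f g : ℂ → ℂ} {a b a' b' z : ℂ} (h : HasW f a b z) (h' : HasW g a' b' z) :
    HasW (fun w => f w + g w) (a + a') (b + b') z := by
  unfold HasW
  refine (HasFDerivAt.add h h').congr_fderiv ?_
  refine ContinuousLinearMap.ext fun x => ?_
  simp only [wlin_apply, add_apply]; ring

theorem HasW.mul {f g : ℂ → ℂ} {a b a' b' z : ℂ} (h : HasW f a b z) (h' : HasW g a' b' z) :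
    HasW (fun w => f w * g w) (a * g z + f z * a') (b * g z + f z * b') z := by
  unfold HasW
  refine (HasFDerivAt.mul h h').congr_fderiv ?_
  refine ContinuousLinearMap.ext fun x => ?_
  simp only [wlin_apply, add_apply, smul_apply,
    smul_eq_mul]
  ring

theorem HasW.const_mul {f : ℂ → ℂ} {a b z : ℂ} (c : ℂ) (h : HasW f a b z) :
    HasW (fun w => c * f w) (c * a) (c * b) z :=
  ((hasW_const c z).mul h).of_eq (by ring) (by ring)

theorem HasW.neg {f : ℂ → ℂ} {a b z : ℂ} (h : HasW f a b z) :
    HasW (fun w => -f w) (-a) (-b) z := by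
  have := h.const_mul (-1)
  simpa using this

theorem HasW.sub {f g : ℂ → ℂ} {a b a' b' z : ℂ} (h : HasW f a b z) (h' : HasW g a' b' z) :
    HasW (fun w => f w - g w) (a - a') (b - b') z := by
  simpa [sub_eq_add_neg] using h.add h'.neg

theorem HasW.comp_deriv {f g : ℂ → ℂ} {a b z g' : ℂ} (h : HasW f a b z)
    (hg : HasDerivAt g g' (f z)) : HasW (fun w => g (f w)) (g' * a) (g' * b) z := by
  unfold HasW
  have h2 : HasFDerivAt g (g' • (1 : ℂ →L[ℝ] ℂ)) (f z) := hg.complexToReal_fderiv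
  refine (HasFDerivAt.comp z h2 h).congr_fderiv ?_
  refine ContinuousLinearMap.ext fun x => ?_
  simp [wlin_apply]
  ring

theorem HasW.inv {f : ℂ → ℂ} {a b z : ℂ} (h : HasW f a b z) (hf : f z ≠ 0) :
    HasW (fun w => (f w)⁻¹) (-a / f z ^ 2) (-b / f z ^ 2) z :=
  (h.comp_deriv (hasDerivAt_inv hf)).of_eq (by field_simp) (by field_simp)

theorem HasW.div {f g : ℂ → ℂ} {a b a' b' z : ℂ} (h : HasW f a b z) (h' : HasW g a' b' z)
    (hg : g z ≠ 0) :
    HasW (fun w => f w / g w) ((a * g z - f z * a') / g z ^ 2)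
      ((b * g z - f z * b') / g z ^ 2) z := by
  simp only [div_eq_mul_inv]
  exact (h.mul (h'.inv hg)).of_eq (by field_simp; ring) (by field_simp; ring)

theorem HasW.conj {f : ℂ → ℂ} {a b z : ℂ} (h : HasW f a b z) :
    HasW (fun w => (starRingEnd ℂ) (f w)) ((starRingEnd ℂ) b) ((starRingEnd ℂ) a) z := by
  unfold HasW
  refine (HasFDerivAt.comp z (Complex.conjCLE : ℂ →L[ℝ] ℂ).hasFDerivAt h).congr_fderiv ?_
  refine ContinuousLinearMap.ext fun x => ?_
  simp [wlin_apply]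
  ring

theorem HasW.sum {ι : Type*} (s : Finset ι) {f : ι → ℂ → ℂ} {a b : ι → ℂ} {z : ℂ}
    (h : ∀ i ∈ s, HasW (f i) (a i) (b i) z) :
    HasW (fun w => ∑ i ∈ s, f i w) (∑ i ∈ s, a i) (∑ i ∈ s, b i) z := by
  classical
  induction s using Finset.induction_on with
  | empty => simpa using hasW_const 0 z
  | insert i s hi ih =>
    simp only [Finset.sum_insert hi]
    exact (h i (Finset.mem_insert_self _ _)).add (ih fun j hj => h j (Finset.mem_insert_of_mem hj))

theorem contDiffOn_fderiv_apply {F : Type*} [NormedAddCommGroup F] [NormedSpace ℝ F] {D : Set ℂ}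
    (hD : IsOpen D) {f : ℂ → F} (hf : ContDiffOn ℝ ∞ f D) (h : ℂ) :
    ContDiffOn ℝ ∞ (fun z => fderiv ℝ f z h) D :=
  (hf.fderiv_of_isOpen hD (by simp)).clm_apply contDiffOn_const

theorem contDiffOn_wz {D : Set ℂ} (hD : IsOpen D) {f : ℂ → ℂ} (hf : ContDiffOn ℝ ∞ f D) :
    ContDiffOn ℝ ∞ (wz f) D :=
  ((contDiffOn_fderiv_apply hD hf 1).sub
    ((contDiffOn_fderiv_apply hD hf Complex.I).const_smul Complex.I)).const_smul (1 / 2 : ℂ)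

theorem contDiffOn_wzb {D : Set ℂ} (hD : IsOpen D) {f : ℂ → ℂ} (hf : ContDiffOn ℝ ∞ f D) :
    ContDiffOn ℝ ∞ (wzb f) D :=
  ((contDiffOn_fderiv_apply hD hf 1).add
    ((contDiffOn_fderiv_apply hD hf Complex.I).const_smul Complex.I)).const_smul (1 / 2 : ℂ)

theorem contDiffOn_conj {D : Set ℂ} {f : ℂ → ℂ} (hf : ContDiffOn ℝ ∞ f D) :
    ContDiffOn ℝ ∞ (fun z => (starRingEnd ℂ) (f z)) D :=
  (Complex.conjCLE : ℂ →L[ℝ] ℂ).contDiff.comp_contDiffOn hf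

theorem contDiffOn_ofReal {D : Set ℂ} {f : ℂ → ℝ} (hf : ContDiffOn ℝ ∞ f D) :
    ContDiffOn ℝ ∞ (fun z => (f z : ℂ)) D :=
  Complex.ofRealCLM.contDiff.comp_contDiffOn hf

theorem hasW_of_contDiffOn {D : Set ℂ} (hD : IsOpen D) {f : ℂ → ℂ} (hf : ContDiffOn ℝ ∞ f D)
    {z : ℂ} (hz : z ∈ D) : HasW f (wz f z) (wzb f z) z :=
  hasW_of_differentiableAt ((hf.differentiableOn (by simp)).differentiableAt (hD.mem_nhds hz))

theorem wz_congr {f g : ℂ → ℂ} {z : ℂ} (e : f =ᶠ[nhds z] g) : wz f z = wz g z := by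
  unfold wz; rw [e.fderiv_eq]

theorem wzb_congr {f g : ℂ → ℂ} {z : ℂ} (e : f =ᶠ[nhds z] g) : wzb f z = wzb g z := by
  unfold wzb; rw [e.fderiv_eq]

/-- Mixed Wirtinger derivatives commute. -/
theorem wz_wzb_comm {D : Set ℂ} (hD : IsOpen D) {f : ℂ → ℂ} (hf : ContDiffOn ℝ ∞ f D)
    {z : ℂ} (hz : z ∈ D) : wz (wzb f) z = wzb (wz f) z := by
  have hs : IsSymmSndFDerivAt ℝ f z :=
    (hf.contDiffAt (hD.mem_nhds hz)).isSymmSndFDerivAt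
      (by simp only [minSmoothness_of_isRCLikeNormedField]; exact WithTop.coe_le_coe.2 le_top)
  have hd : DifferentiableAt ℝ (fderiv ℝ f) z :=
    ((hf.fderiv_of_isOpen hD (m := ∞) (by simp)).differentiableOn (by simp)).differentiableAt
      (hD.mem_nhds hz)
  have h1 : ∀ v : ℂ, HasFDerivAt (fun w => fderiv ℝ f w v)
      ((fderiv ℝ (fderiv ℝ f) z).flip v) z := fun v => by
    simpa using hd.hasFDerivAt.clm_apply (hasFDerivAt_const v z)
  have hb : HasFDerivAt (wzb f) ((1 / 2 : ℂ) • ((fderiv ℝ (fderiv ℝ f) z).flip 1 +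
      Complex.I • (fderiv ℝ (fderiv ℝ f) z).flip Complex.I)) z :=
    ((h1 1).add ((h1 Complex.I).const_smul Complex.I)).const_smul (1 / 2 : ℂ)
  have ha : HasFDerivAt (wz f) ((1 / 2 : ℂ) • ((fderiv ℝ (fderiv ℝ f) z).flip 1 -
      Complex.I • (fderiv ℝ (fderiv ℝ f) z).flip Complex.I)) z :=
    ((h1 1).sub ((h1 Complex.I).const_smul Complex.I)).const_smul (1 / 2 : ℂ)
  have e := hs 1 Complex.I
  unfold wz wzb at *
  rw [ha.fderiv, hb.fderiv]
  simp only [smul_apply, add_apply,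
    sub_apply, ContinuousLinearMap.flip_apply, smul_eq_mul, e]
  ring

/-! ### Entrywise Wirtinger derivatives of matrices -/

/-- The matrix function `X` has entrywise Wirtinger derivatives `A` and `B` at `z`. -/
def HasMW (X : ℂ → Matrix (Fin 3) (Fin 3) ℂ) (A B : Matrix (Fin 3) (Fin 3) ℂ) (z : ℂ) : Prop :=
  ∀ i j, HasW (fun w => X w i j) (A i j) (B i j) z

theorem hasMW_const (C : Matrix (Fin 3) (Fin 3) ℂ) (z : ℂ) : HasMW (fun _ => C) 0 0 z :=
  fun i j => hasW_const (C i j) z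

theorem HasMW.mul {X Y : ℂ → Matrix (Fin 3) (Fin 3) ℂ} {A B A' B' : Matrix (Fin 3) (Fin 3) ℂ}
    {z : ℂ} (h : HasMW X A B z) (h' : HasMW Y A' B' z) :
    HasMW (fun w => X w * Y w) (A * Y z + X z * A') (B * Y z + X z * B') z := by
  intro i j
  simp only [Matrix.mul_apply, Matrix.add_apply, ← Finset.sum_add_distrib]
  exact HasW.sum _ fun k _ => (h i k).mul (h' k j)

theorem HasMW.const_mul {X : ℂ → Matrix (Fin 3) (Fin 3) ℂ} {A B : Matrix (Fin 3) (Fin 3) ℂ}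
    {z : ℂ} (C : Matrix (Fin 3) (Fin 3) ℂ) (h : HasMW X A B z) :
    HasMW (fun w => C * X w) (C * A) (C * B) z := by
  simpa using (hasMW_const C z).mul h

theorem HasMW.mul_const {X : ℂ → Matrix (Fin 3) (Fin 3) ℂ} {A B : Matrix (Fin 3) (Fin 3) ℂ}
    {z : ℂ} (h : HasMW X A B z) (C : Matrix (Fin 3) (Fin 3) ℂ) :
    HasMW (fun w => X w * C) (A * C) (B * C) z := by
  simpa using h.mul (hasMW_const C z)

theorem HasMW.transpose {X : ℂ → Matrix (Fin 3) (Fin 3) ℂ} {A B : Matrix (Fin 3) (Fin 3) ℂ}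
    {z : ℂ} (h : HasMW X A B z) : HasMW (fun w => (X w)ᵀ) Aᵀ Bᵀ z := fun i j => h j i

theorem HasMW.conj {X : ℂ → Matrix (Fin 3) (Fin 3) ℂ} {A B : Matrix (Fin 3) (Fin 3) ℂ}
    {z : ℂ} (h : HasMW X A B z) :
    HasMW (fun w => (X w).map (starRingEnd ℂ)) (B.map (starRingEnd ℂ)) (A.map (starRingEnd ℂ)) z :=
  fun i j => (h i j).conj

theorem HasMW.congr {X Y : ℂ → Matrix (Fin 3) (Fin 3) ℂ} {A B : Matrix (Fin 3) (Fin 3) ℂ}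
    {z : ℂ} (h : HasMW X A B z) (e : Y =ᶠ[nhds z] X) : HasMW Y A B z := fun i j =>
  (h i j).congr (e.mono fun w hw => by simp only [hw])

theorem HasMW.of_eq {X : ℂ → Matrix (Fin 3) (Fin 3) ℂ} {A B A' B' : Matrix (Fin 3) (Fin 3) ℂ}
    {z : ℂ} (h : HasMW X A B z) (ha : A = A') (hb : B = B') : HasMW X A' B' z := by
  rw [← ha, ← hb]; exact h

theorem HasMW.unique {X : ℂ → Matrix (Fin 3) (Fin 3) ℂ} {A B A' B' : Matrix (Fin 3) (Fin 3) ℂ}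
    {z : ℂ} (h : HasMW X A B z) (h' : HasMW X A' B' z) : A = A' ∧ B = B' :=
  ⟨by ext i j; exact ((h i j).unique (h' i j)).1, by ext i j; exact ((h i j).unique (h' i j)).2⟩

/-- If `dX = 0` on a connected open set, then `X` is constant there. -/
theorem hasMW_zero_const {D : Set ℂ} (hD : IsOpen D) (hDc : IsPreconnected D)
    {X : ℂ → Matrix (Fin 3) (Fin 3) ℂ} (h : ∀ z ∈ D, HasMW X 0 0 z) {z w : ℂ} (hz : z ∈ D)
    (hw : w ∈ D) : X z = X w := by
  ext i j
  have hw0 : wlin 0 0 = 0 := by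
    refine ContinuousLinearMap.ext fun x => ?_
    simp [wlin]
  refine hD.is_const_of_fderiv_eq_zero (𝕜 := ℝ) (f := fun w => X w i j) hDc
    (fun y hy => (h y hy i j).differentiableAt.differentiableWithinAt) (fun y hy => ?_) hz hw
  have := h y hy i j
  exact (HasFDerivAt.fderiv this).trans hw0

/-! ### Linear ordinary differential equations -/

section LinearODE

open Set MeasureTheory

variable {F : Type*} [NormedAddCommGroup F] [NormedSpace ℝ F]

/-- The terms of the Picard series of the linear equation `x' = b(t) x`, `x 0 = v`. -/
def picardTerm (b : ℝ → F →L[ℝ] F) (v : F) : ℕ → ℝ → F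
  | 0 => fun _ => v
  | n + 1 => fun t => ∫ s in (0 : ℝ)..t, b s (picardTerm b v n s)

theorem continuous_picardTerm [CompleteSpace F] {b : ℝ → F →L[ℝ] F} (hb : Continuous b) (v : F)
    (n : ℕ) : Continuous (picardTerm b v n) := by
  induction n with
  | zero => exact continuous_const
  | succ n ih =>
    have hc : Continuous fun s => b s (picardTerm b v n s) := hb.clm_apply ih
    exact continuous_iff_continuousAt.2 fun t =>
      (hc.integral_hasStrictDerivAt 0 t).hasDerivAt.continuousAt

theorem hasDerivAt_picardTerm [CompleteSpace F] {b : ℝ → F →L[ℝ] F} (hb : Continuous b) (v : F)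
    (n : ℕ) (t : ℝ) : HasDerivAt (picardTerm b v (n + 1)) (b t (picardTerm b v n t)) t :=
  ((hb.clm_apply (continuous_picardTerm hb v n)).integral_hasStrictDerivAt 0 t).hasDerivAt

/-- Each integration turns `|s|ⁿ/n!` into `|t|ⁿ⁺¹/(n+1)!` and brings one factor `M`. The factorial
makes the series and its termwise derivative converge uniformly on bounded intervals. -/
theorem norm_picardTerm_le [CompleteSpace F] {b : ℝ → F →L[ℝ] F} (hb : Continuous b) (v : F)
    {M : ℝ} (hM : ∀ t, ‖b t‖ ≤ M) (n : ℕ) (t : ℝ) :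
    ‖picardTerm b v n t‖ ≤ ‖v‖ * (M ^ n * |t| ^ n / n.factorial) := by
  have hM0 : 0 ≤ M := (norm_nonneg _).trans (hM 0)
  induction n generalizing t with
  | zero => simp [picardTerm]
  | succ n ih =>
    have hc : Continuous fun s => b s (picardTerm b v n s) :=
      hb.clm_apply (continuous_picardTerm hb v n)
    -- The unordered interval keeps the estimate valid for negative `t`, which the open ball used
    -- for the series contains.
    calc ‖picardTerm b v (n + 1) t‖
        ≤ ∫ s in uIoc (0 : ℝ) t, ‖b s (picardTerm b v n s)‖ :=
          intervalIntegral.norm_integral_le_integral_norm_uIoc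
      _ ≤ ∫ s in uIoc (0 : ℝ) t, (‖v‖ * (M ^ (n + 1) / n.factorial)) * |s - 0| ^ n := by
          refine setIntegral_mono_on ?_ ?_ measurableSet_uIoc fun s _ => ?_
          · exact (hc.norm.intervalIntegrable 0 t).def'
          · exact ((by fun_prop : Continuous fun s : ℝ =>
              (‖v‖ * (M ^ (n + 1) / n.factorial)) * |s - 0| ^ n).intervalIntegrable 0 t).def'
          · calc ‖b s (picardTerm b v n s)‖ ≤ ‖b s‖ * ‖picardTerm b v n s‖ := (b s).le_opNorm _
              _ ≤ M * (‖v‖ * (M ^ n * |s| ^ n / n.factorial)) := by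
                  gcongr
                  · exact hM s
                  · exact ih s
              _ = _ := by rw [sub_zero]; ring
      _ = _ := by
          rw [integral_const_mul, integral_pow_abs_sub_uIoc, sub_zero, Nat.factorial_succ]
          push_cast
          field_simp

theorem exists_hasDerivAt_linear_of_bounded [CompleteSpace F] {b : ℝ → F →L[ℝ] F}
    (hb : Continuous b) {M : ℝ} (hM : ∀ t, ‖b t‖ ≤ M) (v : F) :
    ∃ x : ℝ → F, x 0 = v ∧ ∀ t ∈ Icc (0 : ℝ) 1, HasDerivAt x (b t (x t)) t := by
  have hM0 : 0 ≤ M := (norm_nonneg _).trans (hM 0)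
  have hsum : Summable fun n : ℕ => ‖v‖ * ((M * 2) ^ n / n.factorial) :=
    (Real.summable_pow_div_factorial (M * 2)).mul_left _
  have hbd : ∀ n : ℕ, ∀ t ∈ Metric.ball (0 : ℝ) 2,
      ‖picardTerm b v n t‖ ≤ ‖v‖ * ((M * 2) ^ n / n.factorial) := fun n t ht => by
    refine (norm_picardTerm_le hb v hM n t).trans ?_
    rw [mul_pow]
    have : |t| ≤ 2 := by simpa using (mem_ball_zero_iff.1 ht).le
    gcongr
  have hs : ∀ t ∈ Metric.ball (0 : ℝ) 2, Summable fun n => picardTerm b v n t := fun t ht =>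
    Summable.of_norm_bounded hsum fun n => hbd n t ht
  have h0 : ∀ n, picardTerm b v (n + 1) 0 = 0 := fun n => by simp [picardTerm]
  -- The initial value is split off because only the later terms are integrals vanishing at `0`. The
  -- term of index `n + 1` has derivative `b` applied to the term of index `n`, so the
  -- differentiated series is `b` of the full sum.
  refine ⟨fun t => v + ∑' n, picardTerm b v (n + 1) t, by simp [h0], fun t ht => ?_⟩
  -- Radius `2` only places `[0, 1]` inside an open connected set, so that the derivatives at the
  -- endpoints are two-sided.
  have htb : t ∈ Metric.ball (0 : ℝ) 2 := by
    rw [mem_ball_zero_iff, Real.norm_eq_abs, abs_of_nonneg ht.1]; linarith [ht.2]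
  have key := hasDerivAt_tsum_of_isPreconnected (hsum.mul_left M) Metric.isOpen_ball
    (convex_ball (0 : ℝ) 2).isPreconnected
    (fun n y _ => hasDerivAt_picardTerm hb v n y)
    (fun n y hy => ((b y).le_opNorm _).trans
      (mul_le_mul (hM y) (hbd n y hy) (norm_nonneg _) hM0))
    (Metric.mem_ball_self (by norm_num)) (by simp [h0, summable_zero]) htb
  refine (key.const_add v).congr_deriv ?_
  rw [← ContinuousLinearMap.map_tsum _ (hs t htb), (hs t htb).tsum_eq_zero_add]
  rfl

/-- A linear equation with continuous coefficients on `[0, 1]` has a solution on `[0, 1]`. -/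
theorem exists_hasDerivAt_linear [CompleteSpace F] {a : ℝ → F →L[ℝ] F}
    (ha : ContinuousOn a (Icc 0 1)) (v : F) :
    ∃ x : ℝ → F, x 0 = v ∧ ∀ t ∈ Icc (0 : ℝ) 1, HasDerivAt x (a t (x t)) t := by
  obtain ⟨M, hM⟩ := isCompact_Icc.exists_bound_of_continuousOn ha
  -- Extension by the endpoint values keeps the bound and makes the coefficient continuous on the
  -- whole line.
  have hb : Continuous (IccExtend (zero_le_one' ℝ) (domRestrict (Icc 0 1) a)) :=
    (continuousOn_iff_continuous_domRestrict.1 ha).Icc_extend'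
  obtain ⟨x, h0, hx⟩ := exists_hasDerivAt_linear_of_bounded hb (M := M)
    (fun t => hM _ (projIcc 0 1 (zero_le_one' ℝ) t).2) v
  refine ⟨x, h0, fun t ht => ?_⟩
  have := hx t ht
  rwa [IccExtend_of_mem (zero_le_one' ℝ) _ ht] at this

/-- Grönwall's inequality for an approximate solution of a linear equation. -/
theorem norm_sub_le_of_approx_linear {a : ℝ → F →L[ℝ] F} {x y y' : ℝ → F} {M ε : ℝ}
    (hM : 0 < M) (ha : ∀ t ∈ Icc (0 : ℝ) 1, ‖a t‖ ≤ M)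
    (hx : ∀ t ∈ Icc (0 : ℝ) 1, HasDerivAt x (a t (x t)) t)
    (hy : ∀ t ∈ Icc (0 : ℝ) 1, HasDerivAt y (y' t) t)
    (herr : ∀ t ∈ Icc (0 : ℝ) 1, ‖y' t - a t (y t)‖ ≤ ε) (h0 : x 0 = y 0) {t : ℝ}
    (ht : t ∈ Icc (0 : ℝ) 1) :
    ‖x t - y t‖ ≤ ε / M * (Real.exp (M * t) - 1) := by
  have h := norm_le_gronwallBound_of_norm_deriv_right_le (f := fun t => x t - y t)
    (f' := fun t => a t (x t) - y' t) (δ := 0) (K := M) (ε := ε) (a := 0) (b := 1)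
    (fun t ht => ((hx t ht).sub (hy t ht)).continuousAt.continuousWithinAt)
    (fun t ht => ((hx t (Ico_subset_Icc_self ht)).sub
      (hy t (Ico_subset_Icc_self ht))).hasDerivWithinAt) (by simp [h0])
    (fun t ht => by
      have ht' := Ico_subset_Icc_self ht
      calc ‖a t (x t) - y' t‖ = ‖a t (x t - y t) - (y' t - a t (y t))‖ := by
            rw [map_sub]; congr 1; abel
        _ ≤ ‖a t (x t - y t)‖ + ‖y' t - a t (y t)‖ := norm_sub_le _ _
        _ ≤ M * ‖x t - y t‖ + ε := by
            refine add_le_add (((a t).le_opNorm _).trans ?_) (herr t ht')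
            gcongr
            exact ha t ht') t ht
  rw [gronwallBound_of_K_ne_0 hM.ne'] at h
  simpa using h

/-- Grönwall's estimate with zero defect. -/
theorem linear_ode_unique {a : ℝ → F →L[ℝ] F} (ha : ContinuousOn a (Icc 0 1)) {x y : ℝ → F}
    (hx : ∀ t ∈ Icc (0 : ℝ) 1, HasDerivAt x (a t (x t)) t)
    (hy : ∀ t ∈ Icc (0 : ℝ) 1, HasDerivAt y (a t (y t)) t) (h0 : x 0 = y 0) {t : ℝ}
    (ht : t ∈ Icc (0 : ℝ) 1) : x t = y t := by
  obtain ⟨M, hM⟩ := isCompact_Icc.exists_bound_of_continuousOn ha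
  -- The estimate divides by the constant, which is therefore made strictly positive.
  have hMp : 0 < |M| + 1 := by positivity
  have h := norm_sub_le_of_approx_linear hMp
    (fun t ht => (hM t ht).trans ((le_abs_self M).trans (by linarith))) hx hy (ε := 0)
    (by simp) h0 ht
  rw [zero_div, zero_mul] at h
  exact sub_eq_zero.1 (norm_le_zero_iff.1 h)

/-- Grönwall's bound for a function with `‖df‖ ≤ M ‖f‖` on a ball. -/
theorem norm_le_of_norm_fderiv_le_mul {E : Type*} [NormedAddCommGroup E] [NormedSpace ℝ E]
    {f : E → F} {f' : E → E →L[ℝ] F} {z₀ : E} {r M : ℝ} (hM : 0 ≤ M)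
    (hf : ∀ z ∈ Metric.ball z₀ r, HasFDerivAt f (f' z) z)
    (hb : ∀ z ∈ Metric.ball z₀ r, ‖f' z‖ ≤ M * ‖f z‖) {z : E} (hz : z ∈ Metric.ball z₀ r) :
    ‖f z‖ ≤ ‖f z₀‖ * Real.exp (M * r) := by
  have hr : 0 < r := Metric.pos_of_mem_ball hz
  have hzn : ‖z - z₀‖ ≤ r := by rw [← dist_eq_norm]; exact (Metric.mem_ball.1 hz).le
  have hmem : ∀ t ∈ Icc (0 : ℝ) 1, z₀ + t • (z - z₀) ∈ Metric.ball z₀ r := fun t ht => by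
    rw [Metric.mem_ball, dist_eq_norm, add_sub_cancel_left, norm_smul, Real.norm_eq_abs,
      abs_of_nonneg ht.1]
    calc t * ‖z - z₀‖ ≤ 1 * ‖z - z₀‖ := by gcongr; exact ht.2
      _ = dist z z₀ := by rw [one_mul, dist_eq_norm]
      _ < r := hz
  have hd : ∀ t ∈ Icc (0 : ℝ) 1, HasDerivAt (fun t : ℝ => f (z₀ + t • (z - z₀)))
      (f' (z₀ + t • (z - z₀)) (z - z₀)) t := fun t ht => by
    refine (hf _ (hmem t ht)).comp_hasDerivAt t ?_
    simpa using ((hasDerivAt_id t).smul_const (z - z₀)).const_add z₀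
  have h := norm_le_gronwallBound_of_norm_deriv_right_le
    (f := fun t : ℝ => f (z₀ + t • (z - z₀))) (δ := ‖f z₀‖) (K := M * r) (ε := 0)
    (a := 0) (b := 1) (fun t ht => (hd t ht).continuousAt.continuousWithinAt)
    (fun t ht => (hd t (Ico_subset_Icc_self ht)).hasDerivWithinAt) (by simp)
    (fun t ht => by
      have ht' := Ico_subset_Icc_self ht
      calc _ ≤ ‖f' (z₀ + t • (z - z₀))‖ * ‖z - z₀‖ := ContinuousLinearMap.le_opNorm _ _
        _ ≤ (M * ‖f (z₀ + t • (z - z₀))‖) * r := by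
            gcongr
            exact hb _ (hmem t ht')
        _ = _ := by ring) 1 (by simp)
  rw [gronwallBound_ε0] at h
  simpa using h

/-- A `C¹` function is uniformly differentiable along a compact subset of its open domain. -/
theorem eventually_forall_norm_sub_sub_fderiv_le {E G : Type*} [NormedAddCommGroup E]
    [NormedSpace ℝ E] [NormedAddCommGroup G] [NormedSpace ℝ G] {V K : Set E} (hV : IsOpen V)
    {f : E → G} (hf : ContDiffOn ℝ 1 f V) (hK : IsCompact K) (hKV : K ⊆ V) {ε : ℝ} (hε : 0 < ε) :
    ∀ᶠ k in nhds (0 : E), ∀ w ∈ K, ‖f (w + k) - f w - fderiv ℝ f w k‖ ≤ ε * ‖k‖ := by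
  refine hK.eventually_forall_of_forall_eventually fun x hx => ?_
  have hfx : ContDiffAt ℝ 1 f x := hf.contDiffAt (hV.mem_nhds (hKV hx))
  have hs := (hfx.hasStrictFDerivAt one_ne_zero).isLittleO.def (half_pos hε)
  have ht : Filter.Tendsto (fun p : E × E => (p.2 + p.1, p.2)) (nhds (0, x)) (nhds (x, x)) := by
    have : Continuous fun p : E × E => (p.2 + p.1, p.2) := by fun_prop
    simpa using this.tendsto (0, x)
  have hc : ContinuousAt (fderiv ℝ f) x :=
    (hfx.fderiv_right (m := 0) (by simp)).continuousAt
  have hc' : ∀ᶠ p : E × E in nhds (0, x), ‖fderiv ℝ f p.2 - fderiv ℝ f x‖ ≤ ε / 2 := by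
    have h2 : Filter.Tendsto (fun p : E × E => p.2) (nhds (0, x)) (nhds x) :=
      continuous_snd.tendsto (0, x)
    have := (hc.tendsto.comp h2).eventually (Metric.closedBall_mem_nhds _ (half_pos hε))
    exact this.mono fun p hp => by simpa [dist_eq_norm] using hp
  filter_upwards [ht.eventually hs, hc'] with p h1 h2
  simp only [add_sub_cancel_left] at h1
  calc ‖f (p.2 + p.1) - f p.2 - fderiv ℝ f p.2 p.1‖
      = ‖(f (p.2 + p.1) - f p.2 - fderiv ℝ f x p.1) - (fderiv ℝ f p.2 - fderiv ℝ f x) p.1‖ := by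
        congr 1; simp only [sub_apply]; abel
    _ ≤ ε / 2 * ‖p.1‖ + ε / 2 * ‖p.1‖ := by
        refine (norm_sub_le _ _).trans (add_le_add h1 ?_)
        refine (ContinuousLinearMap.le_opNorm _ _).trans ?_
        gcongr
    _ = ε * ‖p.1‖ := by ring

end LinearODE

/-! ### Frobenius' theorem along rays, and holomorphic dependence on a parameter. -/

section Rays

open Set

variable {E F : Type*} [NormedAddCommGroup E] [NormedSpace ℝ E]

/-- The defect of the trial solution `x + t W h x` on the ray to `z + h`. Flatness cancels
everything of first order in `h`; what remains is quadratic in `h` or contains the Taylor remainder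
`W' - W - D (t h)`. -/
theorem flat_remainder [NormedAddCommGroup F] [NormedSpace ℝ F] {W W' : E →L[ℝ] F →L[ℝ] F}
    {D : E →L[ℝ] E →L[ℝ] F →L[ℝ] F} {z h : E} {t : ℝ} (x : F)
    (flat : D z h + W h ∘L W z = D h z + W z ∘L W h) :
    W z x + (W h x + t • (D z h x + W h (W z x))) - W' (z + h) (x + t • W h x) =
      -(t • D h h x + (W' - W - D (t • h)) (z + h) x + t • W h (W h x)
        + t • t • D h (z + h) (W h x) + t • (W' - W - D (t • h)) (z + h) (W h x)) := by
  have e : D z h x + W h (W z x) = D h z x + W z (W h x) := by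
    simpa using congrArg (fun L => L x) flat
  rw [e]
  simp only [map_add, map_smul, add_apply, sub_apply, smul_apply, smul_sub, smul_add]
  module

theorem exists_norm_fderiv_apply_le {G : Type*} [NormedAddCommGroup G] [NormedSpace ℝ G]
    {V K : Set E} (hV : IsOpen V) {f : E → G} (hf : ContDiffOn ℝ 1 f V) (hK : IsCompact K)
    (hKV : K ⊆ V) : ∃ M, 0 ≤ M ∧ ∀ w ∈ K, ∀ k, ‖fderiv ℝ f w k‖ ≤ M * ‖k‖ := by
  obtain ⟨M, hM⟩ :=
    hK.exists_bound_of_continuousOn ((hf.continuousOn_fderiv_of_isOpen hV le_rfl).mono hKV)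
  refine ⟨|M|, abs_nonneg M, fun w hw k => (ContinuousLinearMap.le_opNorm _ _).trans ?_⟩
  gcongr
  exact (hM w hw).trans (le_abs_self M)

theorem hasDerivAt_comp_smul {G : Type*} [NormedAddCommGroup G] [NormedSpace ℝ G] {f : E → G}
    {z : E} {t : ℝ} (hf : DifferentiableAt ℝ f (t • z)) :
    HasDerivAt (fun t : ℝ => f (t • z)) (fderiv ℝ f (t • z) z) t := by
  refine hf.hasFDerivAt.comp_hasDerivAt t ?_
  simpa using (hasDerivAt_id t).smul_const z

/-- Frobenius' theorem for a flat linear connection `θ` on a star-shaped domain: the function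
obtained by solving `x' = θ(z) x` along the rays from the origin is parallel. -/
theorem hasFDerivAt_of_flat [NormedAddCommGroup F] [NormedSpace ℝ F] {V : Set E} (hV : IsOpen V)
    (hs : StarConvex ℝ 0 V) {θ : E → E →L[ℝ] F →L[ℝ] F} (hθ : ContDiffOn ℝ 1 θ V)
    (flat : ∀ z ∈ V, ∀ h k, fderiv ℝ θ z h k + θ z k ∘L θ z h =
      fderiv ℝ θ z k h + θ z h ∘L θ z k)
    {v : F} {x : E → ℝ → F} (hx0 : ∀ z ∈ V, x z 0 = v)
    (hx : ∀ z ∈ V, ∀ t ∈ Icc (0 : ℝ) 1, HasDerivAt (x z) (θ (t • z) z (x z t)) t)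
    {z : E} (hz : z ∈ V) : HasFDerivAt (fun w => x w 1) ((θ z).flip (x z 1)) z := by
  have hray : ∀ y ∈ V, ∀ t ∈ Icc (0 : ℝ) 1, t • y ∈ V := fun y hy t ht =>
    hs.smul_mem hy ht.1 ht.2
  have hcont : Continuous fun t : ℝ => t • z := by fun_prop
  have hK : IsCompact ((fun t : ℝ => t • z) '' Icc 0 1) := isCompact_Icc.image hcont
  have hKV : (fun t : ℝ => t • z) '' Icc 0 1 ⊆ V := by
    rintro _ ⟨t, ht, rfl⟩; exact hray z hz t ht
  obtain ⟨M₁, hM₁⟩ := hK.exists_bound_of_continuousOn (f := θ) (hθ.continuousOn.mono hKV)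
  obtain ⟨M₂, hM₂0, hM₂⟩ := exists_norm_fderiv_apply_le hV hθ hK hKV
  obtain ⟨C, hC⟩ := (isCompact_Icc (a := (0 : ℝ)) (b := 1)).exists_bound_of_continuousOn
    (f := x z) (fun t ht => (hx z hz t ht).continuousAt.continuousWithinAt)
  have h01 : (0 : ℝ) ∈ Icc (0 : ℝ) 1 := by simp
  have hC0 : 0 ≤ C := (norm_nonneg _).trans (hC 0 h01)
  have hM₁0 : 0 ≤ M₁ := (norm_nonneg _).trans (hM₁ _ ⟨0, h01, rfl⟩)
  rw [hasFDerivAt_iff_isLittleO_nhds_zero, Asymptotics.isLittleO_iff]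
  intro ε hε
  -- `M` bounds the coefficient along all nearby rays: `M₁` for the connection on the central ray,
  -- `M₂` for its first-order change, `1` for the Taylor remainder, `‖z‖ + 1` for the direction, and
  -- a last `1` for positivity. `P` and `Q` collect the parts of the defect that are small through
  -- the Taylor remainder and through `‖h‖`; `η` and `κ` make each part cost at most `ε / 2`.
  set M : ℝ := (M₁ + M₂ + 1) * (‖z‖ + 1) + 1 with hMdef
  have hM : 0 < M := by positivity
  set G : ℝ := (Real.exp M - 1) / M with hG
  have hG0 : 0 ≤ G := div_nonneg (by linarith [Real.add_one_le_exp M]) hM.le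
  set P : ℝ := (‖z‖ + 1) * C * (1 + M₁) with hP
  set Q : ℝ := C * (M₂ + M₁ * M₁ + M₂ * (‖z‖ + 1) * M₁) with hQ
  have hP0 : 0 ≤ P := by positivity
  have hQ0 : 0 ≤ Q := by positivity
  set η : ℝ := min 1 (ε / (2 * (P + 1) * (G + 1))) with hη
  have hη0 : 0 < η := by positivity
  set κ : ℝ := ε / (2 * (Q + 1) * (G + 1)) with hκ
  have hκ0 : 0 < κ := by positivity
  obtain ⟨δ, hδ, hδu⟩ := Metric.eventually_nhds_iff.1
    (eventually_forall_norm_sub_sub_fderiv_le hV hθ hK hKV hη0)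
  have hVz : ∀ᶠ h in nhds (0 : E), z + h ∈ V := by
    have : Filter.Tendsto (fun h => z + h) (nhds 0) (nhds z) := by
      simpa using (continuous_const_add z).tendsto 0
    exact this.eventually (hV.mem_nhds hz)
  filter_upwards [hVz, Metric.ball_mem_nhds (0 : E) hδ, Metric.ball_mem_nhds (0 : E) one_pos,
    Metric.ball_mem_nhds (0 : E) hκ0] with h hhV hhδ hh1 hhκ
  rw [mem_ball_zero_iff] at hhδ hh1 hhκ
  have hρ : ∀ t ∈ Icc (0 : ℝ) 1, ‖θ (t • (z + h)) - θ (t • z) - fderiv ℝ θ (t • z) (t • h)‖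
      ≤ η * ‖h‖ := fun t ht => by
    have hth : ‖t • h‖ ≤ ‖h‖ := by
      rw [norm_smul, Real.norm_eq_abs, abs_of_nonneg ht.1]
      exact mul_le_of_le_one_left (norm_nonneg _) ht.2
    have := hδu (y := t • h) (by rw [dist_zero_right]; exact hth.trans_lt hhδ) (t • z)
      ⟨t, ht, rfl⟩
    rw [← smul_add] at this
    exact this.trans (by gcongr)
  have hzh : ‖z + h‖ ≤ ‖z‖ + 1 := (norm_add_le _ _).trans (by linarith)
  have hη1 : η ≤ 1 := min_le_left _ _
  have ha : ∀ t ∈ Icc (0 : ℝ) 1, ‖θ (t • (z + h)) (z + h)‖ ≤ M := fun t ht => by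
    have e1 : ‖fderiv ℝ θ (t • z) (t • h)‖ ≤ M₂ := by
      refine (hM₂ _ ⟨t, ht, rfl⟩ _).trans ?_
      have h2 : ‖t • h‖ ≤ 1 := by
        rw [norm_smul, Real.norm_eq_abs, abs_of_nonneg ht.1]
        exact mul_le_one₀ ht.2 (norm_nonneg _) hh1.le
      calc _ ≤ M₂ * 1 := by gcongr
        _ = M₂ := mul_one _
    have e2 : ‖θ (t • (z + h))‖ ≤ M₁ + M₂ + 1 := by
      have h3 : θ (t • (z + h)) = θ (t • z) + fderiv ℝ θ (t • z) (t • h) +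
        (θ (t • (z + h)) - θ (t • z) - fderiv ℝ θ (t • z) (t • h)) := by abel
      rw [h3]
      refine (norm_add₃_le).trans (add_le_add (add_le_add (hM₁ _ ⟨t, ht, rfl⟩) e1) ?_)
      exact (hρ t ht).trans (mul_le_one₀ hη1 (norm_nonneg _) hh1.le)
    calc _ ≤ ‖θ (t • (z + h))‖ * ‖z + h‖ := ContinuousLinearMap.le_opNorm _ _
      _ ≤ (M₁ + M₂ + 1) * (‖z‖ + 1) := by gcongr
      _ ≤ M := by rw [hMdef]; linarith
  -- The trial solution: to first order in `h`, the value at `t (z + h)` of a parallel function with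
  -- value `x z t` at `t z`.
  have hy : ∀ t ∈ Icc (0 : ℝ) 1, HasDerivAt (fun t => x z t + t • θ (t • z) h (x z t))
      (θ (t • z) z (x z t) + (θ (t • z) h (x z t) +
        t • (fderiv ℝ θ (t • z) z h (x z t) + θ (t • z) h (θ (t • z) z (x z t))))) t :=
    fun t ht => by
    have h1 : HasDerivAt (fun t : ℝ => θ (t • z)) (fderiv ℝ θ (t • z) z) t :=
      hasDerivAt_comp_smul ((hθ.differentiableOn one_ne_zero).differentiableAt
        (hV.mem_nhds (hray z hz t ht)))
    have h2 : HasDerivAt (fun t : ℝ => θ (t • z) h) (fderiv ℝ θ (t • z) z h) t := by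
      simpa using h1.clm_apply (hasDerivAt_const t h)
    have h3 := h2.clm_apply (hx z hz t ht)
    have h4 := (hasDerivAt_id t).smul h3
    refine ((hx z hz t ht).add h4).congr_deriv ?_
    simp only [id_eq, one_smul]
    module
  have hxz : ∀ t ∈ Icc (0 : ℝ) 1, ‖x z t‖ ≤ C := hC
  have herr : ∀ t ∈ Icc (0 : ℝ) 1, ‖(θ (t • z) z (x z t) + (θ (t • z) h (x z t) +
        t • (fderiv ℝ θ (t • z) z h (x z t) + θ (t • z) h (θ (t • z) z (x z t))))) -
        θ (t • (z + h)) (z + h) (x z t + t • θ (t • z) h (x z t))‖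
      ≤ (η * P + ‖h‖ * Q) * ‖h‖ := fun t ht => by
    have hW : ‖θ (t • z)‖ ≤ M₁ := hM₁ _ ⟨t, ht, rfl⟩
    have htn : ‖t‖ ≤ 1 := by rw [Real.norm_eq_abs, abs_of_nonneg ht.1]; exact ht.2
    rw [flat_remainder (x z t) (flat (t • z) (hray z hz t ht) z h), norm_neg]
    set ρ := θ (t • (z + h)) - θ (t • z) - fderiv ℝ θ (t • z) (t • h)
    have hρt : ‖ρ‖ ≤ η * ‖h‖ := hρ t ht
    have hWh : ‖θ (t • z) h‖ ≤ M₁ * ‖h‖ := (ContinuousLinearMap.le_opNorm _ _).trans (by gcongr)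
    have hWhx : ‖θ (t • z) h (x z t)‖ ≤ M₁ * ‖h‖ * C :=
      (ContinuousLinearMap.le_opNorm _ _).trans (by gcongr; exact hxz t ht)
    have hDh : ‖fderiv ℝ θ (t • z) h‖ ≤ M₂ * ‖h‖ := hM₂ _ ⟨t, ht, rfl⟩ h
    have hρz : ‖ρ (z + h)‖ ≤ η * ‖h‖ * (‖z‖ + 1) :=
      (ContinuousLinearMap.le_opNorm _ _).trans (by gcongr)
    have hsm : ∀ y : F, ‖t • y‖ ≤ ‖y‖ := fun y => by
      rw [norm_smul]; exact mul_le_of_le_one_left (norm_nonneg _) htn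
    have b1 : ‖t • fderiv ℝ θ (t • z) h h (x z t)‖ ≤ M₂ * ‖h‖ * ‖h‖ * C :=
      (hsm _).trans ((ContinuousLinearMap.le_opNorm _ _).trans (by
        gcongr
        · exact (ContinuousLinearMap.le_opNorm _ _).trans (by gcongr)
        · exact hxz t ht))
    have b2 : ‖ρ (z + h) (x z t)‖ ≤ η * ‖h‖ * (‖z‖ + 1) * C :=
      (ContinuousLinearMap.le_opNorm _ _).trans (by gcongr; exact hxz t ht)
    have b3 : ‖t • θ (t • z) h (θ (t • z) h (x z t))‖ ≤ M₁ * ‖h‖ * (M₁ * ‖h‖ * C) :=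
      (hsm _).trans ((ContinuousLinearMap.le_opNorm _ _).trans (by gcongr))
    have b4 : ‖t • t • fderiv ℝ θ (t • z) h (z + h) (θ (t • z) h (x z t))‖
        ≤ M₂ * ‖h‖ * (‖z‖ + 1) * (M₁ * ‖h‖ * C) :=
      (hsm _).trans ((hsm _).trans ((ContinuousLinearMap.le_opNorm _ _).trans (by
        gcongr
        exact (ContinuousLinearMap.le_opNorm _ _).trans (by gcongr))))
    have b5 : ‖t • ρ (z + h) (θ (t • z) h (x z t))‖ ≤ η * ‖h‖ * (‖z‖ + 1) * (M₁ * 1 * C) :=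
      (hsm _).trans ((ContinuousLinearMap.le_opNorm _ _).trans (by
        gcongr
        exact hWhx.trans (by gcongr)))
    calc _ ≤ M₂ * ‖h‖ * ‖h‖ * C + η * ‖h‖ * (‖z‖ + 1) * C + M₁ * ‖h‖ * (M₁ * ‖h‖ * C)
          + M₂ * ‖h‖ * (‖z‖ + 1) * (M₁ * ‖h‖ * C) + η * ‖h‖ * (‖z‖ + 1) * (M₁ * 1 * C) := by
          refine (norm_add_le _ _).trans (add_le_add ?_ b5)
          refine (norm_add_le _ _).trans (add_le_add ?_ b4)
          exact norm_add₃_le.trans (add_le_add (add_le_add b1 b2) b3)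
      _ = _ := by rw [hP, hQ]; ring
  -- At `t = 1` the trial solution is the affine approximation `x z 1 + θ z h (x z 1)`, so this
  -- bound is the differentiability estimate.
  have hfin := norm_sub_le_of_approx_linear hM ha (hx (z + h) hhV) hy herr
    (by simp [hx0 z hz, hx0 _ hhV]) (t := 1) (by simp)
  simp only [one_smul, mul_one] at hfin
  rw [sub_sub, ContinuousLinearMap.flip_apply]
  refine hfin.trans ?_
  have e1 : (η * P + ‖h‖ * Q) * ‖h‖ / M * (Real.exp M - 1) = (η * P * G + ‖h‖ * Q * G) * ‖h‖ := by
    rw [hG]; ring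
  rw [e1]
  gcongr
  have k1 : η * P * G ≤ ε / 2 := by
    calc η * P * G ≤ ε / (2 * (P + 1) * (G + 1)) * (P + 1) * (G + 1) := by
          have := min_le_right 1 (ε / (2 * (P + 1) * (G + 1)))
          rw [← hη] at this
          gcongr <;> linarith
      _ = ε / 2 := by field_simp
  have k2 : ‖h‖ * Q * G ≤ ε / 2 := by
    calc ‖h‖ * Q * G ≤ κ * (Q + 1) * (G + 1) := by gcongr <;> linarith
      _ = ε / 2 := by rw [hκ]; field_simp
  linarith

/-- Solutions of `x' = (a₀ + λ a₁ + λ⁻¹ a₂) x` depend holomorphically on `λ ≠ 0`. -/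
theorem differentiableAt_linear_ode_param [NormedAddCommGroup F] [NormedSpace ℂ F]
    [CompleteSpace F] {a₀ a₁ a₂ : ℝ → F →L[ℝ] F} (h₀ : ContinuousOn a₀ (Icc 0 1))
    (h₁ : ContinuousOn a₁ (Icc 0 1)) (h₂ : ContinuousOn a₂ (Icc 0 1))
    (c₀ : ∀ t (c : ℂ) v, a₀ t (c • v) = c • a₀ t v) (c₁ : ∀ t (c : ℂ) v, a₁ t (c • v) = c • a₁ t v)
    (c₂ : ∀ t (c : ℂ) v, a₂ t (c • v) = c • a₂ t v) {v : F} {x : ℂ → ℝ → F}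
    (hx0 : ∀ lam, lam ≠ 0 → x lam 0 = v)
    (hx : ∀ lam, lam ≠ 0 → ∀ t ∈ Icc (0 : ℝ) 1,
      HasDerivAt (x lam) ((a₀ t + lam • a₁ t + lam⁻¹ • a₂ t) (x lam t)) t)
    {lam : ℂ} (hl : lam ≠ 0) : DifferentiableAt ℂ (fun l => x l 1) lam := by
  set a : ℝ → F →L[ℝ] F := fun t => a₀ t + lam • a₁ t + lam⁻¹ • a₂ t with haDef
  set a' : ℝ → F →L[ℝ] F := fun t => a₁ t - (lam⁻¹ ^ 2) • a₂ t with haDef'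
  have ha : ContinuousOn a (Icc 0 1) := (h₀.add (h₁.const_smul lam)).add (h₂.const_smul lam⁻¹)
  have ha' : ContinuousOn a' (Icc 0 1) := h₁.sub (h₂.const_smul (lam⁻¹ ^ 2))
  -- The equation is coupled with the variational equation `y' = a y + a' x`, `y 0 = 0`, where `a' =
  -- a₁ - λ⁻² a₂`. The block system on `F × F` produces the candidate for the `λ`-derivative.
  have hb : ContinuousOn (fun t => ((a t).comp (ContinuousLinearMap.fst ℝ F F)).prod
      ((a t).comp (ContinuousLinearMap.snd ℝ F F) + (a' t).comp (ContinuousLinearMap.fst ℝ F F)))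
      (Icc 0 1) := by
    have e : ∀ t, ((a t).comp (ContinuousLinearMap.fst ℝ F F)).prod
      ((a t).comp (ContinuousLinearMap.snd ℝ F F) + (a' t).comp (ContinuousLinearMap.fst ℝ F F)) =
      (ContinuousLinearMap.inl ℝ F F).comp ((a t).comp (ContinuousLinearMap.fst ℝ F F)) +
      (ContinuousLinearMap.inr ℝ F F).comp ((a t).comp (ContinuousLinearMap.snd ℝ F F) +
        (a' t).comp (ContinuousLinearMap.fst ℝ F F)) := fun t => by ext <;> simp
    simp only [e]
    exact (continuousOn_const.clm_comp (ha.clm_comp continuousOn_const)).add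
      (continuousOn_const.clm_comp ((ha.clm_comp continuousOn_const).add
        (ha'.clm_comp continuousOn_const)))
  obtain ⟨w, hw0, hw⟩ := exists_hasDerivAt_linear hb (v, 0)
  have hw1 : ∀ t ∈ Icc (0 : ℝ) 1, HasDerivAt (fun t => (w t).1) (a t (w t).1) t := fun t ht =>
    (hw t ht).fst
  have hw2 : ∀ t ∈ Icc (0 : ℝ) 1,
      HasDerivAt (fun t => (w t).2) (a t (w t).2 + a' t (w t).1) t := fun t ht => (hw t ht).snd
  have hxw : ∀ t ∈ Icc (0 : ℝ) 1, x lam t = (w t).1 := fun t ht =>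
    linear_ode_unique ha (hx lam hl) hw1 (by rw [hx0 lam hl, hw0]) ht
  obtain ⟨C, hC⟩ := (isCompact_Icc (a := (0 : ℝ)) (b := 1)).exists_bound_of_continuousOn
    (f := w) (fun t ht => (hw t ht).continuousAt.continuousWithinAt)
  obtain ⟨N₀, hN₀⟩ := isCompact_Icc.exists_bound_of_continuousOn h₀
  obtain ⟨N₁, hN₁⟩ := isCompact_Icc.exists_bound_of_continuousOn h₁
  obtain ⟨N₂, hN₂⟩ := isCompact_Icc.exists_bound_of_continuousOn h₂
  obtain ⟨N₃, hN₃⟩ := isCompact_Icc.exists_bound_of_continuousOn ha'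
  have h01 : (0 : ℝ) ∈ Icc (0 : ℝ) 1 := by simp
  have hC0 : 0 ≤ C := (norm_nonneg _).trans (hC 0 h01)
  have hN₀0 : 0 ≤ N₀ := (norm_nonneg _).trans (hN₀ _ h01)
  have hN₁0 : 0 ≤ N₁ := (norm_nonneg _).trans (hN₁ _ h01)
  have hN₂0 : 0 ≤ N₂ := (norm_nonneg _).trans (hN₂ _ h01)
  have hN₃0 : 0 ≤ N₃ := (norm_nonneg _).trans (hN₃ _ h01)
  have hlp : 0 < ‖lam‖ := norm_pos_iff.2 hl
  set M : ℝ := N₀ + (‖lam‖ + 1) * N₁ + 2 / ‖lam‖ * N₂ + 1 with hMd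
  have hM : 0 < M := by positivity
  set B : ℝ := N₃ * C + (‖lam‖⁻¹ ^ 2 * (2 / ‖lam‖)) * (N₂ * (2 * C)) with hB
  have hB0 : 0 ≤ B := by positivity
  set G : ℝ := (Real.exp M - 1) / M with hG
  have hG0 : 0 ≤ G := div_nonneg (by linarith [Real.add_one_le_exp M]) hM.le
  refine HasDerivAt.differentiableAt (f' := (w 1).2) ?_
  rw [hasDerivAt_iff_isLittleO_nhds_zero, Asymptotics.isLittleO_iff]
  intro ε hε
  filter_upwards [Metric.ball_mem_nhds (0 : ℂ) one_pos,
    Metric.ball_mem_nhds (0 : ℂ) (half_pos hlp),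
    Metric.ball_mem_nhds (0 : ℂ) (show 0 < ε / (B * G + 1) by positivity)] with h hh1 hh2 hh3
  rw [mem_ball_zero_iff] at hh1 hh2 hh3
  have hlh : ‖lam‖ / 2 ≤ ‖lam + h‖ := by
    have := norm_sub_le (lam + h) h
    rw [add_sub_cancel_right] at this
    linarith
  have hlh0 : lam + h ≠ 0 := norm_pos_iff.1 (by linarith)
  have hinv : ‖(lam + h)⁻¹‖ ≤ 2 / ‖lam‖ := by
    rw [norm_inv, inv_le_comm₀ (by linarith) (by positivity), inv_div]; exact hlh
  have hab : ∀ t ∈ Icc (0 : ℝ) 1, ‖a₀ t + (lam + h) • a₁ t + (lam + h)⁻¹ • a₂ t‖ ≤ M :=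
    fun t ht => by
    refine norm_add₃_le.trans ?_
    rw [norm_smul, norm_smul]
    have : ‖lam + h‖ ≤ ‖lam‖ + 1 := (norm_add_le _ _).trans (by linarith)
    have k1 : ‖lam + h‖ * ‖a₁ t‖ ≤ (‖lam‖ + 1) * N₁ := by gcongr; exact hN₁ t ht
    have k2 : ‖(lam + h)⁻¹‖ * ‖a₂ t‖ ≤ 2 / ‖lam‖ * N₂ := by gcongr; exact hN₂ t ht
    linarith [hN₀ t ht]
  have hy : ∀ t ∈ Icc (0 : ℝ) 1, HasDerivAt (fun t => (w t).1 + h • (w t).2)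
      (a t (w t).1 + h • (a t (w t).2 + a' t (w t).1)) t := fun t ht =>
    (hw1 t ht).add ((hw2 t ht).const_smul h)
  have herr : ∀ t ∈ Icc (0 : ℝ) 1, ‖a t (w t).1 + h • (a t (w t).2 + a' t (w t).1) -
      (a₀ t + (lam + h) • a₁ t + (lam + h)⁻¹ • a₂ t) ((w t).1 + h • (w t).2)‖
      ≤ ‖h‖ ^ 2 * B := fun t ht => by
    -- An exact second-order remainder for the inverse, so that the defect of `x + h y` is `h²`
    -- times a bounded term.
    have hi : (lam + h)⁻¹ = lam⁻¹ - h * lam⁻¹ ^ 2 + h ^ 2 * (lam⁻¹ ^ 2 * (lam + h)⁻¹) := by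
      field_simp; ring
    have e : a t (w t).1 + h • (a t (w t).2 + a' t (w t).1) -
      (a₀ t + (lam + h) • a₁ t + (lam + h)⁻¹ • a₂ t) ((w t).1 + h • (w t).2) =
      -(h ^ 2 • (a' t (w t).2 +
        (lam⁻¹ ^ 2 * (lam + h)⁻¹) • a₂ t ((w t).1 + h • (w t).2))) := by
      have e2 : (lam + h)⁻¹ • a₂ t = (lam⁻¹ - h * lam⁻¹ ^ 2) • a₂ t +
          (h ^ 2 * (lam⁻¹ ^ 2 * (lam + h)⁻¹)) • a₂ t := by rw [← add_smul, ← hi]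
      rw [e2]
      generalize lam⁻¹ ^ 2 * (lam + h)⁻¹ = q
      simp only [haDef, haDef', add_apply, sub_apply, smul_apply, map_add, c₀, c₁, c₂]
      module
    rw [e, norm_neg, norm_smul, norm_pow]
    have w1 : ‖(w t).1‖ ≤ C := (norm_fst_le _).trans (hC t ht)
    have w2 : ‖(w t).2‖ ≤ C := (norm_snd_le _).trans (hC t ht)
    have w3 : ‖(w t).1 + h • (w t).2‖ ≤ 2 * C := by
      refine (norm_add_le _ _).trans ?_
      rw [norm_smul]
      have : ‖h‖ * ‖(w t).2‖ ≤ 1 * C := by gcongr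
      linarith
    gcongr
    refine (norm_add_le _ _).trans (add_le_add ?_ ?_)
    · refine (ContinuousLinearMap.le_opNorm _ _).trans ?_
      gcongr
      exact hN₃ t ht
    · rw [norm_smul, norm_mul, norm_pow, norm_inv]
      gcongr
      refine (ContinuousLinearMap.le_opNorm _ _).trans ?_
      gcongr
      exact hN₂ t ht
  have hfin := norm_sub_le_of_approx_linear hM hab (hx (lam + h) hlh0) hy herr
    (by simp [hx0 _ hlh0, hw0]) (t := 1) (by simp)
  rw [hxw 1 (by simp), sub_sub]
  refine hfin.trans ?_
  rw [mul_one]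
  calc ‖h‖ ^ 2 * B / M * (Real.exp M - 1) = ‖h‖ * (B * G) * ‖h‖ := by rw [hG]; ring
    _ ≤ ε / (B * G + 1) * (B * G + 1) * ‖h‖ := by gcongr; linarith
    _ = ε * ‖h‖ := by field_simp

end Rays

/-! ### Solutions of the frame equation for a fixed spectral parameter -/

/-- The part of `connZ` that does not depend on `λ`. -/
def connZDiag (p : ℂ → ℂ) (z : ℂ) : Matrix (Fin 3) (Fin 3) ℂ :=
  !![wz p z / p z, 0, 0; 0, -(wz p z / p z), 0; 0, 0, 0]

/-- The coefficient of `λ` in `connZ`. -/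
def connZOff (H : ℝ) (p U : ℂ → ℂ) (z : ℂ) : Matrix (Fin 3) (Fin 3) ℂ :=
  !![0, 0, (rootH H / 2) * p z; U z / p z ^ 2, 0, 0; 0, (rootH H / 2) * p z, 0]

/-- The part of `connZbar` that does not depend on `λ`. -/
def connZbarDiag (p : ℂ → ℂ) (z : ℂ) : Matrix (Fin 3) (Fin 3) ℂ :=
  !![-(wzb p z / p z), 0, 0; 0, wzb p z / p z, 0; 0, 0, 0]

/-- The coefficient of `λ⁻¹` in `connZbar`. -/
def connZbarOff (H : ℝ) (p U : ℂ → ℂ) (z : ℂ) : Matrix (Fin 3) (Fin 3) ℂ :=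
  !![0, (starRingEnd ℂ) (U z) / p z ^ 2, 0; 0, 0, (rootH H / 2) * p z; (rootH H / 2) * p z, 0, 0]

/-- The Laurent form in `λ` provides joint continuity in `(z, λ)`, holomorphy in `λ`, and the
coefficients required by the parameter theorem. -/
theorem connZ_eq (H : ℝ) (p U : ℂ → ℂ) (lam z : ℂ) :
    connZ H p U lam z = connZDiag p z + lam • connZOff H p U z := by
  ext i j
  fin_cases i <;> fin_cases j <;> simp [connZ, connZDiag, connZOff] <;> ring

theorem connZbar_eq (H : ℝ) (p U : ℂ → ℂ) (lam z : ℂ) :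
    connZbar H p U lam z = connZbarDiag p z + lam⁻¹ • connZbarOff H p U z := by
  ext i j
  fin_cases i <;> fin_cases j <;> simp [connZbar, connZbarDiag, connZbarOff] <;> ring

theorem contDiffOn_div {D : Set ℂ} {f g : ℂ → ℂ} (hf : ContDiffOn ℝ ∞ f D)
    (hg : ContDiffOn ℝ ∞ g D) (h0 : ∀ z ∈ D, g z ≠ 0) : ContDiffOn ℝ ∞ (fun z => f z / g z) D := by
  simp only [div_eq_mul_inv]
  exact hf.mul (hg.inv h0)

/-! ### Smoothness of the connection form. -/

section ConnSmooth

variable {D : Set ℂ} {H : ℝ} {p U : ℂ → ℂ}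

theorem contDiffOn_connZDiag (hD : IsOpen D) (hp : ContDiffOn ℝ ∞ p D) (hp0 : ∀ z ∈ D, p z ≠ 0)
    (i j : Fin 3) : ContDiffOn ℝ ∞ (fun z => connZDiag p z i j) D := by
  have h := contDiffOn_div (contDiffOn_wz hD hp) hp hp0
  fin_cases i <;> fin_cases j <;> simp [connZDiag] <;>
    first | exact contDiffOn_const | exact h | exact h.neg

theorem contDiffOn_connZbarDiag (hD : IsOpen D) (hp : ContDiffOn ℝ ∞ p D)
    (hp0 : ∀ z ∈ D, p z ≠ 0) (i j : Fin 3) :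
    ContDiffOn ℝ ∞ (fun z => connZbarDiag p z i j) D := by
  have h := contDiffOn_div (contDiffOn_wzb hD hp) hp hp0
  fin_cases i <;> fin_cases j <;> simp [connZbarDiag] <;>
    first | exact contDiffOn_const | exact h | exact h.neg

theorem contDiffOn_connZOff (hp : ContDiffOn ℝ ∞ p D) (hp0 : ∀ z ∈ D, p z ≠ 0)
    (hU : ContDiffOn ℝ ∞ U D) (i j : Fin 3) : ContDiffOn ℝ ∞ (fun z => connZOff H p U z i j) D := by
  have h1 := (contDiffOn_const (c := rootH H / 2)).mul hp
  have h2 := contDiffOn_div hU (hp.pow 2) fun z hz => pow_ne_zero 2 (hp0 z hz)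
  fin_cases i <;> fin_cases j <;> simp [connZOff] <;>
    first | exact contDiffOn_const | exact h1 | exact h2

theorem contDiffOn_connZbarOff (hp : ContDiffOn ℝ ∞ p D) (hp0 : ∀ z ∈ D, p z ≠ 0)
    (hU : ContDiffOn ℝ ∞ U D) (i j : Fin 3) :
    ContDiffOn ℝ ∞ (fun z => connZbarOff H p U z i j) D := by
  have h1 := (contDiffOn_const (c := rootH H / 2)).mul hp
  have h2 := contDiffOn_div (contDiffOn_conj hU) (hp.pow 2) fun z hz => pow_ne_zero 2 (hp0 z hz)
  fin_cases i <;> fin_cases j <;> simp [connZbarOff] <;>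
    first | exact contDiffOn_const | exact h1 | exact h2

theorem contDiffOn_connZ (hD : IsOpen D) (hp : ContDiffOn ℝ ∞ p D) (hp0 : ∀ z ∈ D, p z ≠ 0)
    (hU : ContDiffOn ℝ ∞ U D) (lam : ℂ) (i j : Fin 3) :
    ContDiffOn ℝ ∞ (fun z => connZ H p U lam z i j) D := by
  simp only [connZ_eq, Matrix.add_apply, Matrix.smul_apply]
  exact (contDiffOn_connZDiag hD hp hp0 i j).add
    ((contDiffOn_connZOff hp hp0 hU i j).const_smul lam)

theorem contDiffOn_connZbar (hD : IsOpen D) (hp : ContDiffOn ℝ ∞ p D) (hp0 : ∀ z ∈ D, p z ≠ 0)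
    (hU : ContDiffOn ℝ ∞ U D) (lam : ℂ) (i j : Fin 3) :
    ContDiffOn ℝ ∞ (fun z => connZbar H p U lam z i j) D := by
  simp only [connZbar_eq, Matrix.add_apply, Matrix.smul_apply]
  exact (contDiffOn_connZbarDiag hD hp hp0 i j).add
    ((contDiffOn_connZbarOff hp hp0 hU i j).const_smul lam⁻¹)

end ConnSmooth

/-- `X⁻¹ dX = α_λ` on `D`, for one value of `λ`. -/
def Solves (D : Set ℂ) (H : ℝ) (p U : ℂ → ℂ) (lam : ℂ) (X : ℂ → Matrix (Fin 3) (Fin 3) ℂ) : Prop :=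
  ∀ z ∈ D, HasMW X (X z * connZ H p U lam z) (X z * connZbar H p U lam z) z

theorem IsFrame.solves {D : Set ℂ} {H : ℝ} {p U : ℂ → ℂ} {E : ℂ → ℂ → Matrix (Fin 3) (Fin 3) ℂ}
    (h : IsFrame D H p U E) (hD : IsOpen D) {lam : ℂ} (hl : lam ≠ 0) :
    Solves D H p U lam (fun z => E z lam) := fun z hz i j => by
  have h1 := congrFun (congrFun (h.eqZ lam hl z hz) i) j
  have h2 := congrFun (congrFun (h.eqZbar lam hl z hz) i) j
  exact (hasW_of_contDiffOn hD (h.smooth lam hl i j) hz).of_eq h1 h2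

theorem Solves.const_mul {D : Set ℂ} {H : ℝ} {p U : ℂ → ℂ} {lam : ℂ}
    {X : ℂ → Matrix (Fin 3) (Fin 3) ℂ} (h : Solves D H p U lam X)
    (C : Matrix (Fin 3) (Fin 3) ℂ) : Solves D H p U lam (fun z => C * X z) := fun z hz =>
  ((h z hz).const_mul C).of_eq (by rw [Matrix.mul_assoc]) (by rw [Matrix.mul_assoc])

theorem contDiff_wlin : ContDiff ℝ ∞ fun q : ℂ × ℂ => wlin q.1 q.2 :=
  ((ContDiff.smul contDiff_fst contDiff_const).add (ContDiff.smul contDiff_snd contDiff_const))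

/-- Solutions of the frame equation with smooth coefficients are smooth. -/
theorem Solves.contDiffOn {D : Set ℂ} (hD : IsOpen D) {H : ℝ} {p U : ℂ → ℂ} {lam : ℂ}
    {X : ℂ → Matrix (Fin 3) (Fin 3) ℂ} (h : Solves D H p U lam X) (hp : ContDiffOn ℝ ∞ p D)
    (hp0 : ∀ z ∈ D, p z ≠ 0) (hU : ContDiffOn ℝ ∞ U D) (i j : Fin 3) :
    ContDiffOn ℝ ∞ (fun z => X z i j) D := by
  suffices hn : ∀ n : ℕ, ∀ i j, ContDiffOn ℝ n (fun z => X z i j) D from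
    contDiffOn_infty.2 fun n => hn n i j
  intro n
  induction n with
  | zero =>
    intro i j
    exact contDiffOn_zero.2 fun z hz => (h z hz i j).differentiableAt.continuousAt.continuousWithinAt
  | succ n ih =>
    intro i j
    have hle : ((n : ℕ) : WithTop ℕ∞) ≤ ∞ := mod_cast le_top
    push_cast
    rw [contDiffOn_succ_iff_fderiv_of_isOpen hD]
    refine ⟨fun z hz => (h z hz i j).differentiableAt.differentiableWithinAt, by simp, ?_⟩
    -- The derivative is expressed through `X` and smooth coefficients, so each order of
    -- differentiability of all entries yields the next one.
    have e : ∀ z ∈ D, fderiv ℝ (fun z => X z i j) z =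
        wlin ((X z * connZ H p U lam z) i j) ((X z * connZbar H p U lam z) i j) := fun z hz =>
      HasFDerivAt.fderiv (h z hz i j)
    refine ContDiffOn.congr ?_ e
    have h1 : ContDiffOn ℝ n (fun z => (X z * connZ H p U lam z) i j) D := by
      simp only [Matrix.mul_apply]
      exact ContDiffOn.sum fun k _ =>
        (ih i k).mul ((contDiffOn_connZ hD hp hp0 hU lam k j).of_le hle)
    have h2 : ContDiffOn ℝ n (fun z => (X z * connZbar H p U lam z) i j) D := by
      simp only [Matrix.mul_apply]
      exact ContDiffOn.sum fun k _ =>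
        (ih i k).mul ((contDiffOn_connZbar hD hp hp0 hU lam k j).of_le hle)
    exact (contDiff_wlin.of_le hle).comp_contDiffOn (h1.prodMk h2)

/-- Smoothness is automatic, by bootstrapping in the equation. -/
theorem isFrame_of_solves {D : Set ℂ} (hD : IsOpen D) {H : ℝ} {p U : ℂ → ℂ}
    {E : ℂ → ℂ → Matrix (Fin 3) (Fin 3) ℂ} (hp : ContDiffOn ℝ ∞ p D) (hp0 : ∀ z ∈ D, p z ≠ 0)
    (hU : ContDiffOn ℝ ∞ U D) (h : ∀ lam, lam ≠ 0 → Solves D H p U lam (fun z => E z lam)) :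
    IsFrame D H p U E where
  smooth lam hl i j := (h lam hl).contDiffOn hD hp hp0 hU i j
  eqZ lam hl z hz := by ext i j; exact (h lam hl z hz i j).wz_eq
  eqZbar lam hl z hz := by ext i j; exact (h lam hl z hz i j).wzb_eq

theorem differentiableAt_det {M : ℂ → Matrix (Fin 3) (Fin 3) ℂ} {z : ℂ}
    (h : ∀ i j, DifferentiableAt ℝ (fun w => M w i j) z) :
    DifferentiableAt ℝ (fun w => (M w).det) z := by
  simp only [Matrix.det_apply']
  refine DifferentiableAt.fun_sum fun s _ => DifferentiableAt.mul (differentiableAt_const _) ?_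
  exact (HasFDerivAt.finsetProd fun i _ => (h (s i) i).hasFDerivAt).differentiableAt

/-- The derivative of the inverse matrix. -/
theorem HasMW.inv {Y : ℂ → Matrix (Fin 3) (Fin 3) ℂ} {A B : Matrix (Fin 3) (Fin 3) ℂ} {z : ℂ}
    (h : HasMW Y A B z) (hdet : (Y z).det ≠ 0) :
    HasMW (fun w => (Y w)⁻¹) (-((Y z)⁻¹ * A * (Y z)⁻¹)) (-((Y z)⁻¹ * B * (Y z)⁻¹)) z := by
  have hd : ∀ i j, DifferentiableAt ℝ (fun w => Y w i j) z := fun i j => (h i j).differentiableAt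
  have hdd := differentiableAt_det hd
  -- Cramer's formula gives differentiability; the value of the derivative is then forced by
  -- differentiating `Y⁻¹ Y = 1` near `z`.
  have hi : ∀ i j, DifferentiableAt ℝ (fun w => (Y w)⁻¹ i j) z := fun i j => by
    simp only [Matrix.inv_def, Ring.inverse_eq_inv', Matrix.smul_apply, smul_eq_mul,
      Matrix.adjugate_apply]
    refine DifferentiableAt.mul (hdd.inv hdet) (differentiableAt_det fun k l => ?_)
    by_cases hk : k = j
    · subst hk; simp
    · simpa [Matrix.updateRow_ne hk] using hd k l
  have hY : HasMW (fun w => (Y w)⁻¹) (Matrix.of fun i j => wz (fun w => (Y w)⁻¹ i j) z)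
      (Matrix.of fun i j => wzb (fun w => (Y w)⁻¹ i j) z) z := fun i j =>
    hasW_of_differentiableAt (hi i j)
  have hone : HasMW (fun w => (Y w)⁻¹ * Y w) 0 0 z := by
    refine (hasMW_const 1 z).congr ?_
    filter_upwards [hdd.continuousAt.eventually_ne hdet] with w hw
    exact Matrix.nonsing_inv_mul _ (isUnit_iff_ne_zero.2 hw)
  obtain ⟨e1, e2⟩ := (hY.mul h).unique hone
  have hu := isUnit_iff_ne_zero.2 hdet
  refine hY.of_eq ?_ ?_
  · have := congrArg (· * (Y z)⁻¹) (eq_neg_of_add_eq_zero_left e1)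
    simpa [Matrix.mul_assoc, Matrix.mul_nonsing_inv _ hu] using this
  · have := congrArg (· * (Y z)⁻¹) (eq_neg_of_add_eq_zero_left e2)
    simpa [Matrix.mul_assoc, Matrix.mul_nonsing_inv _ hu] using this

/-- Two solutions of the frame equation that agree at a point agree on a connected domain. -/
theorem Solves.eqOn {D : Set ℂ} (hD : IsOpen D) (hDc : IsPreconnected D) {H : ℝ} {p U : ℂ → ℂ}
    {lam : ℂ} {X Y : ℂ → Matrix (Fin 3) (Fin 3) ℂ} (hX : Solves D H p U lam X)
    (hY : Solves D H p U lam Y) (hdet : ∀ z ∈ D, (Y z).det ≠ 0) {z₀ : ℂ} (hz₀ : z₀ ∈ D)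
    (h0 : X z₀ = Y z₀) {z : ℂ} (hz : z ∈ D) : X z = Y z := by
  have hu : ∀ z ∈ D, IsUnit (Y z).det := fun z hz => isUnit_iff_ne_zero.2 (hdet z hz)
  -- The connection multiplies from the right, so it cancels in `X Y⁻¹`.
  have key : ∀ z ∈ D, HasMW (fun w => X w * (Y w)⁻¹) 0 0 z := fun z hz => by
    refine ((hX z hz).mul ((hY z hz).inv (hdet z hz))).of_eq ?_ ?_ <;>
    · rw [← Matrix.mul_assoc (Y z)⁻¹ (Y z), Matrix.nonsing_inv_mul _ (hu z hz), Matrix.one_mul,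
        Matrix.mul_neg, Matrix.mul_assoc, add_neg_cancel]
  have h := hasMW_zero_const hD hDc key hz hz₀
  rw [h0, Matrix.mul_nonsing_inv _ (hu z₀ hz₀)] at h
  have := congrArg (· * Y z) h
  simpa [Matrix.mul_assoc, Matrix.nonsing_inv_mul _ (hu z hz)] using this

/-- Liouville's formula. As the connection is traceless, it makes determinants of solutions
constant. -/
theorem hasW_det {X : ℂ → Matrix (Fin 3) (Fin 3) ℂ} {A B : Matrix (Fin 3) (Fin 3) ℂ} {z : ℂ}
    (h : HasMW X (X z * A) (X z * B) z) :
    HasW (fun w => (X w).det) (A.trace * (X z).det) (B.trace * (X z).det) z := by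
  simp only [Matrix.det_fin_three]
  refine ((((((((h 0 0).mul (h 1 1)).mul (h 2 2)).sub (((h 0 0).mul (h 1 2)).mul (h 2 1))).sub
    (((h 0 1).mul (h 1 0)).mul (h 2 2))).add (((h 0 1).mul (h 1 2)).mul (h 2 0))).add
    (((h 0 2).mul (h 1 0)).mul (h 2 1))).sub (((h 0 2).mul (h 1 1)).mul (h 2 0))).of_eq ?_ ?_ <;>
  · simp only [Matrix.mul_apply, Fin.sum_univ_three, Matrix.trace_fin_three]
    ring

theorem trace_connZ (H : ℝ) (p U : ℂ → ℂ) (lam z : ℂ) : (connZ H p U lam z).trace = 0 := by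
  simp [connZ, Matrix.trace_fin_three]

theorem trace_connZbar (H : ℝ) (p U : ℂ → ℂ) (lam z : ℂ) : (connZbar H p U lam z).trace = 0 := by
  simp [connZbar, Matrix.trace_fin_three]

theorem Solves.det_eq {D : Set ℂ} (hD : IsOpen D) (hDc : IsPreconnected D) {H : ℝ} {p U : ℂ → ℂ}
    {lam : ℂ} {X : ℂ → Matrix (Fin 3) (Fin 3) ℂ} (hX : Solves D H p U lam X) {z w : ℂ}
    (hz : z ∈ D) (hw : w ∈ D) : (X z).det = (X w).det := by
  -- The scalar matrix only serves to reuse the constancy result for matrix functions.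
  have key : ∀ z ∈ D, HasMW (fun w => (X w).det • (1 : Matrix (Fin 3) (Fin 3) ℂ)) 0 0 z :=
    fun z hz i j => by
    have := (hasW_det (hX z hz)).const_mul ((1 : Matrix (Fin 3) (Fin 3) ℂ) i j)
    simpa [trace_connZ, trace_connZbar, mul_comm] using this
  simpa using congrFun (congrFun (hasMW_zero_const hD hDc key hz hw) 0) 0

/-! ### Removable singularities in the spectral parameter -/

theorem norm_wlin_le (a b : ℂ) : ‖wlin a b‖ ≤ ‖a‖ + ‖b‖ :=
  ContinuousLinearMap.opNorm_le_bound _ (by positivity) fun h => by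
    rw [wlin_apply, add_mul]
    refine (norm_add_le _ _).trans ?_
    rw [norm_mul, norm_mul, RCLike.norm_conj]

/-- Right multiplication acts on each row separately, so growth is controlled row by row in the sup
norm; the `3` counts the summands. -/
theorem norm_mul_apply_le {Y A : Matrix (Fin 3) (Fin 3) ℂ} {K : ℝ} (hA : ∀ k j, ‖A k j‖ ≤ K)
    (i j : Fin 3) : ‖(Y * A) i j‖ ≤ 3 * K * ‖(Y i : Fin 3 → ℂ)‖ := by
  rw [Matrix.mul_apply]
  calc ‖∑ k, Y i k * A k j‖ ≤ ∑ k : Fin 3, ‖(Y i : Fin 3 → ℂ)‖ * K := by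
        refine norm_sum_le_of_le _ fun k _ => ?_
        rw [norm_mul]
        exact mul_le_mul (norm_le_pi_norm (Y i : Fin 3 → ℂ) k) (hA k j) (norm_nonneg _)
          (norm_nonneg _)
    _ = _ := by simp; ring

theorem HasMW.hasFDerivAt_row {X : ℂ → Matrix (Fin 3) (Fin 3) ℂ} {A B : Matrix (Fin 3) (Fin 3) ℂ}
    {z : ℂ} (h : HasMW X A B z) (i : Fin 3) :
    HasFDerivAt (fun w => (X w i : Fin 3 → ℂ))
      (ContinuousLinearMap.pi fun j => wlin (A i j) (B i j)) z :=
  hasFDerivAt_pi.2 fun j => h i j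

/-- A family of solutions of the frame equation that is holomorphic in `λ` on the disc bounded by
a circle and solves the equation on the circle solves it at the centre. -/
theorem solves_center {D : Set ℂ} (hD : IsOpen D) {H : ℝ} {p U : ℂ → ℂ}
    (hp : ContDiffOn ℝ ∞ p D) (hp0 : ∀ z ∈ D, p z ≠ 0) (hU : ContDiffOn ℝ ∞ U D)
    {X : ℂ → ℂ → Matrix (Fin 3) (Fin 3) ℂ}
    (hhol : ∀ z ∈ D, ∀ i j, DifferentiableOn ℂ (fun l => X z l i j) {0}ᶜ) {l₀ : ℂ} {R : ℝ}
    (hR : 0 < R) (hR0 : R < ‖l₀‖)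
    (hs : ∀ l ∈ Metric.sphere l₀ R, Solves D H p U l fun z => X z l) :
    Solves D H p U l₀ fun z => X z l₀ := by
  intro z₀ hz₀ i j
  have hball : Metric.closedBall l₀ R ⊆ ({0}ᶜ : Set ℂ) := fun l hl => by
    rintro rfl
    rw [Metric.mem_closedBall, dist_zero_left] at hl
    linarith
  have hsph : Metric.sphere l₀ R ⊆ ({0}ᶜ : Set ℂ) := Metric.sphere_subset_closedBall.trans hball
  obtain ⟨r, hr, hrD⟩ := Metric.nhds_basis_closedBall.mem_iff.1 (hD.mem_nhds hz₀)
  have hcomp : IsCompact (Metric.closedBall z₀ r ×ˢ Metric.sphere l₀ R) :=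
    (isCompact_closedBall _ _).prod (isCompact_sphere _ _)
  have hfst : Set.MapsTo Prod.fst (Metric.closedBall z₀ r ×ˢ Metric.sphere l₀ R) D :=
    fun q hq => hrD hq.1
  obtain ⟨K₁, hK₁⟩ := hcomp.exists_bound_of_continuousOn
    (f := fun q : ℂ × ℂ => fun k j : Fin 3 => connZ H p U q.2 q.1 k j) (by
      refine continuousOn_pi.2 fun k => continuousOn_pi.2 fun j => ?_
      simp only [connZ_eq, Matrix.add_apply, Matrix.smul_apply]
      exact ((contDiffOn_connZDiag hD hp hp0 k j).continuousOn.comp continuousOn_fst hfst).add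
        (continuousOn_snd.smul
          ((contDiffOn_connZOff hp hp0 hU k j).continuousOn.comp continuousOn_fst hfst)))
  obtain ⟨K₂, hK₂⟩ := hcomp.exists_bound_of_continuousOn
    (f := fun q : ℂ × ℂ => fun k j : Fin 3 => connZbar H p U q.2 q.1 k j) (by
      refine continuousOn_pi.2 fun k => continuousOn_pi.2 fun j => ?_
      simp only [connZbar_eq, Matrix.add_apply, Matrix.smul_apply]
      exact ((contDiffOn_connZbarDiag hD hp hp0 k j).continuousOn.comp continuousOn_fst hfst).add
        ((continuousOn_snd.inv₀ fun q hq => hsph hq.2).smul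
          ((contDiffOn_connZbarOff hp hp0 hU k j).continuousOn.comp continuousOn_fst hfst)))
  set K := max |K₁| |K₂| with hK
  have hK0 : 0 ≤ K := (abs_nonneg K₁).trans (le_max_left _ _)
  have hZ : ∀ z ∈ Metric.closedBall z₀ r, ∀ l ∈ Metric.sphere l₀ R, ∀ k j,
      ‖connZ H p U l z k j‖ ≤ K := fun z hz l hl k j =>
    ((norm_le_pi_norm (fun j => connZ H p U l z k j) j).trans
      (norm_le_pi_norm (fun k j => connZ H p U l z k j) k)).trans
      (((hK₁ (z, l) ⟨hz, hl⟩).trans (le_abs_self _)).trans (le_max_left _ _))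
  have hZb : ∀ z ∈ Metric.closedBall z₀ r, ∀ l ∈ Metric.sphere l₀ R, ∀ k j,
      ‖connZbar H p U l z k j‖ ≤ K := fun z hz l hl k j =>
    ((norm_le_pi_norm (fun j => connZbar H p U l z k j) j).trans
      (norm_le_pi_norm (fun k j => connZbar H p U l z k j) k)).trans
      (((hK₂ (z, l) ⟨hz, hl⟩).trans (le_abs_self _)).trans (le_max_right _ _))
  obtain ⟨C, hC⟩ := (isCompact_sphere l₀ R).exists_bound_of_continuousOn
    (f := fun l => (X z₀ l i : Fin 3 → ℂ))
    (continuousOn_pi.2 fun j => ((hhol z₀ hz₀ i j).mono hsph).continuousOn)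
  -- Holomorphy in `λ` bounds `X` on the circle at the single point `z₀`; Grönwall extends the bound
  -- uniformly to nearby `z`. No joint continuity of `X` is needed.
  have hbd : ∀ z ∈ Metric.ball z₀ r, ∀ l ∈ Metric.sphere l₀ R,
      ‖(X z l i : Fin 3 → ℂ)‖ ≤ C * Real.exp (6 * K * r) := fun z hz l hl => by
    refine (norm_le_of_norm_fderiv_le_mul (f := fun w => (X w l i : Fin 3 → ℂ)) (M := 6 * K)
      (by positivity) (fun w hw => (hs l hl w
        (hrD (Metric.ball_subset_closedBall hw))).hasFDerivAt_row i) (fun w hw => ?_) hz).trans ?_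
    · refine ContinuousLinearMap.opNorm_le_bound _ (by positivity) fun h => ?_
      rw [pi_norm_le_iff_of_nonneg (by positivity)]
      intro j
      have hw' := Metric.ball_subset_closedBall hw
      calc ‖wlin ((X w l * connZ H p U l w) i j) ((X w l * connZbar H p U l w) i j) h‖
          ≤ ‖wlin ((X w l * connZ H p U l w) i j) ((X w l * connZbar H p U l w) i j)‖ * ‖h‖ :=
            ContinuousLinearMap.le_opNorm _ _
        _ ≤ (3 * K * ‖(X w l i : Fin 3 → ℂ)‖ + 3 * K * ‖(X w l i : Fin 3 → ℂ)‖) * ‖h‖ := by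
            gcongr
            exact (norm_wlin_le _ _).trans (add_le_add (norm_mul_apply_le (hZ w hw' l hl) i j)
              (norm_mul_apply_le (hZb w hw' l hl) i j))
        _ = _ := by ring
    · gcongr
      exact hC l hl
  have hcirc : ∀ θ, circleMap l₀ R θ ∈ Metric.sphere l₀ R := circleMap_mem_sphere l₀ hR.le
  have hcont : ∀ f : ℂ → ℂ, DifferentiableOn ℂ f {0}ᶜ → Continuous fun θ => f (circleMap l₀ R θ) :=
    fun f hf => (hf.continuousOn.comp_continuous (continuous_circleMap l₀ R)
      fun θ => hsph (hcirc θ))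
  -- The mean value property. It is applied to `X` and to both products of `X` with the connection.
  have havg : ∀ f : ℂ → ℂ, DifferentiableOn ℂ f {0}ᶜ →
      (2 * Real.pi)⁻¹ • ∫ θ in (0 : ℝ)..2 * Real.pi, f (circleMap l₀ R θ) = f l₀ := fun f hf => by
    have := circleAverage_of_differentiable_on_off_countable (f := f) (c := l₀) (R := R)
      Set.countable_empty (by rw [abs_of_pos hR]; exact hf.continuousOn.mono hball)
      (by
        rw [abs_of_pos hR]
        intro z hz
        exact hf.differentiableAt (isOpen_compl_singleton.mem_nhds
          (hball (Metric.ball_subset_closedBall hz.1))))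
    rwa [Real.circleAverage] at this
  have hA : DifferentiableOn ℂ (fun l => (X z₀ l * connZ H p U l z₀) i j) {0}ᶜ := by
    simp only [connZ_eq, Matrix.mul_apply, Matrix.add_apply, Matrix.smul_apply, smul_eq_mul]
    exact DifferentiableOn.fun_sum fun k _ => (hhol z₀ hz₀ i k).mul
      ((differentiableOn_const _).add (differentiableOn_id.mul (differentiableOn_const _)))
  have hB : DifferentiableOn ℂ (fun l => (X z₀ l * connZbar H p U l z₀) i j) {0}ᶜ := by
    simp only [connZbar_eq, Matrix.mul_apply, Matrix.add_apply, Matrix.smul_apply, smul_eq_mul]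
    exact DifferentiableOn.fun_sum fun k _ => (hhol z₀ hz₀ i k).mul
      ((differentiableOn_const _).add ((differentiableOn_id.inv fun l hl => hl).mul
        (differentiableOn_const _)))
  have hF'c : Continuous fun θ =>
      wlin ((X z₀ (circleMap l₀ R θ) * connZ H p U (circleMap l₀ R θ) z₀) i j)
        ((X z₀ (circleMap l₀ R θ) * connZbar H p U (circleMap l₀ R θ) z₀) i j) :=
    contDiff_wlin.continuous.comp ((hcont _ hA).prodMk (hcont _ hB))
  -- Differentiating under the circle average carries the equation to the centre, because the
  -- Wirtinger coefficients of the integrand are again holomorphic in `λ`.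
  have hint := intervalIntegral.hasFDerivAt_integral_of_dominated_of_fderiv_le
    (𝕜 := ℝ) (μ := MeasureTheory.volume) (a := 0) (b := 2 * Real.pi)
    (F := fun z θ => X z (circleMap l₀ R θ) i j)
    (F' := fun z θ => wlin ((X z (circleMap l₀ R θ) * connZ H p U (circleMap l₀ R θ) z) i j)
        ((X z (circleMap l₀ R θ) * connZbar H p U (circleMap l₀ R θ) z) i j))
    (x₀ := z₀) (s := Metric.ball z₀ r)
    (bound := fun _ => 6 * K * (C * Real.exp (6 * K * r)))
    (Metric.ball_mem_nhds z₀ hr)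
    (by
      filter_upwards [hD.mem_nhds hz₀] with z hz
      exact (hcont _ (hhol z hz i j)).aestronglyMeasurable)
    ((hcont _ (hhol z₀ hz₀ i j)).intervalIntegrable _ _)
    hF'c.aestronglyMeasurable
    (Filter.Eventually.of_forall fun θ _ z hz => by
      have hz' := Metric.ball_subset_closedBall hz
      refine (norm_wlin_le _ _).trans ((add_le_add
        (norm_mul_apply_le (hZ z hz' _ (hcirc θ)) i j)
        (norm_mul_apply_le (hZb z hz' _ (hcirc θ)) i j)).trans ?_)
      rw [← add_mul]
      calc _ ≤ (3 * K + 3 * K) * (C * Real.exp (6 * K * r)) := by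
            gcongr; exact hbd z hz _ (hcirc θ)
        _ = _ := by ring)
    (by simp)
    (Filter.Eventually.of_forall fun θ _ z hz =>
      hs _ (hcirc θ) z (hrD (Metric.ball_subset_closedBall hz)) i j)
  have hfin := hint.const_smul (2 * Real.pi)⁻¹
  have he : (fun z => X z l₀ i j) =ᶠ[nhds z₀] fun z =>
      (2 * Real.pi)⁻¹ • ∫ θ in (0 : ℝ)..2 * Real.pi, X z (circleMap l₀ R θ) i j := by
    filter_upwards [hD.mem_nhds hz₀] with z hz
    exact (havg _ (hhol z hz i j)).symm
  refine (hfin.congr_of_eventuallyEq he).congr_fderiv ?_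
  refine ContinuousLinearMap.ext fun h => ?_
  have hi1 := (hcont _ hA).intervalIntegrable (μ := MeasureTheory.volume) 0 (2 * Real.pi)
  have hi2 := (hcont _ hB).intervalIntegrable (μ := MeasureTheory.volume) 0 (2 * Real.pi)
  rw [smul_apply, ContinuousLinearMap.intervalIntegral_apply (hF'c.intervalIntegrable _ _)]
  simp only [wlin_apply]
  rw [intervalIntegral.integral_add (hi1.mul_const h) (hi2.mul_const _),
    intervalIntegral.integral_mul_const, intervalIntegral.integral_mul_const, smul_add,
    ← smul_mul_assoc, ← smul_mul_assoc, havg _ hA, havg _ hB]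

/-- Meant for the six exceptional parameters, where the dressed frame is known only through a
removable singularity. The radius keeps the circle in the punctured neighbourhood and the closed
disc away from `0`. -/
theorem solves_of_eventually {D : Set ℂ} (hD : IsOpen D) {H : ℝ} {p U : ℂ → ℂ}
    (hp : ContDiffOn ℝ ∞ p D) (hp0 : ∀ z ∈ D, p z ≠ 0) (hU : ContDiffOn ℝ ∞ U D)
    {X : ℂ → ℂ → Matrix (Fin 3) (Fin 3) ℂ}
    (hhol : ∀ z ∈ D, ∀ i j, DifferentiableOn ℂ (fun l => X z l i j) {0}ᶜ) {l₀ : ℂ}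
    (hl₀ : l₀ ≠ 0) (hs : ∀ᶠ l in nhdsWithin l₀ {l₀}ᶜ, Solves D H p U l fun z => X z l) :
    Solves D H p U l₀ fun z => X z l₀ := by
  obtain ⟨ρ, hρ, h⟩ := Metric.eventually_nhds_iff.1 (eventually_nhdsWithin_iff.1 hs)
  have hl : 0 < ‖l₀‖ := norm_pos_iff.2 hl₀
  have hR : 0 < min (ρ / 2) (‖l₀‖ / 2) := by positivity
  refine solves_center hD hp hp0 hU hhol hR
    ((min_le_right _ _).trans_lt (by linarith)) fun l hl => h ?_ ?_
  · rw [Metric.mem_sphere.1 hl]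
    exact (min_le_left _ _).trans_lt (by linarith)
  · rintro rfl
    rw [Metric.mem_sphere, dist_self] at hl
    linarith

/-- The quotient `f / q`, completed by the value `f' / q'` at the zeros of `q`. -/
def fillQuot (f q : ℂ → ℂ) (l : ℂ) : ℂ := if q l = 0 then deriv f l / deriv q l else f l / q l

theorem fillQuot_of_ne {f q : ℂ → ℂ} {l : ℂ} (h : q l ≠ 0) : fillQuot f q l = f l / q l :=
  if_neg h

/-- At a simple zero `c` of `q`, both `f` and `q` are `l - c` times their difference slopes. The
quotient of the slopes is holomorphic with value `f' / q'` at `c`, which explains the value filled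
in. -/
theorem differentiableOn_fillQuot {S : Set ℂ} (hS : IsOpen S) {f q : ℂ → ℂ}
    (hf : DifferentiableOn ℂ f S) (hq : DifferentiableOn ℂ q S)
    (h : ∀ l ∈ S, q l = 0 → f l = 0 ∧ deriv q l ≠ 0) : DifferentiableOn ℂ (fillQuot f q) S := by
  intro c hc
  refine DifferentiableAt.differentiableWithinAt ?_
  have hSc := hS.mem_nhds hc
  by_cases hqc : q c = 0
  · obtain ⟨hfc, hq'⟩ := h c hc hqc
    have hdf : DifferentiableAt ℂ (dslope f c) c :=
      ((Complex.differentiableOn_dslope hSc).2 hf).differentiableAt hSc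
    have hdq : DifferentiableAt ℂ (dslope q c) c :=
      ((Complex.differentiableOn_dslope hSc).2 hq).differentiableAt hSc
    have hne : dslope q c c ≠ 0 := by rwa [dslope_same]
    refine (hdf.div hdq hne).congr_of_eventuallyEq ?_
    filter_upwards [hdq.continuousAt.eventually_ne hne] with l hl
    rcases eq_or_ne l c with rfl | hlc
    · simp [fillQuot, hqc]
    · have e1 : (l - c) * dslope q c l = q l := by
        have := sub_smul_dslope q c l
        rwa [hqc, sub_zero, smul_eq_mul] at this
      have e2 : (l - c) * dslope f c l = f l := by
        have := sub_smul_dslope f c l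
        rwa [hfc, sub_zero, smul_eq_mul] at this
      have hlc' := sub_ne_zero.2 hlc
      rw [fillQuot_of_ne (by rw [← e1]; exact mul_ne_zero hlc' hl), ← e1, ← e2,
        mul_div_mul_left _ _ hlc']
      rfl
  · have hqd := hq.differentiableAt hSc
    refine ((hf.differentiableAt hSc).div hqd hqc).congr_of_eventuallyEq ?_
    filter_upwards [hqd.continuousAt.eventually_ne hqc] with l hl
    exact fillQuot_of_ne hl

/-! ### The structure equations of an affine sphere -/

theorem pd_apply {f : ℂ → Fin 3 → ℝ} {z : ℂ} (hf : DifferentiableAt ℝ f z) (k : Fin 2)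
    (i : Fin 3) : pd k (fun w => f w i) z = pd k f z i := by
  unfold pd
  have := hasFDerivAt_pi'.1 hf.hasFDerivAt i
  rw [this.fderiv]
  rfl

theorem pd_congr {F : Type*} [NormedAddCommGroup F] [NormedSpace ℝ F] {f g : ℂ → F} {z : ℂ}
    (e : f =ᶠ[nhds z] g) (k : Fin 2) : pd k f z = pd k g z := by
  unfold pd; rw [e.fderiv_eq]

theorem contDiffOn_pd {F : Type*} [NormedAddCommGroup F] [NormedSpace ℝ F] {D : Set ℂ}
    (hD : IsOpen D) {f : ℂ → F} (hf : ContDiffOn ℝ ∞ f D) (k : Fin 2) :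
    ContDiffOn ℝ ∞ (pd k f) D := contDiffOn_fderiv_apply hD hf _

theorem differentiableAt_of_contDiffOn {F : Type*} [NormedAddCommGroup F] [NormedSpace ℝ F]
    {D : Set ℂ} (hD : IsOpen D) {f : ℂ → F} (hf : ContDiffOn ℝ ∞ f D) {z : ℂ} (hz : z ∈ D) :
    DifferentiableAt ℝ f z :=
  (hf.differentiableOn (by simp)).differentiableAt (hD.mem_nhds hz)

theorem inv_exp_smul_one (t : ℝ) :
    (Real.exp t • (1 : Matrix (Fin 2) (Fin 2) ℝ))⁻¹ = Real.exp (-t) • 1 := by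
  refine Matrix.inv_eq_right_inv ?_
  rw [Matrix.smul_mul, Matrix.mul_smul, smul_smul, ← Real.exp_add]
  simp

/-- The Christoffel symbols of a conformal metric `e^ψ |dz|²`. -/
theorem christoffel_conformal {g : ℂ → Matrix (Fin 2) (Fin 2) ℝ} {ψ : ℂ → ℝ} {z : ℂ}
    (hg : ∀ᶠ w in nhds z, g w = Real.exp (ψ w) • (1 : Matrix (Fin 2) (Fin 2) ℝ))
    (hψ : DifferentiableAt ℝ ψ z) (k i j : Fin 2) :
    christoffel g k i j z = 1 / 2 * ((1 : Matrix (Fin 2) (Fin 2) ℝ) j k * pd i ψ z +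
      (1 : Matrix (Fin 2) (Fin 2) ℝ) i k * pd j ψ z -
      (1 : Matrix (Fin 2) (Fin 2) ℝ) i j * pd k ψ z) := by
  have hpd : ∀ i a b : Fin 2, pd i (fun w => g w a b) z =
      Real.exp (ψ z) * pd i ψ z * (1 : Matrix (Fin 2) (Fin 2) ℝ) a b := fun i a b => by
    have e : (fun w => g w a b) =ᶠ[nhds z] fun w =>
        Real.exp (ψ w) * (1 : Matrix (Fin 2) (Fin 2) ℝ) a b :=
      hg.mono fun w hw => by simp only [hw, Matrix.smul_apply, smul_eq_mul]
    rw [pd_congr e]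
    unfold pd
    rw [((hψ.hasFDerivAt.exp).mul_const _).fderiv]
    simp only [smul_apply, smul_eq_mul]
    ring
  have hexp : Real.exp (-ψ z) * Real.exp (ψ z) = 1 := by rw [← Real.exp_add]; simp
  unfold christoffel
  simp only [hpd, hg.self_of_nhds, inv_exp_smul_one, Matrix.smul_apply, smul_eq_mul]
  have : ∀ l : Fin 2, Real.exp (-ψ z) * (1 : Matrix (Fin 2) (Fin 2) ℝ) k l *
      (Real.exp (ψ z) * pd i ψ z * (1 : Matrix (Fin 2) (Fin 2) ℝ) j l +
        Real.exp (ψ z) * pd j ψ z * (1 : Matrix (Fin 2) (Fin 2) ℝ) i l -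
        Real.exp (ψ z) * pd l ψ z * (1 : Matrix (Fin 2) (Fin 2) ℝ) i j) =
      (1 : Matrix (Fin 2) (Fin 2) ℝ) k l * ((1 : Matrix (Fin 2) (Fin 2) ℝ) j l * pd i ψ z +
        (1 : Matrix (Fin 2) (Fin 2) ℝ) i l * pd j ψ z -
        (1 : Matrix (Fin 2) (Fin 2) ℝ) i j * pd l ψ z) := fun l => by
    linear_combination ((1 : Matrix (Fin 2) (Fin 2) ℝ) k l *
      ((1 : Matrix (Fin 2) (Fin 2) ℝ) j l * pd i ψ z +
        (1 : Matrix (Fin 2) (Fin 2) ℝ) i l * pd j ψ z -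
        (1 : Matrix (Fin 2) (Fin 2) ℝ) i j * pd l ψ z)) * hexp
  simp only [this]
  congr 1
  rw [Finset.sum_eq_single k (fun l _ hl => by simp [Matrix.one_apply_ne' hl]) (by simp)]
  simp

/-- The Laplacian of a conformal metric `e^ψ |dz|²`. -/
theorem laplaceBeltrami_conformal {g : ℂ → Matrix (Fin 2) (Fin 2) ℝ} {ψ : ℂ → ℝ} {z : ℂ}
    (hg : ∀ᶠ w in nhds z, g w = Real.exp (ψ w) • (1 : Matrix (Fin 2) (Fin 2) ℝ))
    (f : ℂ → Fin 3 → ℝ) :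
    laplaceBeltrami g f z = Real.exp (-ψ z) • (pd 0 (pd 0 f) z + pd 1 (pd 1 f) z) := by
  have hdet : ∀ t : ℝ, Real.sqrt (Real.exp t • (1 : Matrix (Fin 2) (Fin 2) ℝ)).det =
      Real.exp t := fun t => by
    rw [Matrix.det_smul, Matrix.det_one, mul_one, Fintype.card_fin, Real.sqrt_sq (Real.exp_pos t).le]
  have e : ∀ i : Fin 2, (fun w => ∑ j, (Real.sqrt (g w).det * (g w)⁻¹ i j) • pd j f w)
      =ᶠ[nhds z] pd i f := fun i => by
    filter_upwards [hg] with w hw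
    rw [hw, hdet, inv_exp_smul_one]
    have : ∀ j, (Real.exp (ψ w) * (Real.exp (-ψ w) • (1 : Matrix (Fin 2) (Fin 2) ℝ)) i j) =
        (1 : Matrix (Fin 2) (Fin 2) ℝ) i j := fun j => by
      rw [Matrix.smul_apply, smul_eq_mul, ← mul_assoc, ← Real.exp_add]
      simp
    simp only [this]
    rw [Finset.sum_eq_single i (fun l _ hl => by simp [Matrix.one_apply_ne' hl]) (by simp)]
    simp
  unfold laplaceBeltrami
  rw [Fin.sum_univ_two, pd_congr (e 0), pd_congr (e 1), hg.self_of_nhds, hdet, Real.exp_neg]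

/-- The equations of Gauss for an affine sphere with centre `0` in real coordinates. -/
structure GaussReal (r : ℂ → Fin 3 → ℝ) (H : ℝ) (ψ : ℂ → ℝ) (u : ℂ) (z : ℂ) : Prop where
  xx : pd 0 (pd 0 r) z = (1 / 2 * pd 0 ψ z + Real.exp (-ψ z) * u.re) • pd 0 r z +
    (-(1 / 2) * pd 1 ψ z - Real.exp (-ψ z) * u.im) • pd 1 r z - (H * Real.exp (ψ z)) • r z
  xy : pd 0 (pd 1 r) z = (1 / 2 * pd 1 ψ z - Real.exp (-ψ z) * u.im) • pd 0 r z +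
    (1 / 2 * pd 0 ψ z - Real.exp (-ψ z) * u.re) • pd 1 r z
  yx : pd 1 (pd 0 r) z = (1 / 2 * pd 1 ψ z - Real.exp (-ψ z) * u.im) • pd 0 r z +
    (1 / 2 * pd 0 ψ z - Real.exp (-ψ z) * u.re) • pd 1 r z
  yy : pd 1 (pd 1 r) z = (-(1 / 2) * pd 0 ψ z - Real.exp (-ψ z) * u.re) • pd 0 r z +
    (1 / 2 * pd 1 ψ z + Real.exp (-ψ z) * u.im) • pd 1 r z - (H * Real.exp (ψ z)) • r z

/-- For a conformal metric and affine normal `-H r`, the Christoffel symbols and the components of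
`Re (u dz³)` are explicit, and the Gauss formula becomes four vector equations. -/
theorem isCubicFormAt_iff {r : ℂ → Fin 3 → ℝ} {H : ℝ} {ψ : ℂ → ℝ} {u z : ℂ}
    (hm : ∀ᶠ w in nhds z, affineMetric r w = Real.exp (ψ w) • (1 : Matrix (Fin 2) (Fin 2) ℝ))
    (hψ : DifferentiableAt ℝ ψ z) (hc : affineNormal r z = -(H • r z)) :
    IsCubicFormAt r (cubicOfCoeff u) z ↔ GaussReal r H ψ u z := by
  have hC : ∀ i j k : Fin 2, ∑ l, cubicOfCoeff u i j l * (affineMetric r z)⁻¹ l k =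
      cubicOfCoeff u i j k * Real.exp (-ψ z) := fun i j k => by
    rw [hm.self_of_nhds, inv_exp_smul_one,
      Finset.sum_eq_single k (fun l _ hl => by simp [Matrix.one_apply_ne hl]) (by simp)]
    simp
  unfold IsCubicFormAt
  simp only [christoffel_conformal hm hψ, hC, hc]
  simp only [hm.self_of_nhds, Fin.sum_univ_two, Matrix.smul_apply, smul_eq_mul]
  constructor
  · intro h
    constructor
    · refine (h 0 0).trans ?_
      simp [cubicOfCoeff]
      module
    · refine (h 0 1).trans ?_
      simp [cubicOfCoeff]
      module
    · refine (h 1 0).trans ?_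
      simp [cubicOfCoeff]
      module
    · refine (h 1 1).trans ?_
      simp [cubicOfCoeff]
      module
  · intro h
    refine Fin.forall_fin_two.2 ⟨Fin.forall_fin_two.2 ⟨?_, ?_⟩, Fin.forall_fin_two.2 ⟨?_, ?_⟩⟩
    · refine h.xx.trans ?_
      simp [cubicOfCoeff]
      module
    · refine h.xy.trans ?_
      simp [cubicOfCoeff]
      module
    · refine h.yx.trans ?_
      simp [cubicOfCoeff]
      module
    · refine h.yy.trans ?_
      simp [cubicOfCoeff]
      module

/-- The volume `det (r, r_x, r_y)`. -/
def posDet (r : ℂ → Fin 3 → ℝ) (z : ℂ) : ℝ :=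
  Matrix.det (Matrix.of ![r z, pd 0 r z, pd 1 r z])

theorem det_comb_rows (a b c : ℝ) (x y w : Fin 3 → ℝ) :
    Matrix.det (Matrix.of ![a • x + b • y + c • w, x, y]) = c * Matrix.det (Matrix.of ![w, x, y]) := by
  simp [Matrix.det_fin_three]
  ring

/-- Tangential terms repeat a row of the determinant, so only the coefficient of `r` survives. It is
absent from the mixed derivatives and equal in the two pure ones. -/
theorem GaussReal.fundForm_eq {r : ℂ → Fin 3 → ℝ} {H : ℝ} {ψ : ℂ → ℝ} {u z : ℂ}
    (h : GaussReal r H ψ u z) :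
    fundForm r z = (Real.exp (ψ z) * (-H * posDet r z)) • (1 : Matrix (Fin 2) (Fin 2) ℝ) := by
  have e : ∀ (s : Fin 3 → ℝ) (a b c : ℝ), s = a • pd 0 r z + b • pd 1 r z - c • r z →
      Matrix.det (Matrix.of ![s, pd 0 r z, pd 1 r z]) = -c * posDet r z := fun s a b c hs => by
    rw [hs, sub_eq_add_neg, ← neg_smul, det_comb_rows, posDet]
  ext i j
  fin_cases i <;> fin_cases j <;> simp only [fundForm, Matrix.of_apply] <;>
    simp only [Fin.zero_eta, Fin.mk_one, Matrix.smul_apply, smul_eq_mul]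
  · rw [e _ _ _ _ h.xx]; simp; ring
  · rw [e _ _ _ 0 (h.xy.trans (by rw [zero_smul ℝ (r z), sub_zero]))]; simp
  · rw [e _ _ _ 0 (h.yx.trans (by rw [zero_smul ℝ (r z), sub_zero]))]; simp
  · rw [e _ _ _ _ h.yy]; simp; ring

theorem det_smul_one_two (t : ℝ) : (t • (1 : Matrix (Fin 2) (Fin 2) ℝ)).det = t ^ 2 := by
  simp

/-- Here `Λ` is `e^(2ψ)` times the identity and `det Λ = e^(4ψ)`, so the factor `|det Λ|^(-1/4)`
equals `e^(-ψ)`. -/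
theorem GaussReal.affineMetric_eq {r : ℂ → Fin 3 → ℝ} {H : ℝ} {ψ : ℂ → ℝ} {u z : ℂ}
    (h : GaussReal r H ψ u z) (hd : -H * posDet r z = Real.exp (ψ z)) :
    affineMetric r z = Real.exp (ψ z) • (1 : Matrix (Fin 2) (Fin 2) ℝ) := by
  unfold affineMetric
  rw [h.fundForm_eq, hd, det_smul_one_two, smul_smul]
  congr 1
  rw [abs_of_nonneg (by positivity), ← Real.exp_add, ← Real.exp_nat_mul, ← Real.exp_mul,
    ← Real.exp_add]
  congr 1
  push_cast
  ring

/-- If `Λ` is `y` times the identity, the affine metric has the sign of `y`; positivity forces `y >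
0`, and then the metric is `√y` times the identity, which determines `y = e^(2ψ)`. -/
theorem GaussReal.posDet_eq {r : ℂ → Fin 3 → ℝ} {H : ℝ} {ψ : ℂ → ℝ} {u z : ℂ}
    (h : GaussReal r H ψ u z)
    (hm : affineMetric r z = Real.exp (ψ z) • (1 : Matrix (Fin 2) (Fin 2) ℝ)) :
    -H * posDet r z = Real.exp (ψ z) := by
  set d := -H * posDet r z with hd
  unfold affineMetric at hm
  rw [h.fundForm_eq, ← hd, det_smul_one_two, smul_smul, abs_of_nonneg (by positivity)] at hm
  have h1 := congrFun (congrFun hm 0) 0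
  simp only [Matrix.smul_apply, Matrix.one_apply_eq, smul_eq_mul, mul_one] at h1
  have hep := Real.exp_pos (ψ z)
  have hd0 : 0 < d := by
    by_contra hneg
    have : ((Real.exp (ψ z) * d) ^ 2) ^ (-(1 / 4) : ℝ) * (Real.exp (ψ z) * d) ≤ 0 :=
      mul_nonpos_of_nonneg_of_nonpos (by positivity)
        (mul_nonpos_of_nonneg_of_nonpos hep.le (not_lt.1 hneg))
    linarith
  set y := Real.exp (ψ z) * d with hy
  have hy0 : 0 < y := by positivity
  have h2 : (y ^ 2) ^ (-(1 / 4) : ℝ) * y = Real.sqrt y := by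
    rw [← Real.rpow_natCast, ← Real.rpow_mul hy0.le, Real.sqrt_eq_rpow]
    nth_rewrite 2 [← Real.rpow_one y]
    rw [← Real.rpow_add hy0]
    norm_num
  rw [h2] at h1
  have h3 : y = Real.exp (ψ z) ^ 2 := by rw [← h1, Real.sq_sqrt hy0.le]
  have : Real.exp (ψ z) * d = Real.exp (ψ z) * Real.exp (ψ z) := by rw [← hy, h3, sq]
  exact mul_left_cancel₀ hep.ne' this

theorem IsAffineSphere.gauss {D : Set ℂ} (hD : IsOpen D) {r : ℂ → Fin 3 → ℝ} {H : ℝ} {ψ : ℂ → ℝ}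
    {U : ℂ → ℂ} (h : IsAffineSphere D r H ψ U) {z : ℂ} (hz : z ∈ D) :
    GaussReal r H ψ (U z) z ∧ -H * posDet r z = Real.exp (ψ z) := by
  have hm : ∀ᶠ w in nhds z, affineMetric r w = Real.exp (ψ w) • (1 : Matrix (Fin 2) (Fin 2) ℝ) :=
    (hD.eventually_mem hz).mono h.metric
  have hg := (isCubicFormAt_iff hm (differentiableAt_of_contDiffOn hD h.smooth_psi hz)
    (h.center z hz)).1 (h.cubic z hz)
  exact ⟨hg, hg.posDet_eq (h.metric z hz)⟩

/-- The metric comes from the determinants, the normal `-H r` from the sum of the two pure second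
derivatives, and the shape operator from differentiating the normal. -/
theorem isAffineSphere_of_gauss {D : Set ℂ} (hD : IsOpen D) {r : ℂ → Fin 3 → ℝ} {H : ℝ}
    {ψ : ℂ → ℝ} {U : ℂ → ℂ} (hr : ContDiffOn ℝ ∞ r D) (hψ : ContDiffOn ℝ ∞ ψ D)
    (hU : ContDiffOn ℝ ∞ U D)
    (h : ∀ z ∈ D, GaussReal r H ψ (U z) z ∧ -H * posDet r z = Real.exp (ψ z)) :
    IsAffineSphere D r H ψ U := by
  have hm : ∀ z ∈ D, affineMetric r z = Real.exp (ψ z) • (1 : Matrix (Fin 2) (Fin 2) ℝ) :=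
    fun z hz => (h z hz).1.affineMetric_eq (h z hz).2
  have hme : ∀ z ∈ D, ∀ᶠ w in nhds z,
      affineMetric r w = Real.exp (ψ w) • (1 : Matrix (Fin 2) (Fin 2) ℝ) := fun z hz =>
    (hD.eventually_mem hz).mono hm
  have hc : ∀ z ∈ D, affineNormal r z = -(H • r z) := fun z hz => by
    unfold affineNormal
    rw [laplaceBeltrami_conformal (hme z hz), (h z hz).1.xx, (h z hz).1.yy]
    have e : Real.exp (-ψ z) * Real.exp (ψ z) = 1 := by rw [← Real.exp_add]; simp
    ext i
    simp only [Pi.smul_apply, Pi.add_apply, Pi.sub_apply, Pi.neg_apply, smul_eq_mul]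
    linear_combination (-H * r z i) * e
  refine ⟨hr, hψ, hU, hm, fun z hz i => ?_, hc, fun z hz => ?_⟩
  · have e : affineNormal r =ᶠ[nhds z] fun w => -(H • r w) :=
      (hD.eventually_mem hz).mono hc
    rw [pd_congr e]
    unfold pd
    have := ((differentiableAt_of_contDiffOn hD hr hz).hasFDerivAt.const_smul H).neg
    exact DFunLike.congr_fun this.fderiv (![1, Complex.I] i)
  · exact (isCubicFormAt_iff (hme z hz) (differentiableAt_of_contDiffOn hD hψ hz) (hc z hz)).2
      (h z hz).1

/-! ### Affine spheres and frames -/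

/-- The Wirtinger derivative `∂/∂z` of a real function. -/
def rz (g : ℂ → ℝ) (z : ℂ) : ℂ := 1 / 2 * (((pd 0 g z : ℝ) : ℂ) - Complex.I * ((pd 1 g z : ℝ) : ℂ))

/-- The Wirtinger derivative `∂/∂z̄` of a real function. -/
def rzb (g : ℂ → ℝ) (z : ℂ) : ℂ := 1 / 2 * (((pd 0 g z : ℝ) : ℂ) + Complex.I * ((pd 1 g z : ℝ) : ℂ))

theorem conj_two : (starRingEnd ℂ) 2 = 2 := map_ofNat _ 2

theorem conj_rz (g : ℂ → ℝ) (z : ℂ) : (starRingEnd ℂ) (rz g z) = rzb g z := by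
  simp [rz, rzb, conj_two]

theorem hasW_ofReal {g : ℂ → ℝ} {z : ℂ} (hg : DifferentiableAt ℝ g z) :
    HasW (fun w => (g w : ℂ)) (rz g z) (rzb g z) z := by
  refine (Complex.ofRealCLM.hasFDerivAt.comp z hg.hasFDerivAt).congr_fderiv ?_
  apply clm_ext_one_I <;> rw [wlin_apply] <;> simp [rz, rzb, pd] <;> ring_nf
  simp

theorem hasFDerivAt_cx {r : ℂ → Fin 3 → ℝ} {z : ℂ} (hr : DifferentiableAt ℝ r z) :
    HasFDerivAt (cx r) (ContinuousLinearMap.pi fun i => Complex.ofRealCLM.comp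
      ((ContinuousLinearMap.proj i).comp (fderiv ℝ r z))) z :=
  hasFDerivAt_pi.2 fun i =>
    Complex.ofRealCLM.hasFDerivAt.comp z (hasFDerivAt_pi'.1 hr.hasFDerivAt i)

theorem wz_cx_apply {r : ℂ → Fin 3 → ℝ} {z : ℂ} (hr : DifferentiableAt ℝ r z) (i : Fin 3) :
    wz (cx r) z i = rz (fun w => r w i) z := by
  unfold rz
  rw [pd_apply hr, pd_apply hr]
  unfold wz
  rw [(hasFDerivAt_cx hr).fderiv]
  simp [pd]

theorem wzb_cx_apply {r : ℂ → Fin 3 → ℝ} {z : ℂ} (hr : DifferentiableAt ℝ r z) (i : Fin 3) :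
    wzb (cx r) z i = rzb (fun w => r w i) z := by
  unfold rzb
  rw [pd_apply hr, pd_apply hr]
  unfold wzb
  rw [(hasFDerivAt_cx hr).fderiv]
  simp [pd]

theorem hasW_cx {r : ℂ → Fin 3 → ℝ} {z : ℂ} (hr : DifferentiableAt ℝ r z) (i : Fin 3) :
    HasW (fun w => cx r w i) (wz (cx r) z i) (wzb (cx r) z i) z := by
  rw [wz_cx_apply hr, wzb_cx_apply hr]
  exact hasW_ofReal (differentiableAt_pi.1 hr i)

theorem expHalf_ne_zero (ψ : ℂ → ℝ) (z : ℂ) : expHalf ψ z ≠ 0 :=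
  Complex.ofReal_ne_zero.2 (Real.exp_ne_zero _)

theorem expHalf_sq (ψ : ℂ → ℝ) (z : ℂ) : expHalf ψ z ^ 2 = (Real.exp (ψ z) : ℂ) := by
  unfold expHalf
  rw [← Complex.ofReal_pow, ← Real.exp_nat_mul]
  congr 2
  push_cast
  ring

theorem exp_neg_eq (ψ : ℂ → ℝ) (z : ℂ) : (Real.exp (-ψ z) : ℂ) = (expHalf ψ z ^ 2)⁻¹ := by
  rw [expHalf_sq, Real.exp_neg, Complex.ofReal_inv]

theorem conj_expHalf (ψ : ℂ → ℝ) (z : ℂ) : (starRingEnd ℂ) (expHalf ψ z) = expHalf ψ z :=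
  Complex.conj_ofReal _

theorem hasW_expHalf {ψ : ℂ → ℝ} {z : ℂ} (hψ : DifferentiableAt ℝ ψ z) :
    HasW (expHalf ψ) (expHalf ψ z * (rz ψ z / 2)) (expHalf ψ z * (rzb ψ z / 2)) z := by
  have e : expHalf ψ = fun w => Complex.exp (1 / 2 * (ψ w : ℂ)) := by
    funext w
    unfold expHalf
    rw [Complex.ofReal_exp]
    congr 1
    push_cast
    ring
  rw [e]
  exact (((hasW_ofReal hψ).const_mul (1 / 2)).comp_deriv (Complex.hasDerivAt_exp _)).of_eq
    (by ring) (by ring)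

theorem contDiffOn_expHalf {D : Set ℂ} {ψ : ℂ → ℝ} (hψ : ContDiffOn ℝ ∞ ψ D) :
    ContDiffOn ℝ ∞ (expHalf ψ) D :=
  contDiffOn_ofReal (Real.contDiff_exp.comp_contDiffOn (hψ.div_const 2))

theorem rootH_sq (H : ℝ) : rootH H ^ 2 = -2 * (H : ℂ) := by
  unfold rootH
  split_ifs with h
  · rw [← Complex.ofReal_pow, Real.sq_sqrt (by linarith)]
    push_cast; ring
  · rw [mul_pow, Complex.I_sq, ← Complex.ofReal_pow, Real.sq_sqrt (by linarith)]
    push_cast; ring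

/-- The sign `κ` in the reality condition. -/
def kap (H : ℝ) : ℂ := if H < 0 then 1 else -1

theorem kap_mul_self (H : ℝ) : kap H * kap H = 1 := by unfold kap; split_ifs <;> norm_num

theorem matT_eq (H : ℝ) : matT H = !![0, 1, 0; 1, 0, 0; 0, 0, kap H] := rfl

/-- The sign `κ` in the reality condition is the one by which `√(-2H)` fails to be real. -/
theorem conj_rootH (H : ℝ) : (starRingEnd ℂ) (rootH H) = kap H * rootH H := by
  unfold rootH kap
  split_ifs <;> simp

theorem conj_eq_inv_of_norm_one {lam : ℂ} (h : ‖lam‖ = 1) : (starRingEnd ℂ) lam = lam⁻¹ := by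
  rw [Complex.inv_def, Complex.normSq_eq_norm_sq, h]; simp

theorem ne_zero_of_norm_one {lam : ℂ} (h : ‖lam‖ = 1) : lam ≠ 0 := by
  rintro rfl; simp at h

/-- The complex form of the equations of Gauss. -/
def GaussCx (r : ℂ → Fin 3 → ℝ) (H : ℝ) (ψ : ℂ → ℝ) (u z : ℂ) : Prop :=
  ∀ i, HasW (fun w => wz (cx r) w i)
    (rz ψ z * wz (cx r) z i + u * (expHalf ψ z ^ 2)⁻¹ * wzb (cx r) z i)
    (-(H / 2 : ℂ) * expHalf ψ z ^ 2 * cx r z i) z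

/-- Symmetry of the mixed partial derivatives is not used: the vanishing of their difference is one
of the real equations compared in `gaussCx_iff`. -/
theorem hasW_wz_cx {D : Set ℂ} (hD : IsOpen D) {r : ℂ → Fin 3 → ℝ} (hr : ContDiffOn ℝ ∞ r D)
    {z : ℂ} (hz : z ∈ D) (i : Fin 3) : HasW (fun w => wz (cx r) w i)
      (1 / 4 * (((pd 0 (pd 0 r) z i - pd 1 (pd 1 r) z i : ℝ) : ℂ) -
        Complex.I * ((pd 1 (pd 0 r) z i + pd 0 (pd 1 r) z i : ℝ) : ℂ)))
      (1 / 4 * (((pd 0 (pd 0 r) z i + pd 1 (pd 1 r) z i : ℝ) : ℂ) +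
        Complex.I * ((pd 1 (pd 0 r) z i - pd 0 (pd 1 r) z i : ℝ) : ℂ))) z := by
  have hd : ∀ k, DifferentiableAt ℝ (pd k r) z := fun k =>
    differentiableAt_of_contDiffOn hD (contDiffOn_pd hD hr k) hz
  have h : ∀ k, HasW (fun w => ((pd k r w i : ℝ) : ℂ)) _ _ z := fun k =>
    hasW_ofReal (differentiableAt_pi.1 (hd k) i)
  have key := ((h 0).sub ((h 1).const_mul Complex.I)).const_mul (1 / 2)
  refine (key.congr ?_).of_eq ?_ ?_
  · filter_upwards [hD.mem_nhds hz] with w hw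
    have hw' := differentiableAt_of_contDiffOn hD hr hw
    rw [wz_cx_apply hw', rz, pd_apply hw', pd_apply hw']
  · simp only [rz, pd_apply (hd _)]
    push_cast
    linear_combination (1 / 4 * ((pd 1 (pd 1 r) z i : ℝ) : ℂ)) * Complex.I_sq
  · simp only [rzb, pd_apply (hd _)]
    push_cast
    linear_combination (-1 / 4 * ((pd 1 (pd 1 r) z i : ℝ) : ℂ)) * Complex.I_sq

/-- By uniqueness of Wirtinger derivatives the two complex equations split into four real ones:
`r_zz` accounts for `r_xx - r_yy` and `r_yx + r_xy`, and the `z̄`-derivative of `r_z` for `r_xx +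
r_yy` and `r_yx - r_xy`. -/
theorem gaussCx_iff {D : Set ℂ} (hD : IsOpen D) {r : ℂ → Fin 3 → ℝ} (hr : ContDiffOn ℝ ∞ r D)
    {H : ℝ} {ψ : ℂ → ℝ} {u z : ℂ} (hz : z ∈ D) :
    GaussCx r H ψ u z ↔ GaussReal r H ψ u z := by
  have hd := differentiableAt_of_contDiffOn hD hr hz
  have key : ∀ i, (HasW (fun w => wz (cx r) w i)
      (rz ψ z * wz (cx r) z i + u * (expHalf ψ z ^ 2)⁻¹ * wzb (cx r) z i)
      (-(H / 2 : ℂ) * expHalf ψ z ^ 2 * cx r z i) z) ↔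
      (pd 0 (pd 0 r) z i - pd 1 (pd 1 r) z i = pd 0 ψ z * pd 0 r z i - pd 1 ψ z * pd 1 r z i +
        2 * Real.exp (-ψ z) * (u.re * pd 0 r z i - u.im * pd 1 r z i) ∧
      pd 1 (pd 0 r) z i + pd 0 (pd 1 r) z i = pd 0 ψ z * pd 1 r z i + pd 1 ψ z * pd 0 r z i -
        2 * Real.exp (-ψ z) * (u.re * pd 1 r z i + u.im * pd 0 r z i)) ∧
      pd 0 (pd 0 r) z i + pd 1 (pd 1 r) z i = -2 * H * Real.exp (ψ z) * r z i ∧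
      pd 1 (pd 0 r) z i - pd 0 (pd 1 r) z i = 0 := fun i => by
    have h0 := hasW_wz_cx hD hr hz i
    have e : ∀ a b : ℂ, HasW (fun w => wz (cx r) w i) a b z ↔
        (1 / 4 * (((pd 0 (pd 0 r) z i - pd 1 (pd 1 r) z i : ℝ) : ℂ) -
        Complex.I * ((pd 1 (pd 0 r) z i + pd 0 (pd 1 r) z i : ℝ) : ℂ))) = a ∧
        (1 / 4 * (((pd 0 (pd 0 r) z i + pd 1 (pd 1 r) z i : ℝ) : ℂ) +
        Complex.I * ((pd 1 (pd 0 r) z i - pd 0 (pd 1 r) z i : ℝ) : ℂ))) = b := fun a b =>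
      ⟨fun h => h0.unique h, fun h => h0.of_eq h.1 h.2⟩
    rw [e, ← exp_neg_eq, expHalf_sq, wz_cx_apply hd, wzb_cx_apply hd, Complex.ext_iff,
      Complex.ext_iff]
    simp [rz, rzb, pd_apply hd, cx, -Complex.ofReal_exp]
    refine and_congr (and_congr ?_ ?_) (and_congr ?_ ?_) <;> constructor <;> intro h <;> linarith
  have hcomp : GaussCx r H ψ u z ↔ ∀ i, _ := forall_congr' key
  rw [hcomp]
  constructor
  · intro h
    constructor <;> ext i <;> obtain ⟨⟨h1, h2⟩, h3, h4⟩ := h i <;>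
      simp only [Pi.add_apply, Pi.sub_apply, Pi.smul_apply, smul_eq_mul] <;> linarith
  · intro h i
    have h1 := congrFun h.xx i
    have h2 := congrFun h.xy i
    have h3 := congrFun h.yx i
    have h4 := congrFun h.yy i
    simp only [Pi.add_apply, Pi.sub_apply, Pi.smul_apply, smul_eq_mul] at h1 h2 h3 h4
    refine ⟨⟨?_, ?_⟩, ?_, ?_⟩ <;> linarith

/-- The reality condition `X̄ = κ X T` of a frame. -/
def RealForm (H : ℝ) (X : Matrix (Fin 3) (Fin 3) ℂ) : Prop :=
  X.map (starRingEnd ℂ) = kap H • (X * matT H)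

theorem realForm_iff {H : ℝ} {X : Matrix (Fin 3) (Fin 3) ℂ} :
    RealForm H X ↔ ∀ i, (starRingEnd ℂ) (X i 0) = kap H * X i 1 ∧
      (starRingEnd ℂ) (X i 1) = kap H * X i 0 ∧ (starRingEnd ℂ) (X i 2) = X i 2 := by
  have hk := kap_mul_self H
  have e : ∀ i, (kap H • (X * matT H)) i 0 = kap H * X i 1 ∧
      (kap H • (X * matT H)) i 1 = kap H * X i 0 ∧ (kap H • (X * matT H)) i 2 = X i 2 :=
    fun i => by
    simp [Matrix.mul_apply, Fin.sum_univ_three, matT_eq]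
    linear_combination X i 2 * hk
  constructor
  · intro h i
    have h0 := congrFun (congrFun h i) 0
    have h1 := congrFun (congrFun h i) 1
    have h2 := congrFun (congrFun h i) 2
    rw [(e i).1] at h0
    rw [(e i).2.1] at h1
    rw [(e i).2.2] at h2
    exact ⟨h0, h1, h2⟩
  · intro h
    ext i j
    fin_cases j
    · exact (h i).1.trans (e i).1.symm
    · exact (h i).2.1.trans (e i).2.1.symm
    · exact (h i).2.2.trans (e i).2.2.symm

theorem conj_wz_cx {r : ℂ → Fin 3 → ℝ} {z : ℂ} (hr : DifferentiableAt ℝ r z) (i : Fin 3) :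
    (starRingEnd ℂ) (wz (cx r) z i) = wzb (cx r) z i := by
  rw [wz_cx_apply hr, wzb_cx_apply hr, conj_rz]

theorem sphereFrame_apply (H : ℝ) (ψ : ℂ → ℝ) (r : ℂ → Fin 3 → ℝ) (lam z : ℂ) (i : Fin 3) :
    sphereFrame H ψ r lam z i 0 = lam⁻¹ * rootH H / expHalf ψ z * wz (cx r) z i ∧
    sphereFrame H ψ r lam z i 1 = lam * rootH H / expHalf ψ z * wzb (cx r) z i ∧
    sphereFrame H ψ r lam z i 2 = -(H : ℂ) * cx r z i := by
  simp [sphereFrame]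

/-- On the unit circle conjugation swaps `λ⁻¹ r_z` and `λ r_z̄`, and `√(-2H)` contributes the factor
`κ`. -/
theorem realForm_sphereFrame (H : ℝ) (ψ : ℂ → ℝ) {r : ℂ → Fin 3 → ℝ} {lam z : ℂ}
    (hl : ‖lam‖ = 1) (hr : DifferentiableAt ℝ r z) : RealForm H (sphereFrame H ψ r lam z) := by
  refine realForm_iff.2 fun i => ?_
  obtain ⟨e0, e1, e2⟩ := sphereFrame_apply H ψ r lam z i
  have hb : (starRingEnd ℂ) (wzb (cx r) z i) = wz (cx r) z i := by
    rw [← conj_wz_cx hr, Complex.conj_conj]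
  rw [e0, e1, e2]
  simp only [map_mul, map_div₀, map_inv₀, map_neg, conj_rootH, conj_expHalf,
    conj_eq_inv_of_norm_one hl, conj_wz_cx hr, hb, inv_inv, cx, Complex.conj_ofReal]
  refine ⟨by ring, by ring, trivial⟩

/-- The powers of `λ` cancel, `r_z ∧ r_z̄ = (i/2) r_x ∧ r_y`, and the squared root is `-2H`. -/
theorem det_sphereFrame (H : ℝ) (ψ : ℂ → ℝ) {r : ℂ → Fin 3 → ℝ} {lam z : ℂ} (hl : lam ≠ 0)
    (hr : DifferentiableAt ℝ r z) : (sphereFrame H ψ r lam z).det =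
      Complex.I * (H : ℂ) ^ 2 / expHalf ψ z ^ 2 * (posDet r z : ℂ) := by
  have hp := expHalf_ne_zero ψ z
  rw [Matrix.det_fin_three]
  simp only [(sphereFrame_apply H ψ r lam z _).1, (sphereFrame_apply H ψ r lam z _).2.1,
    (sphereFrame_apply H ψ r lam z _).2.2, wz_cx_apply hr, wzb_cx_apply hr, rz, rzb, pd_apply hr]
  have e : posDet r z = r z 0 * pd 0 r z 1 * pd 1 r z 2 - r z 0 * pd 0 r z 2 * pd 1 r z 1
      - r z 1 * pd 0 r z 0 * pd 1 r z 2 + r z 1 * pd 0 r z 2 * pd 1 r z 0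
      + r z 2 * pd 0 r z 0 * pd 1 r z 1 - r z 2 * pd 0 r z 1 * pd 1 r z 0 := by
    simp [posDet, Matrix.det_fin_three]
  rw [e]
  simp only [cx]
  push_cast
  field_simp
  rw [rootH_sq]
  ring

/-- The powers of `λ` in the columns absorb the factor of the cubic form: `λ⁻¹ · λ³ · λ⁻¹ = λ` in
the `dz`-part, and `λ · λ⁻³ · λ = λ⁻¹` in the `dz̄`-part, where `|λ| = 1` is used to conjugate `λ³`.
-/
theorem IsAffineSphere.solves {D : Set ℂ} (hD : IsOpen D) {R : ℂ → Fin 3 → ℝ} {H : ℝ} {ψ : ℂ → ℝ}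
    {U : ℂ → ℂ} {lam : ℂ} (hl : ‖lam‖ = 1)
    (h : IsAffineSphere D R H ψ (fun z => lam ^ 3 * U z)) :
    Solves D H (expHalf ψ) U lam (sphereFrame H ψ R lam) := by
  intro z hz i
  have hl0 := ne_zero_of_norm_one hl
  have hp0 := expHalf_ne_zero ψ z
  have hd := differentiableAt_of_contDiffOn hD h.smooth hz
  have hψ := differentiableAt_of_contDiffOn hD h.smooth_psi hz
  have hp := hasW_expHalf hψ
  have ha := (gaussCx_iff hD h.smooth hz).2 (h.gauss hD hz).1 i
  -- Since `R` is real, the equations for `R_z̄` are the conjugates of those for `R_z`.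
  have hb : HasW (fun w => wzb (cx R) w i) _ _ z := ha.conj.congr (by
    filter_upwards [hD.mem_nhds hz] with w hw
    exact (conj_wz_cx (differentiableAt_of_contDiffOn hD h.smooth hw) i).symm)
  have hr := hasW_cx hd i
  obtain ⟨e0, e1, e2⟩ := sphereFrame_apply H ψ R lam z i
  have hrt := rootH_sq H
  have hq : wz (expHalf ψ) z / expHalf ψ z = rz ψ z / 2 := by rw [hp.wz_eq]; field_simp
  have hqb : wzb (expHalf ψ) z / expHalf ψ z = rzb ψ z / 2 := by rw [hp.wzb_eq]; field_simp
  have hcr : (starRingEnd ℂ) (cx R z i) = cx R z i := Complex.conj_ofReal _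
  have hcb : (starRingEnd ℂ) (wzb (cx R) z i) = wz (cx R) z i := by
    rw [← conj_wz_cx hd, Complex.conj_conj]
  refine Fin.forall_fin_succ.2 ⟨?_, Fin.forall_fin_succ.2 ⟨?_, Fin.forall_fin_one.2 ?_⟩⟩
  · refine ((((hasW_const (lam⁻¹ * rootH H) z).div hp hp0).mul ha).congr
      (Filter.Eventually.of_forall fun w => (sphereFrame_apply H ψ R lam w i).1)).of_eq ?_ ?_
    · simp [Matrix.mul_apply, Fin.sum_univ_three, connZ, e0, e1, e2, hq]
      field_simp
      ring
    · simp [Matrix.mul_apply, Fin.sum_univ_three, connZbar, e0, e1, e2, hqb]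
      field_simp
  · refine ((((hasW_const (lam * rootH H) z).div hp hp0).mul hb).congr
      (Filter.Eventually.of_forall fun w => (sphereFrame_apply H ψ R lam w i).2.1)).of_eq ?_ ?_
    · simp [Matrix.mul_apply, Fin.sum_univ_three, connZ, e0, e1, e2, hq, hcr, conj_expHalf,
        conj_two]
      field_simp
    · simp [Matrix.mul_apply, Fin.sum_univ_three, connZbar, e0, e1, e2, hqb, conj_expHalf,
        conj_rz, conj_wz_cx hd, hcb, conj_eq_inv_of_norm_one hl]
      field_simp
      ring
  · refine ((hr.const_mul (-(H : ℂ))).congr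
      (Filter.Eventually.of_forall fun w => (sphereFrame_apply H ψ R lam w i).2.2)).of_eq ?_ ?_
    · simp [Matrix.mul_apply, Fin.sum_univ_three, connZ, e0, e1, e2]
      field_simp
      rw [hrt]; ring
    · simp [Matrix.mul_apply, Fin.sum_univ_three, connZbar, e0, e1, e2]
      field_simp
      rw [hrt]; ring

/-- The normalisation `-H det(r, r_x, r_y) = e^ψ` removes all dependence on the point; this constant
is the one a solution must have to be the frame of a sphere. -/
theorem IsAffineSphere.det_sphereFrame_eq {D : Set ℂ} (hD : IsOpen D) {R : ℂ → Fin 3 → ℝ} {H : ℝ}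
    {ψ : ℂ → ℝ} {V : ℂ → ℂ} {lam z : ℂ} (hl : lam ≠ 0) (h : IsAffineSphere D R H ψ V)
    (hz : z ∈ D) : (sphereFrame H ψ R lam z).det = -(Complex.I * (H : ℂ)) := by
  have hp := expHalf_ne_zero ψ z
  rw [det_sphereFrame H ψ hl (differentiableAt_of_contDiffOn hD h.smooth hz)]
  have e : -(H : ℂ) * (posDet R z : ℂ) = expHalf ψ z ^ 2 := by
    rw [expHalf_sq, ← (h.gauss hD hz).2]; push_cast; ring
  field_simp
  linear_combination (-H : ℂ) * e

/-- A normalized solution of the frame equation whose third column is `-H R` with a real `R` is the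
frame of the affine sphere `R`. -/
theorem isAffineSphere_of_solves {W : Set ℂ} (hW : IsOpen W) {H : ℝ} (hH : H ≠ 0) {ψ : ℂ → ℝ}
    {U : ℂ → ℂ} {lam : ℂ} (hl : ‖lam‖ = 1) (hψ : ContDiffOn ℝ ∞ ψ W) (hU : ContDiffOn ℝ ∞ U W)
    {X : ℂ → Matrix (Fin 3) (Fin 3) ℂ} (hX : Solves W H (expHalf ψ) U lam X)
    (hdet : ∀ z ∈ W, (X z).det = -(Complex.I * (H : ℂ)))
    {R : ℂ → Fin 3 → ℝ} (hR : ∀ z ∈ W, cx R z = (-(H : ℂ))⁻¹ • thirdCol (X z)) :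
    IsAffineSphere W R H ψ (fun z => lam ^ 3 * U z) ∧
      ∀ z ∈ W, sphereFrame H ψ R lam z = X z := by
  have hl0 := ne_zero_of_norm_one hl
  have hHc : (H : ℂ) ≠ 0 := Complex.ofReal_ne_zero.2 hH
  have hrt := rootH_sq H
  have hrt0 : rootH H ≠ 0 := by
    intro h0
    rw [h0] at hrt
    exact hHc (by linear_combination (1 / 2) * hrt)
  have hRi : ∀ z ∈ W, ∀ i, cx R z i = (-(H : ℂ))⁻¹ * X z i 2 := fun z hz i => by
    rw [hR z hz]; rfl
  have hsm : ContDiffOn ℝ ∞ R W := by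
    refine contDiffOn_pi.2 fun i => ?_
    have h1 := hX.contDiffOn hW (contDiffOn_expHalf hψ) (fun z _ => expHalf_ne_zero ψ z) hU i 2
    have h2 := Complex.reCLM.contDiff.comp_contDiffOn
      ((contDiffOn_const (c := (-(H : ℂ))⁻¹)).mul h1)
    refine h2.congr fun z hz => ?_
    have := congrArg Complex.re (hRi z hz i)
    simpa [cx] using this
  have hd : ∀ z ∈ W, DifferentiableAt ℝ R z := fun z hz => differentiableAt_of_contDiffOn hW hsm hz
  -- The third column of the equation identifies `R_z` and `R_z̄` with the first two columns of `X`;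
  -- the first column then carries the Gauss equations.
  have hwz : ∀ z ∈ W, ∀ i, wz (cx R) z i =
      (-(H : ℂ))⁻¹ * (lam * (rootH H / 2) * expHalf ψ z * X z i 0) ∧
      wzb (cx R) z i = (-(H : ℂ))⁻¹ * (lam⁻¹ * (rootH H / 2) * expHalf ψ z * X z i 1) :=
    fun z hz i => by
    have h1 := ((hX z hz i 2).const_mul (-(H : ℂ))⁻¹).congr
      ((hW.eventually_mem hz).mono fun w hw => hRi w hw i)
    obtain ⟨e1, e2⟩ := (hasW_cx (hd z hz) i).unique h1
    have e3 : (X z * connZ H (expHalf ψ) U lam z) i 2 =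
        lam * (rootH H / 2) * expHalf ψ z * X z i 0 := by
      simp [Matrix.mul_apply, Fin.sum_univ_three, connZ]; ring
    have e4 : (X z * connZbar H (expHalf ψ) U lam z) i 2 =
        lam⁻¹ * (rootH H / 2) * expHalf ψ z * X z i 1 := by
      simp [Matrix.mul_apply, Fin.sum_univ_three, connZbar]; ring
    rw [e1, e2, e3, e4]
    exact ⟨rfl, rfl⟩
  have hfr : ∀ z ∈ W, sphereFrame H ψ R lam z = X z := fun z hz => by
    have hp0 := expHalf_ne_zero ψ z
    ext i j
    obtain ⟨e0, e1, e2⟩ := sphereFrame_apply H ψ R lam z i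
    fin_cases j
    · refine e0.trans ?_
      rw [(hwz z hz i).1]
      simp only [Fin.zero_eta]
      field_simp
      rw [hrt]; ring
    · refine e1.trans ?_
      rw [(hwz z hz i).2]
      simp only [Fin.mk_one]
      field_simp
      rw [hrt]; ring
    · refine e2.trans ?_
      rw [hRi z hz i]
      simp only [Fin.reduceFinMk]
      field_simp
  refine ⟨isAffineSphere_of_gauss hW hsm hψ (contDiffOn_const.mul hU) fun z hz => ?_, hfr⟩
  have hp0 := expHalf_ne_zero ψ z
  have hp := hasW_expHalf (differentiableAt_of_contDiffOn hW hψ hz)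
  have hq : wz (expHalf ψ) z / expHalf ψ z = rz ψ z / 2 := by rw [hp.wz_eq]; field_simp
  have hqb : wzb (expHalf ψ) z / expHalf ψ z = rzb ψ z / 2 := by rw [hp.wzb_eq]; field_simp
  constructor
  · refine (gaussCx_iff hW hsm hz).1 fun i => ?_
    refine ((((((hasW_const (lam * (rootH H / 2)) z).mul hp).mul (hX z hz i 0)).const_mul
      (-(H : ℂ))⁻¹)).congr ((hW.eventually_mem hz).mono fun w hw => (hwz w hw i).1)).of_eq ?_ ?_
    · rw [(hwz z hz i).1, (hwz z hz i).2]
      simp [Matrix.mul_apply, Fin.sum_univ_three, connZ, hq]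
      field_simp
      ring
    · rw [hRi z hz i]
      simp [Matrix.mul_apply, Fin.sum_univ_three, connZbar, hqb]
      field_simp
      linear_combination -(expHalf ψ z * X z i 2) * hrt
  · have h1 := det_sphereFrame H ψ hl0 (hd z hz)
    rw [hfr z hz, hdet z hz] at h1
    -- The frame equation does not see a constant linear map of space; the prescribed determinant is
    -- what fixes the normalisation of the affine metric.
    have h2 : -(H : ℂ) * (posDet R z : ℂ) = expHalf ψ z ^ 2 := by
      field_simp at h1
      have hI : (Complex.I * H : ℂ) ≠ 0 := mul_ne_zero Complex.I_ne_zero hHc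
      apply mul_left_cancel₀ hI
      linear_combination Complex.I * H * h1
    rw [expHalf_sq] at h2
    exact_mod_cast h2

/-- The reality condition makes the third column real, so taking its real part loses nothing. -/
theorem exists_isAffineSphere_of_solves {W : Set ℂ} (hW : IsOpen W) {H : ℝ} (hH : H ≠ 0)
    {ψ : ℂ → ℝ} {U : ℂ → ℂ} {lam : ℂ} (hl : ‖lam‖ = 1) (hψ : ContDiffOn ℝ ∞ ψ W)
    (hU : ContDiffOn ℝ ∞ U W) {X : ℂ → Matrix (Fin 3) (Fin 3) ℂ}
    (hX : Solves W H (expHalf ψ) U lam X) (hreal : ∀ z ∈ W, RealForm H (X z))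
    (hdet : ∀ z ∈ W, (X z).det = -(Complex.I * (H : ℂ))) :
    ∃ R : ℂ → Fin 3 → ℝ, (∀ z ∈ W, cx R z = (-(H : ℂ))⁻¹ • thirdCol (X z)) ∧
      IsAffineSphere W R H ψ (fun z => lam ^ 3 * U z) ∧
      ∀ z ∈ W, sphereFrame H ψ R lam z = X z := by
  have hR : ∀ z ∈ W, cx (fun z i => ((-(H : ℂ))⁻¹ * X z i 2).re) z =
      (-(H : ℂ))⁻¹ • thirdCol (X z) := fun z hz => by
    ext i
    refine Complex.conj_eq_iff_re.1 ?_
    rw [map_mul, (realForm_iff.1 (hreal z hz) i).2.2]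
    simp
  exact ⟨_, hR, isAffineSphere_of_solves hW hH hl hψ hU hX hdet hR⟩

theorem matT_mul_self (H : ℝ) : matT H * matT H = 1 := by
  have hk := kap_mul_self H
  ext i j
  fin_cases i <;> fin_cases j <;> simp [matT_eq, Matrix.mul_apply, Fin.sum_univ_three, hk]

theorem inv_matT (H : ℝ) : (matT H)⁻¹ = matT H := Matrix.inv_eq_right_inv (matT_mul_self H)

theorem conj_kap (H : ℝ) : (starRingEnd ℂ) (kap H) = kap H := by unfold kap; split_ifs <;> simp

theorem map_conj_mul (X Y : Matrix (Fin 3) (Fin 3) ℂ) :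
    (X * Y).map (starRingEnd ℂ) = X.map (starRingEnd ℂ) * Y.map (starRingEnd ℂ) := Matrix.map_mul

/-- `X̄ = κ X T` combines with `T ḡ = g T`; thus an initial frame in real form remains so when
multiplied by values of a `τ`-fixed loop. -/
theorem RealForm.mul_tau {H : ℝ} {X g : Matrix (Fin 3) (Fin 3) ℂ} (hX : RealForm H X)
    (hg : tau H g = g) : RealForm H (X * g) := by
  unfold RealForm at *
  have h1 : matT H * g.map (starRingEnd ℂ) = g * matT H := by
    have := congrArg (· * matT H) hg
    simpa [tau, inv_matT, Matrix.mul_assoc, matT_mul_self] using this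
  rw [map_conj_mul, hX, Matrix.smul_mul, Matrix.mul_assoc, h1, Matrix.mul_assoc]

theorem RealForm.real_smul {H : ℝ} {X : Matrix (Fin 3) (Fin 3) ℂ} (hX : RealForm H X) (c : ℝ) :
    RealForm H ((c : ℂ) • X) := by
  refine realForm_iff.2 fun i => ?_
  obtain ⟨h0, h1, h2⟩ := realForm_iff.1 hX i
  simp only [Matrix.smul_apply, smul_eq_mul, map_mul, Complex.conj_ofReal, h0, h1, h2]
  refine ⟨by ring, by ring, trivial⟩

theorem wz_expHalf_conj {D : Set ℂ} (hD : IsOpen D) {ψ : ℂ → ℝ} (hψ : ContDiffOn ℝ ∞ ψ D) {z : ℂ}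
    (hz : z ∈ D) : (starRingEnd ℂ) (wz (expHalf ψ) z) = wzb (expHalf ψ) z ∧
      (starRingEnd ℂ) (wzb (expHalf ψ) z) = wz (expHalf ψ) z := by
  have h := hasW_expHalf (differentiableAt_of_contDiffOn hD hψ hz)
  have hc : (starRingEnd ℂ) (rzb ψ z) = rz ψ z := by rw [← conj_rz, Complex.conj_conj]
  rw [h.wz_eq, h.wzb_eq]
  simp [conj_expHalf, conj_rz, hc, conj_two]

theorem tau_eq (H : ℝ) (M : Matrix (Fin 3) (Fin 3) ℂ) :
    tau H M = !![(starRingEnd ℂ) (M 1 1), (starRingEnd ℂ) (M 1 0), kap H * (starRingEnd ℂ) (M 1 2);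
      (starRingEnd ℂ) (M 0 1), (starRingEnd ℂ) (M 0 0), kap H * (starRingEnd ℂ) (M 0 2);
      kap H * (starRingEnd ℂ) (M 2 1), kap H * (starRingEnd ℂ) (M 2 0),
        (starRingEnd ℂ) (M 2 2)] := by
  have hk := kap_mul_self H
  rw [tau, inv_matT, matT_eq]
  ext i j
  fin_cases i <;> fin_cases j <;> simp [Matrix.mul_apply, Matrix.vecMul, dotProduct,
    Fin.sum_univ_three, mul_comm]
  linear_combination ((starRingEnd ℂ) (M 2 2)) * hk

/-- The reality condition of the connection form. -/
theorem tau_conn {D : Set ℂ} (hD : IsOpen D) (H : ℝ) {ψ : ℂ → ℝ} (hψ : ContDiffOn ℝ ∞ ψ D)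
    (U : ℂ → ℂ) (lam : ℂ) {z : ℂ} (hz : z ∈ D) :
    tau H (connZbar H (expHalf ψ) U ((starRingEnd ℂ) lam)⁻¹ z) = connZ H (expHalf ψ) U lam z ∧
    tau H (connZ H (expHalf ψ) U ((starRingEnd ℂ) lam)⁻¹ z) = connZbar H (expHalf ψ) U lam z := by
  have hk := kap_mul_self H
  obtain ⟨h1, h2⟩ := wz_expHalf_conj hD hψ hz
  constructor
  · rw [tau_eq]
    ext i j
    fin_cases i <;> fin_cases j <;> simp [connZ, connZbar, h2, conj_expHalf,
        conj_rootH, conj_two] <;>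
      linear_combination (lam * (rootH H / 2) * expHalf ψ z) * hk
  · rw [tau_eq]
    ext i j
    fin_cases i <;> fin_cases j <;> simp [connZ, connZbar, h1, conj_expHalf,
        conj_rootH, conj_two] <;>
      linear_combination (lam⁻¹ * (rootH H / 2) * expHalf ψ z) * hk

/-- If `X` solves the frame equation for `1/λ̄`, then `τ(X)` solves it for `λ`. -/
theorem Solves.tau {D : Set ℂ} (hD : IsOpen D) {H : ℝ} {ψ : ℂ → ℝ} (hψ : ContDiffOn ℝ ∞ ψ D)
    {U : ℂ → ℂ} {lam : ℂ} {X : ℂ → Matrix (Fin 3) (Fin 3) ℂ}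
    (hX : Solves D H (expHalf ψ) U ((starRingEnd ℂ) lam)⁻¹ X) :
    Solves D H (expHalf ψ) U lam (fun z => DefiniteAffine.tau H (X z)) := fun z hz => by
  obtain ⟨h1, h2⟩ := tau_conn hD H hψ U lam hz
  have hT : ∀ Y : Matrix (Fin 3) (Fin 3) ℂ, matT H * (matT H * Y) = Y := fun Y => by
    rw [← Matrix.mul_assoc, matT_mul_self, Matrix.one_mul]
  refine (((hX z hz).conj.const_mul (matT H)).mul_const (matT H)⁻¹).of_eq ?_ ?_
  · rw [← h1]
    simp only [DefiniteAffine.tau, inv_matT, map_conj_mul, Matrix.mul_assoc, hT]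
  · rw [← h2]
    simp only [DefiniteAffine.tau, inv_matT, map_conj_mul, Matrix.mul_assoc, hT]

/-! ### Flatness of the connection -/

/-- The derivatives of the entries of the connection form. -/
theorem hasMW_connZ {H : ℝ} {p U : ℂ → ℂ} {q₁ q₂ x₁ x₂ u₁ u₂ z : ℂ} (lam : ℂ)
    (hq : HasW (fun w => wz p w / p w) q₁ q₂ z) (hx : HasW (fun w => rootH H / 2 * p w) x₁ x₂ z)
    (hu : HasW (fun w => U w / p w ^ 2) u₁ u₂ z) :
    HasMW (connZ H p U lam) !![q₁, 0, lam * x₁; lam * u₁, -q₁, 0; 0, lam * x₁, 0]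
      !![q₂, 0, lam * x₂; lam * u₂, -q₂, 0; 0, lam * x₂, 0] z := by
  have h0 := hasW_const 0 z
  have hx' := hx.const_mul lam
  have hu' := hu.const_mul lam
  intro i j
  fin_cases i <;> fin_cases j <;> simp [connZ, mul_assoc, mul_div_assoc] <;>
    first | exact h0 | exact hq | exact hq.neg | exact hx' | exact hu'

theorem hasMW_connZbar {H : ℝ} {p U : ℂ → ℂ} {q₁ q₂ x₁ x₂ u₁ u₂ z : ℂ} (lam : ℂ)
    (hq : HasW (fun w => wzb p w / p w) q₁ q₂ z) (hx : HasW (fun w => rootH H / 2 * p w) x₁ x₂ z)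
    (hu : HasW (fun w => (starRingEnd ℂ) (U w) / p w ^ 2) u₁ u₂ z) :
    HasMW (connZbar H p U lam) !![-q₁, lam⁻¹ * u₁, 0; 0, q₁, lam⁻¹ * x₁; lam⁻¹ * x₁, 0, 0]
      !![-q₂, lam⁻¹ * u₂, 0; 0, q₂, lam⁻¹ * x₂; lam⁻¹ * x₂, 0, 0] z := by
  have h0 := hasW_const 0 z
  have hx' := hx.const_mul lam⁻¹
  have hu' := hu.const_mul lam⁻¹
  intro i j
  fin_cases i <;> fin_cases j <;> simp [connZbar, mul_assoc, mul_div_assoc] <;>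
    first | exact h0 | exact hq | exact hq.neg | exact hx' | exact hu'

/-- The zero curvature equation, in terms of given derivatives of the connection form. -/
def FlatAt (H : ℝ) (p U : ℂ → ℂ) (lam z : ℂ) : Prop :=
  ∃ A₁ A₂ B₁ B₂ : Matrix (Fin 3) (Fin 3) ℂ, HasMW (connZ H p U lam) A₁ A₂ z ∧
    HasMW (connZbar H p U lam) B₁ B₂ z ∧
    A₂ + connZbar H p U lam z * connZ H p U lam z = B₁ + connZ H p U lam z * connZbar H p U lam z

/-- The mixed second derivative of `X` is computed in both orders and the invertible `X` is
cancelled. -/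
theorem Solves.flatAt {D : Set ℂ} (hD : IsOpen D) {H : ℝ} {p U : ℂ → ℂ}
    (hp : ContDiffOn ℝ ∞ p D) (hp0 : ∀ z ∈ D, p z ≠ 0) (hU : ContDiffOn ℝ ∞ U D) {lam : ℂ}
    {X : ℂ → Matrix (Fin 3) (Fin 3) ℂ} (hX : Solves D H p U lam X)
    (hdet : ∀ z ∈ D, (X z).det ≠ 0) {z : ℂ} (hz : z ∈ D) : FlatAt H p U lam z := by
  have hA : HasMW (connZ H p U lam) (Matrix.of fun i j => wz (fun w => connZ H p U lam w i j) z)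
      (Matrix.of fun i j => wzb (fun w => connZ H p U lam w i j) z) z := fun i j =>
    hasW_of_contDiffOn hD (contDiffOn_connZ hD hp hp0 hU lam i j) hz
  have hB : HasMW (connZbar H p U lam)
      (Matrix.of fun i j => wz (fun w => connZbar H p U lam w i j) z)
      (Matrix.of fun i j => wzb (fun w => connZbar H p U lam w i j) z) z := fun i j =>
    hasW_of_contDiffOn hD (contDiffOn_connZbar hD hp hp0 hU lam i j) hz
  refine ⟨_, _, _, _, hA, hB, ?_⟩
  have h1 := (hX z hz).mul hA
  have h2 := (hX z hz).mul hB
  have key : X z * connZbar H p U lam z * connZ H p U lam z +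
      X z * Matrix.of (fun i j => wzb (fun w => connZ H p U lam w i j) z) =
      X z * connZ H p U lam z * connZbar H p U lam z +
      X z * Matrix.of (fun i j => wz (fun w => connZbar H p U lam w i j) z) := by
    ext i j
    rw [← (h1 i j).wzb_eq, ← (h2 i j).wz_eq]
    have e1 : (fun w => (X w * connZ H p U lam w) i j) =ᶠ[nhds z] wz (fun w => X w i j) := by
      filter_upwards [hD.mem_nhds hz] with w hw
      exact (hX w hw i j).wz_eq.symm
    have e2 : (fun w => (X w * connZbar H p U lam w) i j) =ᶠ[nhds z] wzb (fun w => X w i j) := by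
      filter_upwards [hD.mem_nhds hz] with w hw
      exact (hX w hw i j).wzb_eq.symm
    rw [wzb_congr e1, wz_congr e2, wz_wzb_comm hD (hX.contDiffOn hD hp hp0 hU i j) hz]
  have hu := isUnit_iff_ne_zero.2 (hdet z hz)
  have := congrArg ((X z)⁻¹ * ·) key
  simp only [Matrix.mul_assoc, ← Matrix.mul_add] at this
  rw [← Matrix.mul_assoc, ← Matrix.mul_assoc, Matrix.nonsing_inv_mul _ hu, Matrix.one_mul,
    Matrix.one_mul] at this
  rw [add_comm, this, add_comm]

/-- The zero curvature equation does not depend on the spectral parameter. -/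
theorem FlatAt.of_one {D : Set ℂ} (hD : IsOpen D) {H : ℝ} {p U : ℂ → ℂ}
    (hp : ContDiffOn ℝ ∞ p D) (hp0 : ∀ z ∈ D, p z ≠ 0) (hU : ContDiffOn ℝ ∞ U D) {z : ℂ}
    (hz : z ∈ D) (h : FlatAt H p U 1 z) {lam : ℂ} (hl : lam ≠ 0) : FlatAt H p U lam z := by
  have hq := hasW_of_contDiffOn hD (contDiffOn_div (contDiffOn_wz hD hp) hp hp0) hz
  have hq' := hasW_of_contDiffOn hD (contDiffOn_div (contDiffOn_wzb hD hp) hp hp0) hz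
  have hx := hasW_of_contDiffOn hD ((contDiffOn_const (c := rootH H / 2)).mul hp) hz
  have hu := hasW_of_contDiffOn hD
    (contDiffOn_div hU (hp.pow 2) fun z hz => pow_ne_zero 2 (hp0 z hz)) hz
  have hw := hasW_of_contDiffOn hD
    (contDiffOn_div (contDiffOn_conj hU) (hp.pow 2) fun z hz => pow_ne_zero 2 (hp0 z hz)) hz
  refine ⟨_, _, _, _, hasMW_connZ lam hq hx hu, hasMW_connZbar lam hq' hx hw, ?_⟩
  -- Every entry is homogeneous in `λ`: degree `0` on the diagonal, `1` at the off-diagonal places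
  -- of the `dz`-part, `-1` at those of the `dz̄`-part. The equation at `λ` is thus entrywise a
  -- power of `λ` times the equation at `1`.
  obtain ⟨A₁, A₂, B₁, B₂, hA, hB, e⟩ := h
  rw [(hA.unique (hasMW_connZ 1 hq hx hu)).2, (hB.unique (hasMW_connZbar 1 hq' hx hw)).1] at e
  generalize wzb (fun z => wz p z / p z) z = a₁ at *
  generalize wz (fun z => wzb p z / p z) z = a₂ at *
  generalize wz (fun z => rootH H / 2 * p z) z = a₃ at *
  generalize wzb (fun z => rootH H / 2 * p z) z = a₄ at *
  generalize wzb (fun z => U z / p z ^ 2) z = a₅ at *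
  generalize wz (fun z => (starRingEnd ℂ) (U z) / p z ^ 2) z = a₆ at *
  have e' := fun i j => congrFun (congrFun e i) j
  simp only [connZ, connZbar, Matrix.add_apply, Matrix.mul_apply, Fin.sum_univ_three] at e'
  ext i j
  have e'' := e' i j
  simp only [connZ, connZbar, Matrix.add_apply, Matrix.mul_apply, Fin.sum_univ_three]
  fin_cases i <;> fin_cases j <;> simp at e'' ⊢ <;>
    first
    | linear_combination e''
    | linear_combination lam * e''
    | linear_combination lam⁻¹ * e''
    | (field_simp; linear_combination e'')
    | (field_simp at e'' ⊢; linear_combination e'')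

/-! ### Existence of the extended frame -/

/-- The operator `v ↦ vᵢ eⱼ` on row vectors. -/
def elemOp (i j : Fin 3) : (Fin 3 → ℂ) →L[ℝ] (Fin 3 → ℂ) :=
  (ContinuousLinearMap.single ℝ (fun _ : Fin 3 => ℂ) j).comp (ContinuousLinearMap.proj i)

/-- The operator `v ↦ v M` on row vectors. -/
def rowOp (M : Matrix (Fin 3) (Fin 3) ℂ) : (Fin 3 → ℂ) →L[ℝ] (Fin 3 → ℂ) :=
  ∑ i, ∑ j, M i j • elemOp i j

theorem rowOp_apply (M : Matrix (Fin 3) (Fin 3) ℂ) (v : Fin 3 → ℂ) (j : Fin 3) :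
    rowOp M v j = ∑ i, v i * M i j := by
  simp [rowOp, elemOp, Pi.single_apply, mul_comm]

/-- The operator-valued form `v ↦ v (A dz + B dz̄)`. -/
def connOp (A B : Matrix (Fin 3) (Fin 3) ℂ) : ℂ →L[ℝ] (Fin 3 → ℂ) →L[ℝ] (Fin 3 → ℂ) :=
  ∑ i, ∑ j, ((ContinuousLinearMap.id ℝ ℂ).smulRight (elemOp i j)).comp (wlin (A i j) (B i j))

theorem connOp_apply (A B : Matrix (Fin 3) (Fin 3) ℂ) (h : ℂ) (v : Fin 3 → ℂ) (j : Fin 3) :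
    connOp A B h v j = ∑ i, v i * (A i j * h + B i j * (starRingEnd ℂ) h) := by
  simp [connOp, elemOp, Pi.single_apply, mul_comm, wlin_apply]

theorem connOp_eq_rowOp (A B : Matrix (Fin 3) (Fin 3) ℂ) (h : ℂ) :
    connOp A B h = rowOp (h • A + (starRingEnd ℂ) h • B) := by
  refine ContinuousLinearMap.ext fun v => funext fun j => ?_
  simp only [connOp_apply, rowOp_apply, Matrix.add_apply, Matrix.smul_apply, smul_eq_mul,
    mul_comm h, mul_comm ((starRingEnd ℂ) h)]

theorem contDiffOn_connOp {D : Set ℂ} {A B : ℂ → Matrix (Fin 3) (Fin 3) ℂ}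
    (hA : ∀ i j, ContDiffOn ℝ ∞ (fun z => A z i j) D)
    (hB : ∀ i j, ContDiffOn ℝ ∞ (fun z => B z i j) D) :
    ContDiffOn ℝ ∞ (fun z => connOp (A z) (B z)) D := by
  unfold connOp
  refine ContDiffOn.sum fun i _ => ContDiffOn.sum fun j _ => ?_
  exact contDiffOn_const.clm_comp (contDiff_wlin.comp_contDiffOn ((hA i j).prodMk (hB i j)))

theorem hasFDerivAt_clm_apply_apply {E F : Type*} [NormedAddCommGroup E] [NormedSpace ℝ E]
    [NormedAddCommGroup F] [NormedSpace ℝ F] {θ : E → E →L[ℝ] F →L[ℝ] F}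
    {θ' : E →L[ℝ] E →L[ℝ] F →L[ℝ] F} {z : E} (h : HasFDerivAt θ θ' z) (k : E) (v : F) :
    HasFDerivAt (fun w => θ w k v) ((θ'.flip k).flip v) z := by
  refine ((h.clm_apply (hasFDerivAt_const k z)).clm_apply (hasFDerivAt_const v z)).congr_fderiv ?_
  ext
  simp

theorem fderiv_connOp {A B : ℂ → Matrix (Fin 3) (Fin 3) ℂ}
    {A₁ A₂ B₁ B₂ : Matrix (Fin 3) (Fin 3) ℂ} {z : ℂ} (hA : HasMW A A₁ A₂ z) (hB : HasMW B B₁ B₂ z)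
    (hd : DifferentiableAt ℝ (fun z => connOp (A z) (B z)) z) (h k : ℂ) (v : Fin 3 → ℂ)
    (j : Fin 3) : fderiv ℝ (fun z => connOp (A z) (B z)) z h k v j =
      ∑ i, v i * (k * (A₁ i j * h + A₂ i j * (starRingEnd ℂ) h) +
        (starRingEnd ℂ) k * (B₁ i j * h + B₂ i j * (starRingEnd ℂ) h)) := by
  have h1 := hasFDerivAt_pi'.1 (hasFDerivAt_clm_apply_apply hd.hasFDerivAt k v) j
  have h2 : HasW (fun w => connOp (A w) (B w) k v j)
      (∑ i, v i * (k * A₁ i j + (starRingEnd ℂ) k * B₁ i j))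
      (∑ i, v i * (k * A₂ i j + (starRingEnd ℂ) k * B₂ i j)) z := by
    simp only [connOp_apply, mul_comm _ k, mul_comm _ ((starRingEnd ℂ) k)]
    exact HasW.sum _ fun i _ =>
      (((hA i j).const_mul k).add ((hB i j).const_mul _)).const_mul (v i)
  have e := congrArg (fun T : ℂ →L[ℝ] ℂ => T h) (h1.unique h2)
  rw [wlin_apply] at e
  refine (show _ = ((ContinuousLinearMap.proj j).comp (((fderiv ℝ
    (fun z => connOp (A z) (B z)) z).flip k).flip v)) h from rfl).trans ?_
  rw [e, Finset.sum_mul, Finset.sum_mul, ← Finset.sum_add_distrib]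
  exact Finset.sum_congr rfl fun i _ => by ring

/-- Antisymmetrising in `h` and `k` leaves the single factor `k h̄ - h k̄` times the matrix identity
of `FlatAt`. This is the form of flatness used by the ray construction. -/
theorem FlatAt.connOp_flat {H : ℝ} {p U : ℂ → ℂ} {lam z : ℂ} (hf : FlatAt H p U lam z)
    (hd : DifferentiableAt ℝ (fun z => connOp (connZ H p U lam z) (connZbar H p U lam z)) z)
    (h k : ℂ) :
    fderiv ℝ (fun z => connOp (connZ H p U lam z) (connZbar H p U lam z)) z h k +
      connOp (connZ H p U lam z) (connZbar H p U lam z) k ∘L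
        connOp (connZ H p U lam z) (connZbar H p U lam z) h =
    fderiv ℝ (fun z => connOp (connZ H p U lam z) (connZbar H p U lam z)) z k h +
      connOp (connZ H p U lam z) (connZbar H p U lam z) h ∘L
        connOp (connZ H p U lam z) (connZbar H p U lam z) k := by
  obtain ⟨A₁, A₂, B₁, B₂, hA, hB, e⟩ := hf
  refine ContinuousLinearMap.ext fun v => funext fun j => ?_
  simp only [add_apply, Pi.add_apply, ContinuousLinearMap.comp_apply]
  rw [fderiv_connOp hA hB hd, fderiv_connOp hA hB hd]
  simp only [connOp_apply, Fin.sum_univ_three]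
  have e' := fun i => congrFun (congrFun e i) j
  simp only [Matrix.add_apply, Matrix.mul_apply, Fin.sum_univ_three] at e'
  linear_combination (k * (starRingEnd ℂ) h - h * (starRingEnd ℂ) k) *
    (v 0 * e' 0 + v 1 * e' 1 + v 2 * e' 2)

theorem continuousOn_rowOp {S : Set ℝ} {M : ℝ → Matrix (Fin 3) (Fin 3) ℂ}
    (h : ∀ i j, ContinuousOn (fun t => M t i j) S) : ContinuousOn (fun t => rowOp (M t)) S := by
  unfold rowOp
  exact continuousOn_finsetSum _ fun i _ => continuousOn_finsetSum _ fun j _ =>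
    (h i j).smul continuousOn_const

theorem rowOp_smul (M : Matrix (Fin 3) (Fin 3) ℂ) (c : ℂ) (v : Fin 3 → ℂ) :
    rowOp M (c • v) = c • rowOp M v := by
  ext j
  simp only [rowOp_apply, Pi.smul_apply, smul_eq_mul, Finset.mul_sum, mul_assoc]

theorem rowOp_add (M N : Matrix (Fin 3) (Fin 3) ℂ) : rowOp (M + N) = rowOp M + rowOp N := by
  refine ContinuousLinearMap.ext fun v => funext fun j => ?_
  simp only [add_apply, Pi.add_apply, rowOp_apply, Matrix.add_apply, mul_add,
    Finset.sum_add_distrib]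

theorem rowOp_smul_matrix (c : ℂ) (M : Matrix (Fin 3) (Fin 3) ℂ) :
    rowOp (c • M) = c • rowOp M := by
  refine ContinuousLinearMap.ext fun v => funext fun j => ?_
  simp only [smul_apply, Pi.smul_apply, rowOp_apply, Matrix.smul_apply, smul_eq_mul,
    Finset.mul_sum]
  exact Finset.sum_congr rfl fun i _ => by ring

/-- A connection form that is flat for all `λ` has a fundamental solution on a star-shaped domain,
holomorphic in `λ`. -/
theorem exists_fundamental_solution {V : Set ℂ} (hV : IsOpen V) (h0 : (0 : ℂ) ∈ V)
    (hs : StarConvex ℝ 0 V) {H : ℝ} {p U : ℂ → ℂ} (hp : ContDiffOn ℝ ∞ p V)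
    (hp0 : ∀ z ∈ V, p z ≠ 0) (hU : ContDiffOn ℝ ∞ U V)
    (hflat : ∀ z ∈ V, ∀ lam, lam ≠ 0 → FlatAt H p U lam z) :
    ∃ E : ℂ → ℂ → Matrix (Fin 3) (Fin 3) ℂ,
      (∀ lam, lam ≠ 0 → Solves V H p U lam fun z => E z lam) ∧ (∀ lam, lam ≠ 0 → E 0 lam = 1) ∧
      ∀ z ∈ V, ∀ i j, DifferentiableOn ℂ (fun lam => E z lam i j) {0}ᶜ := by
  have hray : ∀ z ∈ V, Set.MapsTo (fun t : ℝ => t • z) (Set.Icc 0 1) V := fun z hz t ht =>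
    hs.smul_mem hz ht.1 ht.2
  have hrc : ∀ z : ℂ, ContinuousOn (fun t : ℝ => t • z) (Set.Icc (0 : ℝ) 1) := fun z => by
    simp only [Complex.real_smul]
    fun_prop
  set θ : ℂ → ℂ → ℂ →L[ℝ] (Fin 3 → ℂ) →L[ℝ] (Fin 3 → ℂ) := fun lam z =>
    connOp (connZ H p U lam z) (connZbar H p U lam z) with hθ
  have hsm : ∀ lam, ContDiffOn ℝ ∞ (θ lam) V := fun lam =>
    contDiffOn_connOp (contDiffOn_connZ hV hp hp0 hU lam) (contDiffOn_connZbar hV hp hp0 hU lam)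
  have hex : ∀ (z lam : ℂ) (i : Fin 3), ∃ x : ℝ → Fin 3 → ℂ, z ∈ V →
      x 0 = Pi.single i 1 ∧ ∀ t ∈ Set.Icc (0 : ℝ) 1,
        HasDerivAt x (θ lam (t • z) z (x t)) t := fun z lam i => by
    by_cases hz : z ∈ V
    · obtain ⟨x, hx⟩ := exists_hasDerivAt_linear (a := fun t => θ lam (t • z) z)
        (((hsm lam).continuousOn.comp (hrc z) (hray z hz)).clm_apply continuousOn_const)
        (Pi.single i 1)
      exact ⟨x, fun _ => hx⟩
    · exact ⟨0, fun h => absurd h hz⟩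
  choose x hx using hex
  refine ⟨fun z lam => Matrix.of fun i => x z lam i 1, fun lam hl z hz i j => ?_,
    fun lam hl => ?_, fun z hz i j => ?_⟩
  · have h := hasFDerivAt_of_flat hV hs ((hsm lam).of_le (by simp))
      (fun z hz h k => (hflat z hz lam hl).connOp_flat
        (((hsm lam).differentiableOn (by simp)).differentiableAt (hV.mem_nhds hz)) h k)
      (v := Pi.single i 1) (x := fun z => x z lam i) (fun z hz => (hx z lam i hz).1)
      (fun z hz => (hx z lam i hz).2) hz
    refine (hasFDerivAt_pi'.1 h j).congr_fderiv (ContinuousLinearMap.ext fun k => ?_)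
    refine (connOp_apply _ _ k (x z lam i 1) j).trans ?_
    rw [wlin_apply]
    simp only [Matrix.mul_apply, Matrix.of_apply, Fin.sum_univ_three]
    ring
  · have h : ∀ i, x 0 lam i 1 = Pi.single i 1 := fun i => by
      have hc : ∀ t ∈ Set.Icc (0 : ℝ) 1, HasDerivAt (fun _ : ℝ => (Pi.single i 1 : Fin 3 → ℂ))
          (θ lam (t • 0) 0 (Pi.single i 1)) t := fun t _ => by
        rw [map_zero, zero_apply]
        exact hasDerivAt_const _ _
      exact linear_ode_unique (a := fun t => θ lam (t • 0) 0) (by simp [continuousOn_const])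
        (hx 0 lam i h0).2 hc (hx 0 lam i h0).1 (Set.right_mem_Icc.2 zero_le_one)
    ext i j
    refine (congrFun (h i) j).trans ?_
    rw [Matrix.one_apply, Pi.single_apply]
    simp only [eq_comm]
  · intro lam hl
    refine DifferentiableAt.differentiableWithinAt ?_
    have hcont : ∀ {M : ℂ → Matrix (Fin 3) (Fin 3) ℂ},
        (∀ i j, ContDiffOn ℝ ∞ (fun w => M w i j) V) → ∀ c : ℂ,
        ContinuousOn (fun t : ℝ => rowOp (c • M (t • z))) (Set.Icc 0 1) := fun hM c =>
      continuousOn_rowOp fun i j => by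
        simp only [Matrix.smul_apply]
        exact (((hM i j).continuousOn.comp (hrc z) (hray z hz)).const_smul c)
    have h := differentiableAt_linear_ode_param
      (a₀ := fun t => rowOp (z • connZDiag p (t • z)) +
        rowOp ((starRingEnd ℂ) z • connZbarDiag p (t • z)))
      (a₁ := fun t => rowOp (z • connZOff H p U (t • z)))
      (a₂ := fun t => rowOp ((starRingEnd ℂ) z • connZbarOff H p U (t • z)))
      ((hcont (contDiffOn_connZDiag hV hp hp0) z).add
        (hcont (contDiffOn_connZbarDiag hV hp hp0) _))
      (hcont (contDiffOn_connZOff hp hp0 hU) z) (hcont (contDiffOn_connZbarOff hp hp0 hU) _)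
      (fun t c v => by simp only [add_apply, rowOp_smul, smul_add])
      (fun t c v => rowOp_smul _ c v) (fun t c v => rowOp_smul _ c v)
      (v := Pi.single i 1) (x := fun l => x z l i) (fun l _ => (hx z l i hz).1)
      (fun l _ t ht => by
        have h := (hx z l i hz).2 t ht
        have e : θ l (t • z) z = rowOp (z • connZDiag p (t • z)) +
            rowOp ((starRingEnd ℂ) z • connZbarDiag p (t • z)) +
            l • rowOp (z • connZOff H p U (t • z)) +
            l⁻¹ • rowOp ((starRingEnd ℂ) z • connZbarOff H p U (t • z)) := by
          rw [hθ]
          simp only [connOp_eq_rowOp, connZ_eq, connZbar_eq, smul_add, rowOp_add,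
            rowOp_smul_matrix]
          rw [smul_comm z l, smul_comm ((starRingEnd ℂ) z) l⁻¹]
          abel
        rwa [e] at h) hl
    exact differentiableAt_pi.1 h j

theorem eps_pow_three : eps ^ 3 = -1 := by
  rw [eps, ← Complex.exp_nat_mul, ← Complex.exp_pi_mul_I]
  congr 1
  push_cast
  ring

theorem eps_ne_zero : eps ≠ 0 := Complex.exp_ne_zero _

theorem inv_eps : eps⁻¹ = -eps ^ 2 :=
  inv_eq_of_mul_eq_one_right (by linear_combination -eps_pow_three)

theorem det_matP : matP.det = -1 := by
  rw [matP, Matrix.det_fin_three]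
  simp
  linear_combination (eps ^ 3 - 1) * eps_pow_three

/-- The inverse-free form of the `σ`-condition can be differentiated in `z` and compared by
continuity in `λ`. -/
theorem sigma_eq_of_mul {g h : Matrix (Fin 3) (Fin 3) ℂ} (hg : g.det ≠ 0)
    (e : h * matP * gᵀ = matP) : sigma g = h := by
  have hP : IsUnit matP.det := by rw [det_matP]; exact isUnit_one.neg
  have hg' : IsUnit (gᵀ).det := by rw [Matrix.det_transpose]; exact isUnit_iff_ne_zero.2 hg
  have e' : matP * (gᵀ)⁻¹ = h * matP := by
    rw [← e, Matrix.mul_assoc, Matrix.mul_nonsing_inv _ hg', Matrix.mul_one, e]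
  rw [sigma, e', Matrix.mul_assoc, Matrix.mul_nonsing_inv _ hP, Matrix.mul_one]

/-- The connection form takes values in the twisted loop algebra. -/
theorem sigma_conn (H : ℝ) (p U : ℂ → ℂ) (lam z : ℂ) :
    connZ H p U (eps * lam) z * matP + matP * (connZ H p U lam z)ᵀ = 0 ∧
    connZbar H p U (eps * lam) z * matP + matP * (connZbar H p U lam z)ᵀ = 0 := by
  have h3 := eps_pow_three
  constructor
  · ext i j
    fin_cases i <;> fin_cases j <;>
      simp [connZ, matP, Fin.sum_univ_three, Matrix.vecMul, dotProduct] <;>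
      first
      | ring1
      | linear_combination (lam * (rootH H / 2) * p z) * h3
      | linear_combination (lam * (rootH H / 2) * p z * eps) * h3
      | linear_combination (lam * U z / p z ^ 2 * eps ^ 2) * h3
  · ext i j
    fin_cases i <;> fin_cases j <;>
      simp [connZbar, inv_eps, matP, Fin.sum_univ_three, Matrix.vecMul, dotProduct] <;>
      first
      | ring1
      | linear_combination (lam⁻¹ * (rootH H / 2) * p z) * h3
      | linear_combination (-(lam⁻¹ * (rootH H / 2) * p z)) * h3
      | linear_combination (lam⁻¹ * (rootH H / 2) * p z * (1 - eps ^ 3)) * h3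

/-- By `sigma_conn`, `E(ελ) P E(λ)ᵗ` has zero derivative, and its value at `z = 0` is `P`. The
determinant is constant because the connection is traceless. -/
theorem isSigmaLoop_of_solves {V : Set ℂ} (hV : IsOpen V) (hVc : IsPreconnected V)
    (h0 : (0 : ℂ) ∈ V) {H : ℝ} {p U : ℂ → ℂ} {E : ℂ → ℂ → Matrix (Fin 3) (Fin 3) ℂ}
    (hE : ∀ lam, lam ≠ 0 → Solves V H p U lam fun z => E z lam)
    (hE0 : ∀ lam, lam ≠ 0 → E 0 lam = 1)
    (hhol : ∀ z ∈ V, ∀ i j, DifferentiableOn ℂ (fun lam => E z lam i j) {0}ᶜ) {z : ℂ}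
    (hz : z ∈ V) : IsSigmaLoop (E z) := by
  have hdet : ∀ lam, lam ≠ 0 → (E z lam).det = 1 := fun lam hl => by
    rw [(hE lam hl).det_eq hV hVc hz h0, hE0 lam hl, Matrix.det_one]
  refine ⟨hhol z hz, hdet, fun lam hl => sigma_eq_of_mul (by rw [hdet lam hl]; exact one_ne_zero) ?_⟩
  have hl' := mul_ne_zero eps_ne_zero hl
  have key : ∀ w ∈ V, HasMW (fun w => E w (eps * lam) * matP * (E w lam)ᵀ) 0 0 w := fun w hw => by
    obtain ⟨e1, e2⟩ := sigma_conn H p U lam w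
    refine (((hE _ hl' w hw).mul_const matP).mul (hE lam hl w hw).transpose).of_eq ?_ ?_
    · rw [Matrix.transpose_mul]
      calc _ = E w (eps * lam) * (connZ H p U (eps * lam) w * matP +
            matP * (connZ H p U lam w)ᵀ) * (E w lam)ᵀ := by noncomm_ring
        _ = 0 := by rw [e1, Matrix.mul_zero, Matrix.zero_mul]
    · rw [Matrix.transpose_mul]
      calc _ = E w (eps * lam) * (connZbar H p U (eps * lam) w * matP +
            matP * (connZbar H p U lam w)ᵀ) * (E w lam)ᵀ := by noncomm_ring
        _ = 0 := by rw [e2, Matrix.mul_zero, Matrix.zero_mul]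
  have h := hasMW_zero_const hV hVc key hz h0
  simpa [hE0 lam hl, hE0 _ hl'] using h

theorem tau_one (H : ℝ) : tau H 1 = 1 := by
  rw [tau, inv_matT, Matrix.map_one _ (map_zero _) (map_one _), Matrix.mul_one, matT_mul_self]

/-- The frame of the given sphere is an invertible solution at `λ = 1`, so the connection is flat
there and hence for all `λ`. The `τ`-condition holds because `τ(E(1/λ̄))` solves the same equation
with the same initial value. -/
theorem exists_isNormalizedFrame {V : Set ℂ} (hV : IsOpen V) (h0 : (0 : ℂ) ∈ V)
    (hs : StarConvex ℝ 0 V) {H : ℝ} (hH : H ≠ 0) {ψ : ℂ → ℝ} {U : ℂ → ℂ} {r : ℂ → Fin 3 → ℝ}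
    (hr : IsAffineSphere V r H ψ U) :
    ∃ E : ℂ → ℂ → Matrix (Fin 3) (Fin 3) ℂ, IsNormalizedFrame V H ψ U E := by
  have hHc : (H : ℂ) ≠ 0 := Complex.ofReal_ne_zero.2 hH
  have hp := contDiffOn_expHalf hr.smooth_psi
  have hp0 : ∀ z ∈ V, expHalf ψ z ≠ 0 := fun z _ => expHalf_ne_zero ψ z
  have hVc : IsPreconnected V := (hs.isPathConnected h0).isConnected.isPreconnected
  have hr' : IsAffineSphere V r H ψ (fun z => 1 ^ 3 * U z) := by simpa using hr
  have hflat : ∀ z ∈ V, ∀ lam, lam ≠ 0 → FlatAt H (expHalf ψ) U lam z := fun z hz lam hl =>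
    FlatAt.of_one hV hp hp0 hr.smooth_U hz
      ((hr'.solves hV norm_one).flatAt hV hp hp0 hr.smooth_U
        (fun z hz => by
          rw [hr'.det_sphereFrame_eq hV one_ne_zero hz]
          exact neg_ne_zero.2 (mul_ne_zero Complex.I_ne_zero hHc)) hz) hl
  obtain ⟨E, hE, hE0, hhol⟩ := exists_fundamental_solution hV h0 hs hp hp0 hr.smooth_U hflat
  have hloop := fun z (hz : z ∈ V) => isSigmaLoop_of_solves hV hVc h0 hE hE0 hhol hz
  refine ⟨E, isFrame_of_solves hV hp hp0 hr.smooth_U hE, fun z hz => ⟨hloop z hz, fun lam hl => ?_⟩,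
    hE0⟩
  have hl' : ((starRingEnd ℂ) lam)⁻¹ ≠ 0 := inv_ne_zero ((map_ne_zero _).2 hl)
  refine Solves.eqOn hV hVc ((hE _ hl').tau hV hr.smooth_psi) (hE lam hl)
    (fun z hz => by rw [(hloop z hz).det lam hl]; exact one_ne_zero) h0 ?_ hz
  rw [hE0 _ hl', hE0 _ hl, tau_one]

/-- The frame of an affine sphere in terms of the normalized frame. -/
theorem sphereFrame_eq_mul {D : Set ℂ} (hD : IsOpen D) (hDc : IsPreconnected D)
    (h0 : (0 : ℂ) ∈ D) {H : ℝ} {ψ : ℂ → ℝ} {U : ℂ → ℂ} {E : ℂ → ℂ → Matrix (Fin 3) (Fin 3) ℂ}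
    (hE : IsNormalizedFrame D H ψ U E) {lam : ℂ} (hl : ‖lam‖ = 1) {R : ℂ → Fin 3 → ℝ}
    (hR : IsAffineSphere D R H ψ (fun z => lam ^ 3 * U z)) (hH : H ≠ 0) {z : ℂ} (hz : z ∈ D) :
    sphereFrame H ψ R lam 0 * E z lam = sphereFrame H ψ R lam z := by
  have hl0 := ne_zero_of_norm_one hl
  have hHc : (H : ℂ) ≠ 0 := Complex.ofReal_ne_zero.2 hH
  refine Solves.eqOn hD hDc ((hE.frame.solves hD hl0).const_mul _) (hR.solves hD hl)
    (fun z hz => ?_) h0 ?_ hz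
  · rw [hR.det_sphereFrame_eq hD hl0 hz]
    exact neg_ne_zero.2 (mul_ne_zero Complex.I_ne_zero hHc)
  · rw [hE.normalized lam hl0, Matrix.mul_one]

theorem conj_inv_of_norm_one {lam : ℂ} (h : ‖lam‖ = 1) : ((starRingEnd ℂ) lam)⁻¹ = lam := by
  rw [conj_eq_inv_of_norm_one h, inv_inv]

/-- The associated family of an affine sphere. -/
theorem exists_associated_family {V : Set ℂ} (hV : IsOpen V) (h0 : (0 : ℂ) ∈ V)
    (hs : StarConvex ℝ 0 V) {H : ℝ} (hH : H ≠ 0) {ψ : ℂ → ℝ} {U : ℂ → ℂ} {r : ℂ → Fin 3 → ℝ}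
    (hr : IsAffineSphere V r H ψ U) :
    ∃ (E : ℂ → ℂ → Matrix (Fin 3) (Fin 3) ℂ) (R : ℂ → ℂ → Fin 3 → ℝ),
      IsNormalizedFrame V H ψ U E ∧ Set.EqOn (R 1) r V ∧
      ∀ lam : ℂ, ‖lam‖ = 1 →
        IsAffineSphere V (R lam) H ψ (fun z => lam ^ 3 * U z) ∧
        ∀ z ∈ V, sphereFrame H ψ (R lam) lam z = sphereFrame H ψ (R lam) lam 0 * E z lam := by
  obtain ⟨E, hE⟩ := exists_isNormalizedFrame hV h0 hs hH hr
  have hHc : (H : ℂ) ≠ 0 := Complex.ofReal_ne_zero.2 hH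
  have hVc : IsPreconnected V := (hs.isPathConnected h0).isConnected.isPreconnected
  have hr' : IsAffineSphere V r H ψ (fun z => 1 ^ 3 * U z) := by simpa using hr
  -- One initial frame, that of `r` at `λ = 1`, serves for every `λ`: it is in real form and has the
  -- required determinant, so `F E(·, λ)` is the frame of a sphere.
  set F := sphereFrame H ψ r 1 0 with hF
  have hex : ∀ lam : ℂ, ∃ R : ℂ → Fin 3 → ℝ, ‖lam‖ = 1 →
      (∀ z ∈ V, cx R z = (-(H : ℂ))⁻¹ • thirdCol (F * E z lam)) ∧
      IsAffineSphere V R H ψ (fun z => lam ^ 3 * U z) ∧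
      ∀ z ∈ V, sphereFrame H ψ R lam z = F * E z lam := fun lam => by
    by_cases hl : ‖lam‖ = 1
    · have hl0 := ne_zero_of_norm_one hl
      obtain ⟨R, h⟩ := exists_isAffineSphere_of_solves hV hH hl hr.smooth_psi hr.smooth_U
        ((hE.frame.solves hV hl0).const_mul F)
        (fun z hz => (realForm_sphereFrame H ψ norm_one
          (differentiableAt_of_contDiffOn hV hr.smooth h0)).mul_tau (by
            have := (hE.loop z hz).2 lam hl0
            rwa [conj_inv_of_norm_one hl] at this))
        (fun z hz => by
          rw [Matrix.det_mul, (hE.loop z hz).1.det lam hl0, mul_one, hF,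
            hr'.det_sphereFrame_eq hV one_ne_zero h0])
      exact ⟨R, fun _ => h⟩
    · exact ⟨r, fun h => absurd h hl⟩
  choose R hR using hex
  refine ⟨E, R, hE, fun z hz => ?_, fun lam hl => ⟨(hR lam hl).2.1, fun z hz => ?_⟩⟩
  · have h1 := (hR 1 norm_one).1 z hz
    rw [hF, sphereFrame_eq_mul hV hVc h0 hE norm_one hr' hH hz] at h1
    funext i
    have h2 := congrFun h1 i
    rw [Pi.smul_apply, thirdCol, (sphereFrame_apply H ψ r 1 z i).2.2, smul_eq_mul,
      inv_mul_cancel_left₀ (neg_ne_zero.2 hHc)] at h2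
    exact Complex.ofReal_injective h2
  · rw [(hR lam hl).2.2 z hz, (hR lam hl).2.2 0 h0, hE.normalized lam (ne_zero_of_norm_one hl),
      Matrix.mul_one]

theorem IsAffineSphere.mono {D V : Set ℂ} {r : ℂ → Fin 3 → ℝ} {H : ℝ} {ψ : ℂ → ℝ} {U : ℂ → ℂ}
    (h : IsAffineSphere D r H ψ U) (hV : V ⊆ D) : IsAffineSphere V r H ψ U where
  smooth := h.smooth.mono hV
  smooth_psi := h.smooth_psi.mono hV
  smooth_U := h.smooth_U.mono hV
  metric z hz := h.metric z (hV hz)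
  shape z hz := h.shape z (hV hz)
  center z hz := h.center z (hV hz)
  cubic z hz := h.cubic z (hV hz)

/-! ### Algebra of the simple elements -/

/-- The numerator `(λ³ - β³) A g_{β,ℓ}(λ)` of the simple element of rank 1 type. -/
def numG (β b c d lam : ℂ) : Matrix (Fin 3) (Fin 3) ℂ :=
  !![d / (2 * b * c - 1) * (lam ^ 3 * (2 * b * c - 1) + β ^ 3),
      d / (2 * b * c - 1) * (2 * β * lam ^ 2 * c ^ 2), d / (2 * b * c - 1) * (2 * β ^ 2 * lam * c);
    d⁻¹ * (2 * β ^ 2 * lam * b ^ 2), d⁻¹ * (lam ^ 3 + β ^ 3 * (2 * b * c - 1)),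
      d⁻¹ * (2 * β * lam ^ 2 * b);
    2 * β * lam ^ 2 * b, 2 * β ^ 2 * lam * c, lam ^ 3 + β ^ 3]

/-- The adjoint `S N(-λ)ᵗ S` of `N = numG`, where `S` is the permutation of the first two
coordinates. -/
def adjG (β b c d lam : ℂ) : Matrix (Fin 3) (Fin 3) ℂ :=
  !![d⁻¹ * (β ^ 3 * (2 * b * c - 1) - lam ^ 3), d / (2 * b * c - 1) * (2 * β * lam ^ 2 * c ^ 2),
      -(2 * β ^ 2 * lam * c);
    -(d⁻¹ * (2 * β ^ 2 * lam * b ^ 2)), d / (2 * b * c - 1) * (β ^ 3 - lam ^ 3 * (2 * b * c - 1)),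
      2 * β * lam ^ 2 * b;
    d⁻¹ * (2 * β * lam ^ 2 * b), -(d / (2 * b * c - 1) * (2 * β ^ 2 * lam * c)), β ^ 3 - lam ^ 3]

theorem smul_simpleG {β b c d lam : ℂ} (hs : 2 * b * c - 1 ≠ 0) (hl : lam ^ 3 ≠ β ^ 3) :
    (lam ^ 3 - β ^ 3) • simpleG β b c d lam = numG β b c d lam := by
  have hl' := sub_ne_zero.2 hl
  ext i j
  fin_cases i <;> fin_cases j <;> simp [simpleG, numG, Matrix.diagonal_mul] <;> field_simp <;> ring

/-- The rank 2 element at `α` has the numerator of the rank 1 element at `-α`. One polynomial matrix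
thus serves both cases, and in the rank 2 case the line is evaluated at `-α`. -/
theorem smul_simpleM {α b c d lam : ℂ} (hs : 2 * b * c - 1 ≠ 0) (hl : lam ^ 3 ≠ α ^ 3) :
    (lam ^ 3 - α ^ 3) • simpleM α b c d lam = numG (-α) b c d lam := by
  have hl' := sub_ne_zero.2 hl
  ext i j
  fin_cases i <;> fin_cases j <;> simp [simpleM, numG, Matrix.diagonal_mul] <;> field_simp <;> ring

/-- An inverse that is polynomial in `λ` up to a scalar. The scalar locates the six values of `λ` at
which a factorization through `numG` can fail. -/
theorem numG_mul_adjG {β b c d lam : ℂ} (hs : 2 * b * c - 1 ≠ 0) (hd : d ≠ 0) :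
    numG β b c d lam * adjG β b c d lam = (β ^ 6 - lam ^ 6) • 1 := by
  ext i j
  fin_cases i <;> fin_cases j <;>
    simp [numG, adjG] <;> field_simp <;> ring

theorem adjG_mul_numG {β b c d lam : ℂ} (hs : 2 * b * c - 1 ≠ 0) (hd : d ≠ 0) :
    adjG β b c d lam * numG β b c d lam = (β ^ 6 - lam ^ 6) • 1 := by
  ext i j
  fin_cases i <;> fin_cases j <;>
    simp [numG, adjG] <;> field_simp <;> ring

theorem det_numG {β b c d lam : ℂ} (hs : 2 * b * c - 1 ≠ 0) (hd : d ≠ 0) :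
    (numG β b c d lam).det = (lam ^ 3 - β ^ 3) ^ 2 * (lam ^ 3 + β ^ 3) := by
  rw [numG, Matrix.det_fin_three]
  simp
  field_simp
  ring

theorem det_numG_ne_zero {β b c d lam : ℂ} (hs : 2 * b * c - 1 ≠ 0) (hd : d ≠ 0)
    (hl : β ^ 6 - lam ^ 6 ≠ 0) : (numG β b c d lam).det ≠ 0 := by
  rw [det_numG hs hd]
  intro h0
  rcases mul_eq_zero.1 h0 with h0 | h0
  · exact hl (by linear_combination (-(lam ^ 3 + β ^ 3)) * (pow_eq_zero_iff two_ne_zero).1 h0)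
  · exact hl (by linear_combination (-(lam ^ 3 - β ^ 3)) * h0)

/-- The `σ`-condition before normalisation; the denominators of the simple element at `λ` and `ελ`
later cancel the scalar. -/
theorem numG_mul_matP {β b c d lam : ℂ} (hs : 2 * b * c - 1 ≠ 0) (hd : d ≠ 0) :
    numG β b c d (eps * lam) * matP * (numG β b c d lam)ᵀ = (β ^ 6 - lam ^ 6) • matP := by
  have h3 := eps_pow_three
  have h4 : eps ^ 4 = -eps := by linear_combination eps * h3
  ext i j
  fin_cases i <;> fin_cases j <;>
    simp [numG, matP, h4, Fin.sum_univ_three, Matrix.vecMul, dotProduct, mul_pow, h3] <;>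
    field_simp <;> ring_nf <;> simp only [h3, h4] <;> ring

/-- `adjG` for `d² = 2bc - 1`, in terms of `e = 1/d`. -/
def adjE (β b c e lam : ℂ) : Matrix (Fin 3) (Fin 3) ℂ :=
  !![e * (β ^ 3 * (2 * b * c - 1) - lam ^ 3), e * (2 * β * lam ^ 2 * c ^ 2),
      -(2 * β ^ 2 * lam * c);
    -(e * (2 * β ^ 2 * lam * b ^ 2)), e * (β ^ 3 - lam ^ 3 * (2 * b * c - 1)),
      2 * β * lam ^ 2 * b;
    e * (2 * β * lam ^ 2 * b), -(e * (2 * β ^ 2 * lam * c)), β ^ 3 - lam ^ 3]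

/-- With `d² = 2bc - 1` the two row factors of the numerator become one, and differentiation only
involves the inverse `e = 1/d`. -/
theorem adjG_eq_adjE {β b c d lam : ℂ} (hd : d ^ 2 = 2 * b * c - 1) (hd0 : d ≠ 0) :
    adjG β b c d lam = adjE β b c d⁻¹ lam := by
  have e : d / (2 * b * c - 1) = d⁻¹ := by rw [← hd]; field_simp
  rw [adjG, adjE, e]

/-- The directional derivative of `adjE` in the parameters. -/
def dAdjE (β b c e b' c' e' lam : ℂ) : Matrix (Fin 3) (Fin 3) ℂ :=
  !![e' * (β ^ 3 * (2 * b * c - 1) - lam ^ 3) + e * (β ^ 3 * (2 * (b' * c + b * c'))),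
      e' * (2 * β * lam ^ 2 * c ^ 2) + e * (2 * β * lam ^ 2 * (2 * c * c')),
      -(2 * β ^ 2 * lam * c');
    -(e' * (2 * β ^ 2 * lam * b ^ 2) + e * (2 * β ^ 2 * lam * (2 * b * b'))),
      e' * (β ^ 3 - lam ^ 3 * (2 * b * c - 1)) - e * (lam ^ 3 * (2 * (b' * c + b * c'))),
      2 * β * lam ^ 2 * b';
    e' * (2 * β * lam ^ 2 * b) + e * (2 * β * lam ^ 2 * b'),
      -(e' * (2 * β ^ 2 * lam * c) + e * (2 * β ^ 2 * lam * c')), 0]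

theorem hasMW_adjE (β lam : ℂ) {b c e : ℂ → ℂ} {b₁ b₂ c₁ c₂ e₁ e₂ z : ℂ} (hb : HasW b b₁ b₂ z)
    (hc : HasW c c₁ c₂ z) (he : HasW e e₁ e₂ z) :
    HasMW (fun w => adjE β (b w) (c w) (e w) lam) (dAdjE β (b z) (c z) (e z) b₁ c₁ e₁ lam)
      (dAdjE β (b z) (c z) (e z) b₂ c₂ e₂ lam) z := by
  have hs : HasW (fun w => 2 * b w * c w - 1) (2 * (b₁ * c z + b z * c₁))
      (2 * (b₂ * c z + b z * c₂)) z :=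
    (((hb.const_mul 2).mul hc).sub (hasW_const 1 z)).of_eq (by ring) (by ring)
  have hbb : HasW (fun w => b w ^ 2) (2 * b z * b₁) (2 * b z * b₂) z := by
    simp only [sq]
    exact (hb.mul hb).of_eq (by ring) (by ring)
  have hcc : HasW (fun w => c w ^ 2) (2 * c z * c₁) (2 * c z * c₂) z := by
    simp only [sq]
    exact (hc.mul hc).of_eq (by ring) (by ring)
  have h00 := he.mul ((hs.const_mul (β ^ 3)).sub (hasW_const (lam ^ 3) z))
  have h01 := he.mul (hcc.const_mul (2 * β * lam ^ 2))
  have h02 := (hc.const_mul (2 * β ^ 2 * lam)).neg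
  have h10 := (he.mul (hbb.const_mul (2 * β ^ 2 * lam))).neg
  have h11 := he.mul ((hasW_const (β ^ 3) z).sub (hs.const_mul (lam ^ 3)))
  have h12 := hb.const_mul (2 * β * lam ^ 2)
  have h20 := he.mul (hb.const_mul (2 * β * lam ^ 2))
  have h21 := (he.mul (hc.const_mul (2 * β ^ 2 * lam))).neg
  have h22 := hasW_const (β ^ 3 - lam ^ 3) z
  intro i j
  fin_cases i <;> fin_cases j <;> simp only [adjE, dAdjE]
  · exact h00.of_eq (by simp) (by simp)
  · exact h01.of_eq (by simp) (by simp)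
  · exact h02.of_eq (by simp) (by simp)
  · exact h10.of_eq (by simp) (by simp)
  · exact h11.of_eq (by simp; ring) (by simp; ring)
  · exact h12.of_eq (by simp) (by simp)
  · exact h20.of_eq (by simp) (by simp)
  · exact h21.of_eq (by simp) (by simp)
  · exact h22.of_eq (by simp) (by simp)

/-- `hb` and `hc` are the Riccati equations of the moving line, and `t` is the logarithmic
derivative of `d`. They make `adjE` intertwine the old `dz`-part with the one in which `x` becomes
`x d` and `u` becomes `u / d²`. The entries are compared after multiplication by `2bc - 1`. -/
theorem gauge_adjE {β b c e lam q x u b' c' t d : ℂ} (hs : 2 * b * c - 1 ≠ 0)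
    (he : e ^ 2 * (2 * b * c - 1) = 1) (ht : t * (2 * b * c - 1) = b' * c + b * c')
    (hd : d = e * (2 * b * c - 1)) (hb : b' = b * q + c * β * u - b ^ 2 * β * x)
    (hc : c' = -c * q + β * x - b * c * β * x) :
    !![q, 0, lam * x; lam * u, -q, 0; 0, lam * x, 0] * adjE β b c e lam +
      dAdjE β b c e b' c' (-(e * t)) lam =
    adjE β b c e lam * !![q + t, 0, lam * x * d; lam * u * e ^ 2, -(q + t), 0;
      0, lam * x * d, 0] := by
  subst hb hc hd
  ext i j
  fin_cases i <;> fin_cases j <;> simp [adjE, dAdjE] <;> refine mul_left_cancel₀ hs ?_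
  · linear_combination (-(lam * u * (e * (2 * β * lam ^ 2 * c ^ 2)))) * he -
      2 * (e * (β ^ 3 * (2 * b * c - 1) - lam ^ 3)) * ht
  · ring
  · linear_combination (-(lam * x * (β ^ 3 * (2 * b * c - 1) - lam ^ 3)) * (2 * b * c - 1)) * he
  · linear_combination (-(lam * u * (e * (β ^ 3 - lam ^ 3 * (2 * b * c - 1))))) * he +
      2 * (e * (2 * β ^ 2 * lam * b ^ 2)) * ht
  · ring
  · linear_combination (lam * x * (2 * β ^ 2 * lam * b ^ 2) * (2 * b * c - 1)) * he
  · linear_combination (lam * u * (e * (2 * β ^ 2 * lam * c))) * he -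
      2 * (e * (2 * β * lam ^ 2 * b)) * ht
  · ring
  · linear_combination (-(lam * x * (2 * β * lam ^ 2 * b)) * (2 * b * c - 1)) * he

/-- In the `dz̄`-part the connection carries `λ⁻¹` and the Riccati equations carry `β⁻¹`. Writing
the coefficients as `β w`, `β x` in the former and `λ w`, `λ x` in the latter removes both inverses.
-/
theorem gauge_bar_adjE {β b c e lam q x w b' c' t d : ℂ} (hs : 2 * b * c - 1 ≠ 0)
    (he : e ^ 2 * (2 * b * c - 1) = 1) (ht : t * (2 * b * c - 1) = b' * c + b * c')
    (hd : d = e * (2 * b * c - 1)) (hb : b' = -b * q + lam * x - b * c * lam * x)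
    (hc : c' = b * lam * w + c * q - c ^ 2 * lam * x) :
    !![-q, β * w, 0; 0, q, β * x; β * x, 0, 0] * adjE β b c e lam +
      dAdjE β b c e b' c' (-(e * t)) lam =
    adjE β b c e lam * !![-(q + t), β * w * e ^ 2, 0; 0, q + t, β * x * d;
      β * x * d, 0, 0] := by
  subst hb hc hd
  ext i j
  fin_cases i <;> fin_cases j <;> simp [adjE, dAdjE] <;> refine mul_left_cancel₀ hs ?_
  · ring
  · linear_combination (-(β * w * (e * (β ^ 3 * (2 * b * c - 1) - lam ^ 3)))) * he -
      2 * (e * (2 * β * lam ^ 2 * c ^ 2)) * ht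
  · linear_combination (-(β * x * (2 * β * lam ^ 2 * c ^ 2)) * (2 * b * c - 1)) * he
  · ring
  · linear_combination (β * w * (e * (2 * β ^ 2 * lam * b ^ 2))) * he -
      2 * (e * (β ^ 3 - lam ^ 3 * (2 * b * c - 1))) * ht
  · linear_combination (-(β * x * (β ^ 3 - lam ^ 3 * (2 * b * c - 1))) * (2 * b * c - 1)) * he
  · ring
  · linear_combination (-(β * w * (e * (2 * β * lam ^ 2 * b)))) * he +
      2 * (e * (2 * β ^ 2 * lam * c)) * ht
  · linear_combination (-(β * x * (2 * β ^ 2 * lam * c)) * (2 * b * c - 1)) * he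

/-! ### Symmetries of twisted loops -/

/-- The permutation matrix of the first two coordinates. -/
def swapS : Matrix (Fin 3) (Fin 3) ℂ := !![0, 1, 0; 1, 0, 0; 0, 0, 1]

/-- The diagonal matrix by which `λ ↦ μ λ`, `μ³ = 1`, acts on twisted loops. -/
def cubeDiag (μ : ℂ) : Matrix (Fin 3) (Fin 3) ℂ := Matrix.diagonal ![μ, μ ^ 2, 1]

theorem eps_re : eps.re = 1 / 2 := by
  have e : eps = Complex.exp ((Real.pi / 3 : ℝ) * Complex.I) := by
    rw [eps]; congr 1; push_cast; ring
  rw [e, Complex.exp_ofReal_mul_I_re, Real.cos_pi_div_three]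

/-- The relation `ε³ = -1` alone would allow `ε = -1`; the real part excludes it. -/
theorem eps_sq : eps ^ 2 = eps - 1 := by
  have h : (eps + 1) * (eps ^ 2 - (eps - 1)) = 0 := by linear_combination eps_pow_three
  rcases mul_eq_zero.1 h with h | h
  · have := congrArg Complex.re h
    rw [Complex.add_re, eps_re, Complex.one_re, Complex.zero_re] at this
    norm_num at this
  · exact sub_eq_zero.1 h

theorem eq_of_pow_three_eq_one {μ : ℂ} (h : μ ^ 3 = 1) :
    μ = 1 ∨ μ = eps ^ 2 ∨ μ = eps ^ 2 * eps ^ 2 := by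
  have : (μ - 1) * ((μ - eps ^ 2) * (μ - eps ^ 2 * eps ^ 2)) = 0 := by
    rw [eps_sq]
    linear_combination h + (μ - 1) * (-μ + eps - 2) * eps_sq
  rcases mul_eq_zero.1 this with h | h
  · exact Or.inl (sub_eq_zero.1 h)
  · rcases mul_eq_zero.1 h with h | h
    · exact Or.inr (Or.inl (sub_eq_zero.1 h))
    · exact Or.inr (Or.inr (sub_eq_zero.1 h))

theorem cubeDiag_mul (μ ν : ℂ) : cubeDiag μ * cubeDiag ν = cubeDiag (μ * ν) := by
  rw [cubeDiag, cubeDiag, cubeDiag, Matrix.diagonal_mul_diagonal]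
  congr 1
  funext i
  fin_cases i <;> simp [mul_pow]

theorem cubeDiag_one : cubeDiag 1 = 1 := by
  rw [cubeDiag, ← Matrix.diagonal_one]
  congr 1
  funext i
  fin_cases i <;> simp

theorem det_cubeDiag {μ : ℂ} (h : μ ^ 3 = 1) : (cubeDiag μ).det = 1 := by
  rw [cubeDiag, Matrix.det_diagonal, Fin.prod_univ_three]
  simp
  linear_combination h

theorem eps_sq_pow_three : (eps ^ 2) ^ 3 = 1 := by
  linear_combination (eps ^ 3 - 1) * eps_pow_three

theorem cubeDiag_mul_matP : cubeDiag (eps ^ 2) * matPᵀ = matP := by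
  have h := eps_pow_three
  ext i j
  fin_cases i <;> fin_cases j <;> simp [cubeDiag, matP, Matrix.diagonal_mul]
  · ring
  · linear_combination (eps ^ 5 - eps ^ 2) * h

theorem swapS_mul_cubeDiag : swapS * cubeDiag (eps ^ 2) = matP := by
  ext i j
  fin_cases i <;> fin_cases j <;> simp [cubeDiag, matP, swapS, Matrix.mul_diagonal]
  ring

theorem matrix_mul_right_cancel {X Y Z : Matrix (Fin 3) (Fin 3) ℂ} (hZ : Z.det ≠ 0)
    (h : X * Z = Y * Z) : X = Y := by
  have := congrArg (· * Z⁻¹) h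
  simpa [Matrix.mul_assoc, Matrix.mul_nonsing_inv _ (isUnit_iff_ne_zero.2 hZ)] using this

section Loop

variable {g : ℂ → Matrix (Fin 3) (Fin 3) ℂ}

theorem mul_matP_of_sigma {g h : Matrix (Fin 3) (Fin 3) ℂ} (hg : g.det ≠ 0) (e : sigma g = h) :
    h * matP * gᵀ = matP := by
  have hP : IsUnit matP.det := by rw [det_matP]; exact isUnit_one.neg
  have hg' : IsUnit (gᵀ).det := by rw [Matrix.det_transpose]; exact isUnit_iff_ne_zero.2 hg
  rw [← e, sigma, Matrix.mul_assoc _ matP⁻¹, Matrix.nonsing_inv_mul _ hP, Matrix.mul_one,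
    Matrix.mul_assoc, Matrix.nonsing_inv_mul _ hg', Matrix.mul_one]

theorem IsSigmaLoop.mul_matP (hg : IsSigmaLoop g) {lam : ℂ} (hl : lam ≠ 0) :
    g (eps * lam) * matP * (g lam)ᵀ = matP :=
  mul_matP_of_sigma (by rw [hg.det lam hl]; exact one_ne_zero) (hg.sigma_real lam hl)

/-- Using the `σ`-condition at `λ` and at `ελ` eliminates the transposed inverse: `σ²` is
conjugation by a diagonal matrix. -/
theorem IsSigmaLoop.eps_sq_mul (hg : IsSigmaLoop g) {lam : ℂ} (hl : lam ≠ 0) :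
    g (eps ^ 2 * lam) * cubeDiag (eps ^ 2) = cubeDiag (eps ^ 2) * g lam := by
  have hl' := mul_ne_zero eps_ne_zero hl
  have h1 := congrArg Matrix.transpose (hg.mul_matP hl)
  have h2 := hg.mul_matP hl'
  rw [Matrix.transpose_mul, Matrix.transpose_mul, Matrix.transpose_transpose] at h1
  rw [← mul_assoc, ← sq, ← cubeDiag_mul_matP] at h2
  refine matrix_mul_right_cancel (Z := matPᵀ * (g (eps * lam))ᵀ) ?_ ?_
  · rw [Matrix.det_mul, Matrix.det_transpose, Matrix.det_transpose, hg.det _ hl', det_matP]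
    norm_num
  · rw [Matrix.mul_assoc (cubeDiag _), h1, ← h2]
    simp only [Matrix.mul_assoc]

theorem IsSigmaLoop.cube_mul (hg : IsSigmaLoop g) {μ lam : ℂ} (hμ : μ ^ 3 = 1) (hl : lam ≠ 0) :
    g (μ * lam) * cubeDiag μ = cubeDiag μ * g lam := by
  rcases eq_of_pow_three_eq_one hμ with rfl | rfl | rfl
  · rw [cubeDiag_one, one_mul, Matrix.mul_one, Matrix.one_mul]
  · exact hg.eps_sq_mul hl
  · rw [← cubeDiag_mul, mul_assoc, ← Matrix.mul_assoc,
      hg.eps_sq_mul (mul_ne_zero (pow_ne_zero 2 eps_ne_zero) hl), Matrix.mul_assoc,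
      hg.eps_sq_mul hl, Matrix.mul_assoc]

/-- The third iterate of `σ`. As `ε³ = -1`, it relates `λ` to `-λ`, and its matrix is the plain swap
of two coordinates. -/
theorem IsSigmaLoop.neg_mul (hg : IsSigmaLoop g) {lam : ℂ} (hl : lam ≠ 0) :
    g (-lam) * swapS * (g lam)ᵀ = swapS := by
  have hl' := mul_ne_zero (pow_ne_zero 2 eps_ne_zero) hl
  have h1 := hg.mul_matP hl'
  have h2 := congrArg Matrix.transpose (hg.eps_sq_mul hl)
  have hC : (cubeDiag (eps ^ 2))ᵀ = cubeDiag (eps ^ 2) := Matrix.diagonal_transpose _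
  have e : eps * (eps ^ 2 * lam) = -lam := by linear_combination lam * eps_pow_three
  rw [Matrix.transpose_mul, Matrix.transpose_mul, hC] at h2
  rw [e, ← swapS_mul_cubeDiag] at h1
  refine matrix_mul_right_cancel (Z := cubeDiag (eps ^ 2)) ?_ ?_
  · rw [det_cubeDiag eps_sq_pow_three]; exact one_ne_zero
  · rw [Matrix.mul_assoc, ← h2, ← h1]
    simp only [Matrix.mul_assoc]

/-- The row vector `(μ² b, μ c, 1)`. -/
def rowVec (μ b c : ℂ) : Fin 3 → ℂ := ![μ ^ 2 * b, μ * c, 1]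

/-- The column vector `(μ c, μ² b, 1)`. -/
def colVec (μ b c : ℂ) : Fin 3 → ℂ := ![μ * c, μ ^ 2 * b, 1]

/-- The cubic symmetry moves the relation between the old and the new line from `λ` to `μλ`,
replacing both lines by diagonal images. -/
theorem IsSigmaLoop.rowVec_vecMul (hg : IsSigmaLoop g) {μ lam b c bt ct v : ℂ} (hμ : μ ^ 3 = 1)
    (hl : lam ≠ 0) (h : ![b, c, 1] ᵥ* g lam = v • ![bt, ct, 1]) :
    rowVec μ b c ᵥ* g (μ * lam) = v • rowVec μ bt ct := by
  have e : rowVec μ b c ᵥ* cubeDiag μ = ![b, c, 1] := by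
    funext i
    rw [cubeDiag, Matrix.vecMul_diagonal]
    fin_cases i <;> simp [rowVec]
    · linear_combination b * hμ
    · linear_combination c * hμ
  have h1 : (rowVec μ b c ᵥ* g (μ * lam)) ᵥ* cubeDiag μ = v • ![bt, ct, 1] := by
    rw [Matrix.vecMul_vecMul, hg.cube_mul hμ hl, ← Matrix.vecMul_vecMul, e, h]
  generalize rowVec μ b c ᵥ* g (μ * lam) = y at h1 ⊢
  have h2 := fun i => congrFun h1 i
  simp only [cubeDiag, Matrix.vecMul_diagonal] at h2
  funext i
  have h0 := h2 0
  have h1' := h2 1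
  have h2' := h2 2
  simp at h0 h1' h2'
  fin_cases i <;> simp [rowVec]
  · linear_combination μ ^ 2 * h0 - y 0 * hμ
  · linear_combination μ * h1' - y 1 * hμ
  · exact h2'

/-- The symmetry `λ ↦ -λ` turns the row relation at `μλ` into a column relation at `-μλ`. One
condition at `β` thus controls all six roots of `λ⁶ = β⁶`. -/
theorem IsSigmaLoop.mulVec_colVec (hg : IsSigmaLoop g) {μ lam b c bt ct v : ℂ} (hμ : μ ^ 3 = 1)
    (hl : lam ≠ 0) (h : ![b, c, 1] ᵥ* g lam = v • ![bt, ct, 1]) :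
    v • (g (-(μ * lam)) *ᵥ colVec μ bt ct) = colVec μ b c := by
  have hμ0 : μ ≠ 0 := fun h => by simp [h] at hμ
  have e : ∀ b c, swapS *ᵥ rowVec μ b c = colVec μ b c := fun b c => by
    funext i
    fin_cases i <;> simp [swapS, rowVec, colVec, Matrix.mulVec, dotProduct, Fin.sum_univ_three]
  rw [← e, ← Matrix.mulVec_smul, ← Matrix.mulVec_smul, ← hg.rowVec_vecMul hμ hl h,
    ← Matrix.mulVec_transpose, Matrix.mulVec_mulVec, Matrix.mulVec_mulVec,
    hg.neg_mul (mul_ne_zero hμ0 hl), e]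

end Loop

/-- At the roots of `λ³ = β³` the numerator degenerates: every row is a multiple of the translated
line. -/
theorem numG_eq_vecMulVec {β b c d μ : ℂ} (hμ : μ ^ 3 = 1) :
    numG β b c d (μ * β) = Matrix.vecMulVec ![d / (2 * b * c - 1) * (2 * β ^ 3 * (μ * c)),
      d⁻¹ * (2 * β ^ 3 * (μ ^ 2 * b)), 2 * β ^ 3] (rowVec μ b c) := by
  ext i j
  fin_cases i <;> fin_cases j <;> simp [numG, Matrix.vecMulVec_apply, rowVec]
  · linear_combination (d / (2 * b * c - 1) * β ^ 3 * (2 * b * c - 1 - 2 * b * c)) * hμ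
  · ring
  · exact Or.inl (by ring)
  · linear_combination (-(2 * d⁻¹ * β ^ 3 * b ^ 2 * μ)) * hμ
  · linear_combination (d⁻¹ * β ^ 3 * (1 - 2 * b * c)) * hμ
  · exact Or.inl (by ring)
  · ring
  · ring
  · linear_combination β ^ 3 * hμ

/-- At the roots of `λ³ = -β³` it is the adjoint that degenerates, with every column a multiple of
the translated column vector. -/
theorem adjG_eq_vecMulVec {β b c d μ : ℂ} (hμ : μ ^ 3 = 1) :
    adjG β b c d (-(μ * β)) = Matrix.vecMulVec (colVec μ b c) ![d⁻¹ * (2 * β ^ 3 * (μ ^ 2 * b)),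
      d / (2 * b * c - 1) * (2 * β ^ 3 * (μ * c)), 2 * β ^ 3] := by
  ext i j
  fin_cases i <;> fin_cases j <;> simp [adjG, Matrix.vecMulVec_apply, colVec]
  · linear_combination (d⁻¹ * β ^ 3 * (1 - 2 * b * c)) * hμ
  · ring
  · ring
  · linear_combination (-(2 * d⁻¹ * β ^ 3 * b ^ 2 * μ)) * hμ
  · linear_combination (d / (2 * b * c - 1) * β ^ 3 * (2 * b * c - 1 - 2 * b * c)) * hμ
  · ring
  · exact Or.inl (by ring)
  · exact Or.inl (by ring)
  · linear_combination β ^ 3 * hμ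

theorem rowVec_vecMul_adjG {β b c d μ : ℂ} (hμ : μ ^ 3 = 1) :
    rowVec μ b c ᵥ* adjG β b c d (μ * β) = 0 := by
  funext i
  fin_cases i <;> simp [adjG, Matrix.vecMul, dotProduct, Fin.sum_univ_three, rowVec]
  · linear_combination (-(d⁻¹ * β ^ 3 * μ ^ 2 * b)) * hμ
  · linear_combination (2 * d / (2 * b * c - 1) * β ^ 3 * μ * b * c ^ 2 -
      d / (2 * b * c - 1) * β ^ 3 * μ * c * (2 * b * c - 1)) * hμ
  · linear_combination (-β ^ 3) * hμ

theorem numG_mulVec_colVec {β b c d μ : ℂ} (hμ : μ ^ 3 = 1) :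
    numG β b c d (-(μ * β)) *ᵥ colVec μ b c = 0 := by
  funext i
  fin_cases i <;> simp [numG, Matrix.mulVec, dotProduct, Fin.sum_univ_three, colVec]
  · linear_combination (2 * d / (2 * b * c - 1) * β ^ 3 * μ * b * c ^ 2 -
      d / (2 * b * c - 1) * β ^ 3 * μ * c * (2 * b * c - 1)) * hμ
  · linear_combination (-(d⁻¹ * β ^ 3 * μ ^ 2 * b)) * hμ
  · linear_combination (-β ^ 3) * hμ

/-! ### Dressing of a twisted loop -/

theorem hasDerivAt_pow_six (β lam : ℂ) :
    HasDerivAt (fun l => β ^ 6 - l ^ 6) (-(6 * lam ^ 5)) lam := by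
  simpa using (hasDerivAt_pow 6 lam).const_sub (β ^ 6)

theorem eventually_pow_six_ne (β : ℂ) {lam : ℂ} (hl : lam ≠ 0) :
    ∀ᶠ l in nhdsWithin lam {lam}ᶜ, l ≠ 0 ∧ β ^ 6 - l ^ 6 ≠ 0 := by
  have h1 : ∀ᶠ l in nhdsWithin lam {lam}ᶜ, l ≠ 0 :=
    nhdsWithin_le_nhds (isOpen_compl_singleton.mem_nhds hl)
  have h2 := (hasDerivAt_pow_six β lam).eventually_ne (c := 0)
    (neg_ne_zero.2 (mul_ne_zero (by norm_num) (pow_ne_zero 5 hl)))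
  filter_upwards [h1, h2] with l a b using ⟨a, b⟩

/-- Two continuous functions on `ℂ \ {0}` that agree where `λ⁶ ≠ β⁶` agree. -/
theorem eq_of_eq_off_roots (β : ℂ) {f g : ℂ → ℂ} (hf : ContinuousOn f {0}ᶜ)
    (hg : ContinuousOn g {0}ᶜ) (h : ∀ l, l ≠ 0 → β ^ 6 - l ^ 6 ≠ 0 → f l = g l) {lam : ℂ}
    (hl : lam ≠ 0) : f lam = g lam := by
  have hn : ({0}ᶜ : Set ℂ) ∈ nhds lam := isOpen_compl_singleton.mem_nhds hl
  have h1 := (hf.continuousAt hn).tendsto.mono_left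
    (nhdsWithin_le_nhds (s := {lam}ᶜ))
  have h2 := (hg.continuousAt hn).tendsto.mono_left
    (nhdsWithin_le_nhds (s := {lam}ᶜ))
  refine tendsto_nhds_unique (h1.congr' ?_) h2
  filter_upwards [eventually_pow_six_ne β hl] with l hl using h l hl.1 hl.2

theorem matrix_eq_of_eq_off_roots (β : ℂ) {f g : ℂ → Matrix (Fin 3) (Fin 3) ℂ}
    (hf : ∀ i j, ContinuousOn (fun l => f l i j) {0}ᶜ)
    (hg : ∀ i j, ContinuousOn (fun l => g l i j) {0}ᶜ)
    (h : ∀ l, l ≠ 0 → β ^ 6 - l ^ 6 ≠ 0 → f l = g l) {lam : ℂ} (hl : lam ≠ 0) : f lam = g lam := by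
  ext i j
  exact eq_of_eq_off_roots β (hf i j) (hg i j) (fun l h0 h6 => by rw [h l h0 h6]) hl

theorem differentiableOn_matrix_mul {S : Set ℂ} {f g : ℂ → Matrix (Fin 3) (Fin 3) ℂ}
    (hf : ∀ i j, DifferentiableOn ℂ (fun l => f l i j) S)
    (hg : ∀ i j, DifferentiableOn ℂ (fun l => g l i j) S) (i j : Fin 3) :
    DifferentiableOn ℂ (fun l => (f l * g l) i j) S := by
  simp only [Matrix.mul_apply]
  exact DifferentiableOn.fun_sum fun k _ => (hf i k).mul (hg k j)

theorem differentiableOn_numG (β b c d : ℂ) (S : Set ℂ) (i j : Fin 3) :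
    DifferentiableOn ℂ (fun l => numG β b c d l i j) S := by
  refine Differentiable.differentiableOn ?_
  fin_cases i <;> fin_cases j <;> simp [numG] <;> fun_prop

theorem differentiableOn_adjG (β b c d : ℂ) (S : Set ℂ) (i j : Fin 3) :
    DifferentiableOn ℂ (fun l => adjG β b c d l i j) S := by
  refine Differentiable.differentiableOn ?_
  fin_cases i <;> fin_cases j <;> simp [adjG] <;> fun_prop

theorem differentiableOn_det {S : Set ℂ} {f : ℂ → Matrix (Fin 3) (Fin 3) ℂ}
    (hf : ∀ i j, DifferentiableOn ℂ (fun l => f l i j) S) :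
    DifferentiableOn ℂ (fun l => (f l).det) S := by
  simp only [Matrix.det_fin_three]
  have := fun i j => hf i j
  fun_prop (disch := assumption)

/-- The dressed loop `N g Ñ⁻¹`, where `N`, `Ñ` are the numerators of the simple elements with the
parameters `(b, c, d)` and `(bt, ct, dt)`. -/
def dress (β b c d bt ct dt : ℂ) (g : ℂ → Matrix (Fin 3) (Fin 3) ℂ) (lam : ℂ) :
    Matrix (Fin 3) (Fin 3) ℂ :=
  Matrix.of fun i j => fillQuot
    (fun l => (numG β b c d l * g l * adjG β bt ct dt l) i j) (fun l => β ^ 6 - l ^ 6) lam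

section Dress

variable {β b c d bt ct dt v : ℂ} {g : ℂ → Matrix (Fin 3) (Fin 3) ℂ}

theorem dress_of_ne {lam : ℂ} (hl : β ^ 6 - lam ^ 6 ≠ 0) :
    dress β b c d bt ct dt g lam =
      (β ^ 6 - lam ^ 6)⁻¹ • (numG β b c d lam * g lam * adjG β bt ct dt lam) := by
  ext i j
  rw [dress, Matrix.of_apply, fillQuot_of_ne (q := fun l => β ^ 6 - l ^ 6) hl, Matrix.smul_apply,
    smul_eq_mul, div_eq_inv_mul]

/-- At `λ³ = β³` the rows of the left factor lie on the old line, `g` carries it to the new one, and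
the right factor annihilates the new line. At `λ³ = -β³` the columns of the right factor lie on the
new column vector, `g` carries it to the old one, and the left factor annihilates that. -/
theorem numerator_eq_zero (hβ : β ≠ 0) (hg : IsSigmaLoop g) (hv : v ≠ 0)
    (h : ![b, c, 1] ᵥ* g β = v • ![bt, ct, 1]) {lam : ℂ} (hl : β ^ 6 - lam ^ 6 = 0) :
    numG β b c d lam * g lam * adjG β bt ct dt lam = 0 := by
  have hf : (lam ^ 3 - β ^ 3) * (lam ^ 3 + β ^ 3) = 0 := by linear_combination -hl
  rcases mul_eq_zero.1 hf with h3 | h3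
  · have hμ : (lam / β) ^ 3 = 1 := by
      rw [div_pow, sub_eq_zero.1 h3, div_self (pow_ne_zero 3 hβ)]
    have e : lam = lam / β * β := (div_mul_cancel₀ _ hβ).symm
    generalize lam / β = μ at hμ e
    subst e
    rw [numG_eq_vecMulVec hμ, Matrix.vecMulVec_mul, Matrix.vecMulVec_mul,
      hg.rowVec_vecMul hμ hβ h, Matrix.smul_vecMul, rowVec_vecMul_adjG hμ, smul_zero]
    ext i j
    simp [Matrix.vecMulVec_apply]
  · have hμ : (-(lam / β)) ^ 3 = 1 := by
      rw [neg_pow, div_pow, eq_neg_of_add_eq_zero_left h3, neg_div, div_self (pow_ne_zero 3 hβ)]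
      norm_num
    have e : lam = -(-(lam / β) * β) := by field_simp
    generalize -(lam / β) = μ at hμ e
    subst e
    have h0 := hg.mulVec_colVec hμ hβ h
    have h1 : numG β b c d (-(μ * β)) *ᵥ (g (-(μ * β)) *ᵥ colVec μ bt ct) = 0 := by
      have := congrArg (numG β b c d (-(μ * β)) *ᵥ ·) h0
      simp only [Matrix.mulVec_smul, numG_mulVec_colVec hμ] at this
      exact (smul_eq_zero.1 this).resolve_left hv
    rw [adjG_eq_vecMulVec hμ, Matrix.mul_vecMulVec, ← Matrix.mulVec_mulVec, h1]
    ext i j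
    simp [Matrix.vecMulVec_apply]

/-- The nonzero roots of `β⁶ - λ⁶` are simple, so vanishing of the numerator there suffices. -/
theorem differentiableOn_dress (hβ : β ≠ 0) (hg : IsSigmaLoop g) (hv : v ≠ 0)
    (h : ![b, c, 1] ᵥ* g β = v • ![bt, ct, 1]) (i j : Fin 3) :
    DifferentiableOn ℂ (fun l => dress β b c d bt ct dt g l i j) {0}ᶜ := by
  refine differentiableOn_fillQuot isOpen_compl_singleton
    (differentiableOn_matrix_mul (differentiableOn_matrix_mul (differentiableOn_numG _ _ _ _ _)
      hg.holo) (differentiableOn_adjG _ _ _ _ _) i j)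
    (fun l _ => (hasDerivAt_pow_six β l).differentiableAt.differentiableWithinAt)
    fun l hl hq => ⟨?_, ?_⟩
  · simp only [numerator_eq_zero hβ hg hv h hq, Matrix.zero_apply]
  · rw [(hasDerivAt_pow_six β l).deriv]
    exact neg_ne_zero.2 (mul_ne_zero (by norm_num) (pow_ne_zero 5 hl))

/-- The factorization `N g = g̃ Ñ`. -/
theorem numG_mul_eq_dress_mul (hβ : β ≠ 0) (hg : IsSigmaLoop g) (hv : v ≠ 0)
    (h : ![b, c, 1] ᵥ* g β = v • ![bt, ct, 1]) (hst : 2 * bt * ct - 1 ≠ 0) (hdt : dt ≠ 0)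
    {lam : ℂ} (hl : lam ≠ 0) :
    numG β b c d lam * g lam = dress β b c d bt ct dt g lam * numG β bt ct dt lam := by
  refine matrix_eq_of_eq_off_roots β
    (f := fun lam => numG β b c d lam * g lam)
    (g := fun lam => dress β b c d bt ct dt g lam * numG β bt ct dt lam)
    (fun i j => (differentiableOn_matrix_mul (differentiableOn_numG _ _ _ _ _)
      hg.holo i j).continuousOn)
    (fun i j => (differentiableOn_matrix_mul (differentiableOn_dress hβ hg hv h)
      (differentiableOn_numG _ _ _ _ _) i j).continuousOn) (fun l _ h6 => ?_) hl
  rw [dress_of_ne h6, Matrix.smul_mul, Matrix.mul_assoc _ (adjG _ _ _ _ _),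
    adjG_mul_numG hst hdt, Matrix.mul_smul, smul_smul, inv_mul_cancel₀ h6, one_smul,
    Matrix.mul_one]

/-- The determinant of `numG` and the scalar in its `σ`-relation do not depend on `b`, `c`, `d`. The
contributions of the old and the new numerator therefore cancel off the six roots; continuity covers
the roots. -/
theorem isSigmaLoop_dress (hβ : β ≠ 0) (hg : IsSigmaLoop g) (hv : v ≠ 0)
    (h : ![b, c, 1] ᵥ* g β = v • ![bt, ct, 1]) (hs : 2 * b * c - 1 ≠ 0) (hd : d ≠ 0)
    (hst : 2 * bt * ct - 1 ≠ 0) (hdt : dt ≠ 0) : IsSigmaLoop (dress β b c d bt ct dt g) := by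
  have hfac := fun {lam : ℂ} (hl : lam ≠ 0) => numG_mul_eq_dress_mul (d := d) hβ hg hv h hst hdt hl
  have hhol := differentiableOn_dress (d := d) (dt := dt) hβ hg hv h
  have hdet : ∀ lam, lam ≠ 0 → (dress β b c d bt ct dt g lam).det = 1 := fun lam hl => by
    refine eq_of_eq_off_roots β (g := fun _ => 1) (differentiableOn_det hhol).continuousOn
      continuousOn_const (fun l hl h6 => ?_) hl
    have h1 := congrArg Matrix.det (hfac hl)
    rw [Matrix.det_mul, Matrix.det_mul, hg.det l hl, mul_one, det_numG hs hd, ← det_numG hst hdt]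
      at h1
    exact (mul_right_cancel₀ (det_numG_ne_zero hst hdt h6) ((one_mul _).trans h1)).symm
  refine ⟨hhol, hdet, fun lam hl => sigma_eq_of_mul (by rw [hdet lam hl]; exact one_ne_zero) ?_⟩
  have hmaps : ∀ f : ℂ → ℂ, DifferentiableOn ℂ f {0}ᶜ →
      DifferentiableOn ℂ (fun l => f (eps * l)) {0}ᶜ := fun f hf =>
    hf.comp (differentiableOn_id.const_mul eps) fun l hl => mul_ne_zero eps_ne_zero hl
  have hL := fun i j => (differentiableOn_matrix_mul (differentiableOn_matrix_mul
    (g := fun _ => matP) (fun i j => hmaps _ (hhol i j)) fun i j => differentiableOn_const _)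
    (g := fun lam => (dress β b c d bt ct dt g lam)ᵀ) (fun i j => hhol j i) i j).continuousOn
  refine matrix_eq_of_eq_off_roots β
    (f := fun lam => dress β b c d bt ct dt g (eps * lam) * matP *
      (dress β b c d bt ct dt g lam)ᵀ) (g := fun _ => matP) hL
    (fun i j => continuousOn_const) (fun l hl h6 => ?_) hl
  have hl' := mul_ne_zero eps_ne_zero hl
  have key : dress β b c d bt ct dt g (eps * l) * (numG β bt ct dt (eps * l) * matP *
      (numG β bt ct dt l)ᵀ) * (dress β b c d bt ct dt g l)ᵀ =
      numG β b c d (eps * l) * (g (eps * l) * matP * (g l)ᵀ) * (numG β b c d l)ᵀ := by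
    calc _ = (dress β b c d bt ct dt g (eps * l) * numG β bt ct dt (eps * l)) * matP *
        (dress β b c d bt ct dt g l * numG β bt ct dt l)ᵀ := by
          rw [Matrix.transpose_mul]; simp only [Matrix.mul_assoc]
      _ = _ := by
          rw [← hfac hl, ← hfac hl', Matrix.transpose_mul]; simp only [Matrix.mul_assoc]
  rw [numG_mul_matP hst hdt, hg.mul_matP hl, numG_mul_matP hs hd, Matrix.mul_smul,
    Matrix.smul_mul] at key
  exact smul_right_injective _ h6 key

end Dress

/-! ### The frame equation of the dressed frame -/

section Frame

variable {V : Set ℂ} {H : ℝ} {p U : ℂ → ℂ} {E : ℂ → ℂ → Matrix (Fin 3) (Fin 3) ℂ} {β b c z : ℂ}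

theorem lineVec_apply (b c β : ℂ) (E : ℂ → ℂ → Matrix (Fin 3) (Fin 3) ℂ) (z : ℂ) (j : Fin 3) :
    lineVec b c β E z j = b * E z β 0 j + c * E z β 1 j + E z β 2 j := by
  simp [lineVec, Matrix.vecMul, dotProduct, Fin.sum_univ_three]

theorem hasW_lineVec (h : Solves V H p U β fun z => E z β) (hz : z ∈ V) (j : Fin 3) :
    HasW (fun w => lineVec b c β E w j) ((lineVec b c β E z ᵥ* connZ H p U β z) j)
      ((lineVec b c β E z ᵥ* connZbar H p U β z) j) z := by
  have e : ∀ M : Matrix (Fin 3) (Fin 3) ℂ, (lineVec b c β E z ᵥ* M) j =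
      b * (E z β * M) 0 j + c * (E z β * M) 1 j + (E z β * M) 2 j := fun M => by
    simp only [Matrix.vecMul, dotProduct, Fin.sum_univ_three, lineVec_apply, Matrix.mul_apply]
    ring
  rw [e, e]
  simp only [lineVec_apply]
  exact (((h z hz 0 j).const_mul b).add ((h z hz 1 j).const_mul c)).add (h z hz 2 j)

theorem vecMul_connZ (v : Fin 3 → ℂ) (H : ℝ) (p U : ℂ → ℂ) (lam z : ℂ) :
    (v ᵥ* connZ H p U lam z) 0 = v 0 * (wz p z / p z) + v 1 * (lam * (U z / p z ^ 2)) ∧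
    (v ᵥ* connZ H p U lam z) 1 = -(v 1 * (wz p z / p z)) + v 2 * (lam * (rootH H / 2 * p z)) ∧
    (v ᵥ* connZ H p U lam z) 2 = v 0 * (lam * (rootH H / 2 * p z)) := by
  simp only [Matrix.vecMul, dotProduct, Fin.sum_univ_three]
  refine ⟨?_, ?_, ?_⟩ <;> simp [connZ] <;> exact Or.inl (by ring)

theorem vecMul_connZbar (v : Fin 3 → ℂ) (H : ℝ) (p U : ℂ → ℂ) (lam z : ℂ) :
    (v ᵥ* connZbar H p U lam z) 0 =
      -(v 0 * (wzb p z / p z)) + v 2 * (lam⁻¹ * (rootH H / 2 * p z)) ∧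
    (v ᵥ* connZbar H p U lam z) 1 =
      v 0 * (lam⁻¹ * ((starRingEnd ℂ) (U z) / p z ^ 2)) + v 1 * (wzb p z / p z) ∧
    (v ᵥ* connZbar H p U lam z) 2 = v 1 * (lam⁻¹ * (rootH H / 2 * p z)) := by
  simp only [Matrix.vecMul, dotProduct, Fin.sum_univ_three]
  refine ⟨?_, ?_, ?_⟩ <;> simp [connZbar] <;> exact Or.inl (by ring)

/-- Quotients of components of a solution of a linear system satisfy Riccati equations; these feed
the gauge identities. -/
theorem hasW_bTilde (h : Solves V H p U β fun z => E z β) (hz : z ∈ V)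
    (hv : lineVec b c β E z 2 ≠ 0) :
    HasW (bTilde b c β E)
      (bTilde b c β E z * (wz p z / p z) + cTilde b c β E z * β * (U z / p z ^ 2) -
        bTilde b c β E z ^ 2 * β * (rootH H / 2 * p z))
      (-bTilde b c β E z * (wzb p z / p z) + β⁻¹ * (rootH H / 2 * p z) -
        bTilde b c β E z * cTilde b c β E z * β⁻¹ * (rootH H / 2 * p z)) z := by
  refine ((hasW_lineVec h hz 0).div (hasW_lineVec h hz 2) hv).of_eq ?_ ?_
  · obtain ⟨e0, -, e2⟩ := vecMul_connZ (lineVec b c β E z) H p U β z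
    rw [e0, e2, bTilde, cTilde]
    generalize wz p z / p z = q, U z / p z ^ 2 = u
    field_simp
  · obtain ⟨e0, -, e2⟩ := vecMul_connZbar (lineVec b c β E z) H p U β z
    rw [e0, e2, bTilde, cTilde]
    generalize wzb p z / p z = q, (starRingEnd ℂ) (U z) / p z ^ 2 = u, β⁻¹ = n
    field_simp

theorem hasW_cTilde (h : Solves V H p U β fun z => E z β) (hz : z ∈ V)
    (hv : lineVec b c β E z 2 ≠ 0) :
    HasW (cTilde b c β E)
      (-cTilde b c β E z * (wz p z / p z) + β * (rootH H / 2 * p z) -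
        bTilde b c β E z * cTilde b c β E z * β * (rootH H / 2 * p z))
      (bTilde b c β E z * β⁻¹ * ((starRingEnd ℂ) (U z) / p z ^ 2) +
        cTilde b c β E z * (wzb p z / p z) -
        cTilde b c β E z ^ 2 * β⁻¹ * (rootH H / 2 * p z)) z := by
  refine ((hasW_lineVec h hz 1).div (hasW_lineVec h hz 2) hv).of_eq ?_ ?_
  · obtain ⟨-, e1, e2⟩ := vecMul_connZ (lineVec b c β E z) H p U β z
    rw [e1, e2, bTilde, cTilde]
    generalize wz p z / p z = q, U z / p z ^ 2 = u
    field_simp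
  · obtain ⟨-, e1, e2⟩ := vecMul_connZbar (lineVec b c β E z) H p U β z
    rw [e1, e2, bTilde, cTilde]
    generalize wzb p z / p z = q, (starRingEnd ℂ) (U z) / p z ^ 2 = u, β⁻¹ = n
    field_simp

theorem lineVec_eq_smul (hv : lineVec b c β E z 2 ≠ 0) :
    ![b, c, 1] ᵥ* E z β = lineVec b c β E z 2 • ![bTilde b c β E z, cTilde b c β E z, 1] := by
  funext i
  fin_cases i
  · exact (mul_div_cancel₀ _ hv).symm
  · exact (mul_div_cancel₀ _ hv).symm
  · exact (mul_one _).symm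

theorem lineVec_two_ne (h : lineVec b c β E z ∉ coneDelta) : lineVec b c β E z 2 ≠ 0 :=
  fun h0 => h (Or.inr h0)

theorem tilde_ne (h : lineVec b c β E z ∉ coneDelta) :
    2 * bTilde b c β E z * cTilde b c β E z - 1 ≠ 0 := fun h0 => by
  have hv := lineVec_two_ne h
  refine h (Or.inl ?_)
  rw [bTilde, cTilde] at h0
  field_simp at h0
  linear_combination h0

/-- The gauge transformation of the connection form under dressing. -/
theorem gauge_conn {dt : ℂ → ℂ} {lam : ℂ} (h : Solves V H p U β fun z => E z β) (hβ : β ≠ 0)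
    (hl : lam ≠ 0) (hV : IsOpen V) (hp : ContDiffOn ℝ ∞ p V) (hp0 : ∀ z ∈ V, p z ≠ 0)
    (hcone : ∀ z ∈ V, lineVec b c β E z ∉ coneDelta) (hdt : ContDiffOn ℝ ∞ dt V)
    (hdt2 : ∀ z ∈ V, dt z ^ 2 = 2 * bTilde b c β E z * cTilde b c β E z - 1) (hz : z ∈ V) :
    ∃ A' B', HasMW (fun w => adjG β (bTilde b c β E w) (cTilde b c β E w) (dt w) lam) A' B' z ∧
      connZ H p U lam z * adjG β (bTilde b c β E z) (cTilde b c β E z) (dt z) lam + A' =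
        adjG β (bTilde b c β E z) (cTilde b c β E z) (dt z) lam *
          connZ H (fun z => dt z * p z) U lam z ∧
      connZbar H p U lam z * adjG β (bTilde b c β E z) (cTilde b c β E z) (dt z) lam + B' =
        adjG β (bTilde b c β E z) (cTilde b c β E z) (dt z) lam *
          connZbar H (fun z => dt z * p z) U lam z := by
  have hv := lineVec_two_ne (hcone z hz)
  have hne : ∀ w ∈ V, dt w ≠ 0 := fun w hw h0 => tilde_ne (hcone w hw) (by
    rw [← hdt2 w hw, h0]; norm_num)
  have hd0 := hne z hz
  have hpz := hp0 z hz
  have hs := tilde_ne (hcone z hz)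
  have hb := hasW_bTilde h hz hv
  have hc := hasW_cTilde h hz hv
  have hd := hasW_of_contDiffOn hV hdt hz
  have hpw := hasW_of_contDiffOn hV hp hz
  have hdp := hd.mul hpw
  -- Differentiating `d̃²` as a square and as `2 b̃ c̃ - 1` yields `d̃' d̃ = b̃' c̃ + b̃ c̃'`, the
  -- relation the gauge identities require.
  have hs2 : HasW (fun w => dt w ^ 2) _ _ z := ((((hb.const_mul 2).mul hc).sub
    (hasW_const 1 z)).congr (by
      filter_upwards [hV.mem_nhds hz] with w hw
      rw [hdt2 w hw]))
  obtain ⟨t1, t2⟩ := hs2.unique (((hd.mul hd).congr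
    (Filter.Eventually.of_forall fun w => sq (dt w))))
  have hA := hasMW_adjE β lam hb hc (hd.inv hd0)
  refine ⟨_, _, hA.congr (by
    filter_upwards [hV.mem_nhds hz] with w hw
    rw [adjG_eq_adjE (hdt2 w hw) (hne w hw)]), ?_, ?_⟩
  · have e1 : connZ H p U lam z = !![wz p z / p z, 0, lam * (rootH H / 2 * p z);
        lam * (U z / p z ^ 2), -(wz p z / p z), 0; 0, lam * (rootH H / 2 * p z), 0] := by
      simp only [connZ, mul_div_assoc, mul_assoc]
    have e2 : connZ H (fun z => dt z * p z) U lam z =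
        !![wz p z / p z + wz dt z / dt z, 0, lam * (rootH H / 2 * p z) * dt z;
          lam * (U z / p z ^ 2) * (dt z)⁻¹ ^ 2, -(wz p z / p z + wz dt z / dt z), 0;
          0, lam * (rootH H / 2 * p z) * dt z, 0] := by
      have a1 : wz (fun z => dt z * p z) z / (dt z * p z) = wz p z / p z + wz dt z / dt z := by
        rw [hdp.wz_eq]; field_simp; ring
      have a2 : lam * (rootH H / 2) * (dt z * p z) = lam * (rootH H / 2 * p z) * dt z := by ring
      have a3 : lam * U z / (dt z * p z) ^ 2 = lam * (U z / p z ^ 2) * (dt z)⁻¹ ^ 2 := by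
        field_simp
      rw [connZ, a1, a2, a3]
    have e3 : -wz dt z / dt z ^ 2 = -((dt z)⁻¹ * (wz dt z / dt z)) := by field_simp
    rw [adjG_eq_adjE (hdt2 z hz) hd0, e1, e2, e3]
    refine gauge_adjE hs ?_ ?_ ?_ rfl rfl
    · rw [← hdt2 z hz]; field_simp
    · rw [← hdt2 z hz]
      have : wz dt z / dt z * dt z ^ 2 = wz dt z * dt z := by field_simp
      rw [this]
      linear_combination (-1 / 2) * t1
    · rw [← hdt2 z hz]; field_simp
  · have e1 : connZbar H p U lam z = !![-(wzb p z / p z),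
          β * ((starRingEnd ℂ) (U z) / p z ^ 2 / (β * lam)), 0;
        0, wzb p z / p z, β * (rootH H / 2 * p z / (β * lam));
        β * (rootH H / 2 * p z / (β * lam)), 0, 0] := by
      have a2 : lam⁻¹ * (rootH H / 2) * p z = β * (rootH H / 2 * p z / (β * lam)) := by
        field_simp
      have a3 : lam⁻¹ * (starRingEnd ℂ) (U z) / p z ^ 2 =
          β * ((starRingEnd ℂ) (U z) / p z ^ 2 / (β * lam)) := by field_simp
      rw [connZbar, a2, a3]
    have e2 : connZbar H (fun z => dt z * p z) U lam z = !![-(wzb p z / p z + wzb dt z / dt z),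
          β * ((starRingEnd ℂ) (U z) / p z ^ 2 / (β * lam)) * (dt z)⁻¹ ^ 2, 0;
        0, wzb p z / p z + wzb dt z / dt z, β * (rootH H / 2 * p z / (β * lam)) * dt z;
        β * (rootH H / 2 * p z / (β * lam)) * dt z, 0, 0] := by
      have a1 : wzb (fun z => dt z * p z) z / (dt z * p z) =
          wzb p z / p z + wzb dt z / dt z := by
        rw [hdp.wzb_eq]; field_simp; ring
      have a2 : lam⁻¹ * (rootH H / 2) * (dt z * p z) =
          β * (rootH H / 2 * p z / (β * lam)) * dt z := by field_simp
      have a3 : lam⁻¹ * (starRingEnd ℂ) (U z) / (dt z * p z) ^ 2 =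
          β * ((starRingEnd ℂ) (U z) / p z ^ 2 / (β * lam)) * (dt z)⁻¹ ^ 2 := by field_simp
      rw [connZbar, a1, a2, a3]
    have e3 : -wzb dt z / dt z ^ 2 = -((dt z)⁻¹ * (wzb dt z / dt z)) := by field_simp
    have e4 : ∀ y : ℂ, β⁻¹ * y = lam * (y / (β * lam)) := fun y => by field_simp
    rw [adjG_eq_adjE (hdt2 z hz) hd0, e1, e2, e3]
    refine gauge_bar_adjE hs ?_ ?_ ?_ ?_ ?_
    · rw [← hdt2 z hz]; field_simp
    · rw [← hdt2 z hz]
      have : wzb dt z / dt z * dt z ^ 2 = wzb dt z * dt z := by field_simp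
      rw [this]
      linear_combination (-1 / 2) * t2
    · rw [← hdt2 z hz]; field_simp
    · simp only [mul_assoc, e4]
    · simp only [mul_assoc, e4]

/-- The dressed frame. -/
def dressFrame (β b c d : ℂ) (dt : ℂ → ℂ) (E : ℂ → ℂ → Matrix (Fin 3) (Fin 3) ℂ) (z : ℂ) :
    ℂ → Matrix (Fin 3) (Fin 3) ℂ :=
  dress β b c d (bTilde b c β E z) (cTilde b c β E z) (dt z) (E z)

theorem dressFrame_of_ne {d lam : ℂ} {dt : ℂ → ℂ} (hl : β ^ 6 - lam ^ 6 ≠ 0) :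
    dressFrame β b c d dt E z lam = (β ^ 6 - lam ^ 6)⁻¹ • (numG β b c d lam * E z lam *
      adjG β (bTilde b c β E z) (cTilde b c β E z) (dt z) lam) :=
  dress_of_ne hl

/-- Where `λ⁶ ≠ β⁶`, the dressed frame is a constant matrix times `E` times the adjoint, and
`gauge_conn` computes its derivative. At the six roots that formula is unavailable and
`solves_of_eventually` takes over. -/
theorem isFrame_dressFrame {d : ℂ} {dt : ℂ → ℂ} (hE : IsFrame V H p U E)
    (hloop : ∀ z ∈ V, IsSigmaLoop (E z)) (hβ : β ≠ 0)
    (hV : IsOpen V) (hp : ContDiffOn ℝ ∞ p V) (hp0 : ∀ z ∈ V, p z ≠ 0) (hU : ContDiffOn ℝ ∞ U V)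
    (hcone : ∀ z ∈ V, lineVec b c β E z ∉ coneDelta) (hdt : ContDiffOn ℝ ∞ dt V)
    (hdt2 : ∀ z ∈ V, dt z ^ 2 = 2 * bTilde b c β E z * cTilde b c β E z - 1) :
    IsFrame V H (fun z => dt z * p z) U (dressFrame β b c d dt E) := by
  have hne : ∀ w ∈ V, dt w ≠ 0 := fun w hw h0 => tilde_ne (hcone w hw) (by
    rw [← hdt2 w hw, h0]; norm_num)
  have hp' := hdt.mul hp
  have hp0' : ∀ z ∈ V, dt z * p z ≠ 0 := fun z hz => mul_ne_zero (hne z hz) (hp0 z hz)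
  have hgood : ∀ lam, lam ≠ 0 → β ^ 6 - lam ^ 6 ≠ 0 →
      Solves V H (fun z => dt z * p z) U lam fun z => dressFrame β b c d dt E z lam :=
    fun lam hl h6 z hz => by
    obtain ⟨A', B', hA, h1, h2⟩ := gauge_conn (hE.solves hV hβ) hβ hl hV hp hp0 hcone hdt hdt2 hz
    have key := (((hE.solves hV hl z hz).mul hA).const_mul
      ((β ^ 6 - lam ^ 6)⁻¹ • numG β b c d lam)).congr
      (Y := fun z => dressFrame β b c d dt E z lam) (Filter.Eventually.of_forall fun w => by
        beta_reduce
        rw [dressFrame_of_ne h6, Matrix.mul_assoc, Matrix.smul_mul])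
    refine key.of_eq ?_ ?_
    · beta_reduce
      rw [Matrix.mul_assoc (E z lam), ← Matrix.mul_add, h1, dressFrame_of_ne h6]
      simp only [Matrix.smul_mul, Matrix.mul_assoc]
    · beta_reduce
      rw [Matrix.mul_assoc (E z lam), ← Matrix.mul_add, h2, dressFrame_of_ne h6]
      simp only [Matrix.smul_mul, Matrix.mul_assoc]
  refine isFrame_of_solves hV hp' hp0' hU fun lam hl => ?_
  refine solves_of_eventually hV hp' hp0' hU (fun z hz => differentiableOn_dress hβ (hloop z hz)
    (lineVec_two_ne (hcone z hz)) (lineVec_eq_smul (lineVec_two_ne (hcone z hz)))) hl ?_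
  filter_upwards [eventually_pow_six_ne β hl] with l h using hgood l h.1 h.2

end Frame

/-! ### Simple elements as germs of loops -/

theorem simpleG_eq {β b c d lam : ℂ} (hs : 2 * b * c - 1 ≠ 0) (hl : lam ^ 3 ≠ β ^ 3) :
    simpleG β b c d lam = (lam ^ 3 - β ^ 3)⁻¹ • numG β b c d lam := by
  rw [← smul_simpleG hs hl, smul_smul, inv_mul_cancel₀ (sub_ne_zero.2 hl), one_smul]

theorem simpleM_eq {α b c d lam : ℂ} (hs : 2 * b * c - 1 ≠ 0) (hl : lam ^ 3 ≠ α ^ 3) :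
    simpleM α b c d lam = (lam ^ 3 - α ^ 3)⁻¹ • numG (-α) b c d lam := by
  rw [← smul_simpleM hs hl, smul_smul, inv_mul_cancel₀ (sub_ne_zero.2 hl), one_smul]

/-- As `|α| = 1`, the poles and degeneracies of simple elements lie on the unit circle, so every
radius below `1` gives admissible discs around `0` and `∞`. -/
theorem pow_three_ne_of_norm {γ lam : ℂ} (hγ : ‖γ‖ = 1) (hl : ‖lam‖ ≠ 1) : lam ^ 3 ≠ γ := by
  intro h
  refine hl ((pow_eq_one_iff_of_nonneg (norm_nonneg lam) three_ne_zero).1 ?_)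
  rw [← norm_pow, h, hγ]

/-- The numerator in the coordinate at infinity: `μ³ N(1/μ)`. -/
def numGInf (β b c d mu : ℂ) : Matrix (Fin 3) (Fin 3) ℂ :=
  !![d / (2 * b * c - 1) * (2 * b * c - 1 + β ^ 3 * mu ^ 3),
      d / (2 * b * c - 1) * (2 * β * mu * c ^ 2), d / (2 * b * c - 1) * (2 * β ^ 2 * mu ^ 2 * c);
    d⁻¹ * (2 * β ^ 2 * mu ^ 2 * b ^ 2), d⁻¹ * (1 + mu ^ 3 * β ^ 3 * (2 * b * c - 1)),
      d⁻¹ * (2 * β * mu * b);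
    2 * β * mu * b, 2 * β ^ 2 * mu ^ 2 * c, 1 + mu ^ 3 * β ^ 3]

theorem numGInf_eq {β b c d mu : ℂ} (hmu : mu ≠ 0) :
    numGInf β b c d mu = mu ^ 3 • numG β b c d mu⁻¹ := by
  ext i j
  fin_cases i <;> fin_cases j <;> simp [numGInf, numG] <;> field_simp

theorem det_numGInf {β b c d mu : ℂ} (hs : 2 * b * c - 1 ≠ 0) (hd : d ≠ 0) :
    (numGInf β b c d mu).det = (1 - mu ^ 3 * β ^ 3) ^ 2 * (1 + mu ^ 3 * β ^ 3) := by
  rw [numGInf, Matrix.det_fin_three]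
  simp
  field_simp
  ring

theorem det_smul_three (k : ℂ) (M : Matrix (Fin 3) (Fin 3) ℂ) : (k • M).det = k ^ 3 * M.det := by
  rw [Matrix.det_smul, Fintype.card_fin]

/-- Covers both kinds of simple element, with `γ = α³` and `β = ±α`. The relation `γ² = β⁶` matches
the scalar of `numG_mul_matP` with the denominators `((ελ)³ - γ)(λ³ - γ) = γ² - λ⁶`. The radius
`1/2` is arbitrary. -/
theorem isSigmaLoopI_of_eq {β γ b c d : ℂ} (hβ : ‖β‖ = 1) (hγ : γ ^ 2 = β ^ 6)
    (hs : 2 * b * c - 1 ≠ 0) (hd : d ≠ 0) {g : ℂ → Matrix (Fin 3) (Fin 3) ℂ}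
    (hg : ∀ lam, ‖lam‖ ≠ 1 → g lam = (lam ^ 3 - γ)⁻¹ • numG β b c d lam) :
    IsSigmaLoopI (1 / 2) g := by
  have hγ1 : ‖γ‖ = 1 := by
    refine (pow_eq_one_iff_of_nonneg (norm_nonneg γ) two_ne_zero).1 ?_
    rw [← norm_pow, hγ, norm_pow, hβ, one_pow]
  have hβ3 : ‖β ^ 3‖ = 1 := by rw [norm_pow, hβ, one_pow]
  have hnβ3 : ‖-β ^ 3‖ = 1 := by rw [norm_neg, hβ3]
  have hball : ∀ lam ∈ Metric.ball (0 : ℂ) (1 / 2), ‖lam‖ ≠ 1 := fun lam h => by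
    rw [mem_ball_zero_iff] at h
    linarith
  have hinf : ∀ mu : ℂ, ‖mu‖ ≠ 1 → ∀ δ : ℂ, ‖δ‖ = 1 → 1 - mu ^ 3 * δ ≠ 0 := fun mu hmu δ hδ h0 => by
    have : mu ^ 3 = δ⁻¹ := by
      refine eq_inv_of_mul_eq_one_left ?_
      linear_combination -h0
    exact pow_three_ne_of_norm (by rw [norm_inv, hδ, inv_one]) hmu this
  refine ⟨fun i j => ?_, fun lam hl => ?_, ⟨fun mu => (1 - mu ^ 3 * γ)⁻¹ • numGInf β b c d mu,
    fun i j => ?_, fun mu hmu => ?_, fun mu hmu hmu0 => ?_⟩, fun lam hl => ?_⟩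
  · refine DifferentiableOn.congr (f := fun lam => (lam ^ 3 - γ)⁻¹ * numG β b c d lam i j) ?_
      fun lam hl => by rw [hg lam (hball lam hl), Matrix.smul_apply, smul_eq_mul]
    refine DifferentiableOn.mul (DifferentiableOn.inv ?_ fun lam hl => ?_)
      (differentiableOn_numG _ _ _ _ _ i j)
    · fun_prop
    · exact sub_ne_zero.2 (pow_three_ne_of_norm hγ1 (hball lam hl))
  · have h1 := hball lam hl
    rw [hg lam h1, det_smul_three, det_numG hs hd]
    refine mul_ne_zero (pow_ne_zero 3 (inv_ne_zero (sub_ne_zero.2 (pow_three_ne_of_norm hγ1 h1))))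
      (mul_ne_zero (pow_ne_zero 2 (sub_ne_zero.2 (pow_three_ne_of_norm hβ3 h1))) ?_)
    have := sub_ne_zero.2 (pow_three_ne_of_norm hnβ3 h1)
    rwa [sub_neg_eq_add] at this
  · simp only [Matrix.smul_apply, smul_eq_mul]
    refine DifferentiableOn.mul (DifferentiableOn.inv ?_ fun mu hmu =>
      hinf mu (hball mu hmu) γ hγ1) ?_
    · fun_prop
    · refine Differentiable.differentiableOn ?_
      fin_cases i <;> fin_cases j <;> simp [numGInf] <;> fun_prop
  · rw [det_smul_three, det_numGInf hs hd]
    have h2 := hinf mu (hball mu hmu) _ hnβ3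
    rw [mul_neg, sub_neg_eq_add] at h2
    exact mul_ne_zero (pow_ne_zero 3 (inv_ne_zero (hinf mu (hball mu hmu) γ hγ1)))
      (mul_ne_zero (pow_ne_zero 2 (hinf mu (hball mu hmu) _ hβ3)) h2)
  · have h1 := hball mu hmu
    beta_reduce
    rw [hg mu⁻¹ (by rwa [norm_inv, ne_eq, inv_eq_one]), numGInf_eq hmu0, smul_smul]
    congr 1
    have := hinf mu h1 γ hγ1
    have h3 : mu⁻¹ ^ 3 - γ ≠ 0 := fun h0 => this (by
      have : mu ^ 3 * (mu⁻¹ ^ 3 - γ) = 1 - mu ^ 3 * γ := by field_simp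
      rw [← this, h0, mul_zero])
    field_simp
  · have h1 : ‖lam‖ ≠ 1 := by
      rcases hl with h | h <;> norm_num at h <;> intro h' <;> linarith
    have he : ‖eps‖ = 1 := by
      refine (pow_eq_one_iff_of_nonneg (norm_nonneg eps) three_ne_zero).1 ?_
      rw [← norm_pow, eps_pow_three, norm_neg, norm_one]
    have h2 : ‖eps * lam‖ ≠ 1 := by rwa [norm_mul, he, one_mul]
    have e1 := sub_ne_zero.2 (pow_three_ne_of_norm hγ1 h1)
    have e2 := sub_ne_zero.2 (pow_three_ne_of_norm hγ1 h2)
    have e3 := sub_ne_zero.2 (pow_three_ne_of_norm hnβ3 h1)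
    refine sigma_eq_of_mul ?_ ?_
    · rw [hg lam h1, det_smul_three, det_numG hs hd]
      refine mul_ne_zero (pow_ne_zero 3 (inv_ne_zero e1)) (mul_ne_zero
        (pow_ne_zero 2 (sub_ne_zero.2 (pow_three_ne_of_norm hβ3 h1))) ?_)
      rwa [sub_neg_eq_add] at e3
    · rw [hg lam h1, hg _ h2, Matrix.transpose_smul, Matrix.smul_mul, Matrix.smul_mul,
        Matrix.mul_smul, numG_mul_matP hs hd, smul_smul, smul_smul]
      have : ((eps * lam) ^ 3 - γ)⁻¹ * (lam ^ 3 - γ)⁻¹ * (β ^ 6 - lam ^ 6) = 1 := by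
        rw [← mul_inv, inv_mul_eq_one₀ (mul_ne_zero e2 e1)]
        linear_combination hγ + lam ^ 3 * (lam ^ 3 - γ) * eps_pow_three
      rw [this, one_smul]

theorem isSigmaGerm_simpleG {α b c d : ℂ} (hα : ‖α‖ = 1) (hs : 2 * b * c - 1 ≠ 0) (hd : d ≠ 0) :
    IsSigmaGerm (simpleG α b c d) :=
  ⟨1 / 2, by norm_num, by norm_num, isSigmaLoopI_of_eq hα (γ := α ^ 3) (by ring) hs hd
    fun lam hl => simpleG_eq hs (pow_three_ne_of_norm (by rw [norm_pow, hα, one_pow]) hl)⟩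

theorem isSigmaLoopI_simpleM {α b c d : ℂ} (hα : ‖α‖ = 1) (hs : 2 * b * c - 1 ≠ 0) (hd : d ≠ 0) :
    IsSigmaLoopI (1 / 2) (simpleM α b c d) :=
  isSigmaLoopI_of_eq (β := -α) (γ := α ^ 3) (by rwa [norm_neg]) (by ring) hs hd
    fun lam hl => simpleM_eq hs (pow_three_ne_of_norm (by rw [norm_pow, hα, one_pow]) hl)

/-! ### The reality condition of the simple elements -/

theorem tau_mul (H : ℝ) (X Y : Matrix (Fin 3) (Fin 3) ℂ) : tau H (X * Y) = tau H X * tau H Y := by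
  have hT : ∀ Z : Matrix (Fin 3) (Fin 3) ℂ, matT H * (matT H * Z) = Z := fun Z => by
    rw [← Matrix.mul_assoc, matT_mul_self, Matrix.one_mul]
  simp only [tau, inv_matT, map_conj_mul, Matrix.mul_assoc, hT]

theorem tau_smul (H : ℝ) (k : ℂ) (X : Matrix (Fin 3) (Fin 3) ℂ) :
    tau H (k • X) = (starRingEnd ℂ) k • tau H X := by
  have e : (k • X).map (starRingEnd ℂ) = (starRingEnd ℂ) k • X.map (starRingEnd ℂ) := by
    ext i j
    simp
  rw [tau, tau, e, Matrix.mul_smul, Matrix.smul_mul]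

theorem kap_of_neg {H : ℝ} (hH : H < 0) : kap H = 1 := if_pos hH

theorem kap_of_pos {H : ℝ} (hH : 0 < H) : kap H = -1 := if_neg hH.le.not_gt

/-- The condition on `|d|²` makes the factors of the first two rows conjugate to each other, and `λ
↦ 1/λ̄` reverses the powers of `λ` up to `λ³ β³`. -/
theorem tau_numG {H : ℝ} (hH : H < 0) {β b d lam : ℂ} (hβ : ‖β‖ = 1)
    (hs : 2 * b * (starRingEnd ℂ) b - 1 ≠ 0)
    (hd : d * (starRingEnd ℂ) d = 2 * b * (starRingEnd ℂ) b - 1) (hl : lam ≠ 0) :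
    tau H (numG β b ((starRingEnd ℂ) b) d ((starRingEnd ℂ) lam)⁻¹) =
      (lam ^ 3 * β ^ 3)⁻¹ • numG β b ((starRingEnd ℂ) b) d lam := by
  have hβ0 := ne_zero_of_norm_one hβ
  have hd0 : d ≠ 0 := fun h => by rw [h, zero_mul] at hd; exact hs hd.symm
  have hdc : (starRingEnd ℂ) d ≠ 0 := (map_ne_zero _).2 hd0
  have e : d / (2 * b * (starRingEnd ℂ) b - 1) = ((starRingEnd ℂ) d)⁻¹ := by
    rw [← hd]; field_simp
  rw [tau_eq, kap_of_neg hH, numG, e, numG, e]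
  ext i j
  fin_cases i <;> fin_cases j <;>
    simp [conj_eq_inv_of_norm_one hβ, conj_two] <;> field_simp <;> ring

/-- The scalar of `tau_numG` at `β = -α` cancels against the conjugated denominator. At `β = α` the
sign would be opposite, which is the obstruction found in `not_isTwistedGerm_simpleG`. -/
theorem tau_simpleM {H : ℝ} (hH : H < 0) {α b d lam : ℂ} (hα : ‖α‖ = 1)
    (hs : 2 * b * (starRingEnd ℂ) b - 1 ≠ 0)
    (hd : d * (starRingEnd ℂ) d = 2 * b * (starRingEnd ℂ) b - 1) (hl : lam ≠ 0)
    (hl3 : lam ^ 3 ≠ α ^ 3) :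
    tau H (simpleM α b ((starRingEnd ℂ) b) d ((starRingEnd ℂ) lam)⁻¹) =
      simpleM α b ((starRingEnd ℂ) b) d lam := by
  have hα0 := ne_zero_of_norm_one hα
  have h1 := sub_ne_zero.2 hl3
  have h2 : lam⁻¹ ^ 3 - α⁻¹ ^ 3 ≠ 0 := fun h => h1 (by
    rw [inv_pow, inv_pow, sub_eq_zero, inv_inj] at h
    rw [h, sub_self])
  have hc : (((starRingEnd ℂ) lam)⁻¹) ^ 3 ≠ α ^ 3 := fun h => h2 (by
    have := congrArg (starRingEnd ℂ) h
    rw [map_pow, map_inv₀, Complex.conj_conj, map_pow, conj_eq_inv_of_norm_one hα] at this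
    rw [this, sub_self])
  rw [simpleM_eq hs hc, simpleM_eq hs hl3, tau_smul,
    tau_numG hH (by rwa [norm_neg]) hs hd hl, smul_smul]
  congr 1
  simp only [map_inv₀, map_sub, map_pow, Complex.conj_conj, conj_eq_inv_of_norm_one hα]
  field_simp
  ring

theorem isTwistedGerm_simpleM {H : ℝ} (hH : H < 0) {α b d : ℂ} (hα : ‖α‖ = 1)
    (hs : 2 * b * (starRingEnd ℂ) b - 1 ≠ 0)
    (hd : d * (starRingEnd ℂ) d = 2 * b * (starRingEnd ℂ) b - 1) :
    IsTwistedGerm H (simpleM α b ((starRingEnd ℂ) b) d) := by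
  have hd0 : d ≠ 0 := fun h => by rw [h, zero_mul] at hd; exact hs hd.symm
  refine ⟨1 / 2, by norm_num, by norm_num, isSigmaLoopI_simpleM hα hs hd0, fun lam hl h =>
    tau_simpleM hH hα hs hd hl (pow_three_ne_of_norm (by rw [norm_pow, hα, one_pow]) ?_)⟩
  rcases h with h | h <;> norm_num at h <;> intro h' <;> linarith

/-- The reality condition determines the parameters of a simple element of rank 2 type. -/
theorem IsTwistedGerm.simpleM_params {H : ℝ} (hH : H < 0) {α b c d : ℂ} (hα : ‖α‖ = 1)
    (hs : 2 * b * c - 1 ≠ 0) (h : IsTwistedGerm H (simpleM α b c d)) :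
    c = (starRingEnd ℂ) b ∧ d * (starRingEnd ℂ) d = 2 * b * c - 1 := by
  obtain ⟨ρ, hρ, hρ1, hI, hτ⟩ := h
  have hα0 := ne_zero_of_norm_one hα
  have hα3 : ‖α ^ 3‖ = 1 := by rw [norm_pow, hα, one_pow]
  -- For `d = 0` the first row of the numerator vanishes, contradicting invertibility at `λ = 0`.
  have hd0 : d ≠ 0 := fun h0 => by
    have hl : ((0 : ℂ)) ^ 3 ≠ α ^ 3 := pow_three_ne_of_norm hα3 (by simp)
    refine hI.det_zero 0 (Metric.mem_ball_self hρ) ?_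
    rw [simpleM_eq hs hl, det_smul_three, numG, Matrix.det_fin_three, h0]
    simp
  have key : ∀ lam : ℂ, lam ≠ 0 → ‖lam‖ < ρ →
      (-(lam ^ 3 * α ^ 3)) • tau H (numG (-α) b c d ((starRingEnd ℂ) lam)⁻¹) =
        numG (-α) b c d lam := fun lam hl hlρ => by
    have e1 : lam ^ 3 ≠ α ^ 3 := pow_three_ne_of_norm hα3 (by linarith)
    have hn : ‖((starRingEnd ℂ) lam)⁻¹‖ ≠ 1 := by
      rw [norm_inv, RCLike.norm_conj, ne_eq, inv_eq_one]
      linarith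
    have e2 := pow_three_ne_of_norm hα3 hn
    have e3 : lam⁻¹ ^ 3 - α⁻¹ ^ 3 ≠ 0 := fun h0 => e1 (by
      rwa [inv_pow, inv_pow, sub_eq_zero, inv_inj] at h0)
    have h1 := hτ lam hl (Or.inl hlρ)
    rw [simpleM_eq hs e2, simpleM_eq hs e1, tau_smul] at h1
    simp only [map_inv₀, map_sub, map_pow, Complex.conj_conj, conj_eq_inv_of_norm_one hα] at h1
    have h2 := congrArg ((lam ^ 3 - α ^ 3) • ·) h1
    simp only [smul_smul, mul_inv_cancel₀ (sub_ne_zero.2 e1), one_smul] at h2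
    rw [← h2]
    congr 1
    have e4 := sub_ne_zero.2 e1
    rw [eq_mul_inv_iff_mul_eq₀ e3]
    field_simp
    ring
  -- The lower left entry does not involve `d` and compares `c̄` with `b`.
  have hc : c = (starRingEnd ℂ) b := by
    have hl : ((ρ / 2 : ℝ) : ℂ) ≠ 0 := Complex.ofReal_ne_zero.2 (by positivity)
    have h1 := congrFun (congrFun (key ((ρ / 2 : ℝ) : ℂ) hl (by
      rw [Complex.norm_real, Real.norm_of_nonneg (by positivity)]; linarith)) 2) 0
    rw [tau_eq, kap_of_neg hH] at h1
    generalize ((ρ / 2 : ℝ) : ℂ) = lam at hl h1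
    simp [numG, conj_eq_inv_of_norm_one hα, conj_two] at h1
    have h2 : (starRingEnd ℂ) c = b := by
      field_simp at h1
      exact h1
    rw [← h2, Complex.conj_conj]
  refine ⟨hc, ?_⟩
  have hdc : (starRingEnd ℂ) d ≠ 0 := (map_ne_zero _).2 hd0
  -- The second factor could vanish at a given `λ`; adding the equations at `λ` and `-λ` replaces it
  -- by the nonzero constant `-2α³`.
  have h00 : ∀ lam : ℂ, lam ≠ 0 → ‖lam‖ < ρ →
      (d * (starRingEnd ℂ) d - (2 * b * c - 1)) * (lam ^ 3 * (2 * b * c - 1) - α ^ 3) = 0 :=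
    fun lam hl hlρ => by
    have h1 := congrFun (congrFun (key lam hl hlρ) 0) 0
    rw [tau_eq] at h1
    simp [numG, conj_eq_inv_of_norm_one hα, conj_two] at h1
    rw [hc] at h1 hs ⊢
    simp only [Complex.conj_conj] at h1
    have hs' : 2 * (starRingEnd ℂ) b * b - 1 ≠ 0 := by rwa [mul_right_comm]
    field_simp at h1
    linear_combination -h1
  have hl : ((ρ / 2 : ℝ) : ℂ) ≠ 0 := Complex.ofReal_ne_zero.2 (by positivity)
  have hn : ‖((ρ / 2 : ℝ) : ℂ)‖ < ρ := by
    rw [Complex.norm_real, Real.norm_of_nonneg (by positivity)]; linarith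
  have h1 := h00 _ hl hn
  have h2 := h00 _ (neg_ne_zero.2 hl) (by rwa [norm_neg])
  have h3 : (d * (starRingEnd ℂ) d - (2 * b * c - 1)) * (-2 * α ^ 3) = 0 := by
    linear_combination h1 + h2
  exact sub_eq_zero.1 ((mul_eq_zero.1 h3).resolve_right
    (mul_ne_zero (by norm_num) (pow_ne_zero 3 hα0)))

/-- For `H > 0` no simple element of rank 1 type with `|α| = 1` satisfies the reality condition:
the lower right entry of `τ(g(1/λ̄))` is the negative of that of `g(λ)`. -/
theorem not_isTwistedGerm_simpleG {H : ℝ} {α b c d : ℂ} (hα : ‖α‖ = 1)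
    (hs : 2 * b * c - 1 ≠ 0) : ¬IsTwistedGerm H (simpleG α b c d) := by
  rintro ⟨ρ, hρ, hρ1, -, hτ⟩
  have hα0 := ne_zero_of_norm_one hα
  have hα3 : ‖α ^ 3‖ = 1 := by rw [norm_pow, hα, one_pow]
  have hl : ((ρ / 2 : ℝ) : ℂ) ≠ 0 := Complex.ofReal_ne_zero.2 (by positivity)
  have hn : ‖((ρ / 2 : ℝ) : ℂ)‖ < ρ := by
    rw [Complex.norm_real, Real.norm_of_nonneg (by positivity)]; linarith
  generalize ((ρ / 2 : ℝ) : ℂ) = lam at hl hn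
  have e1 : lam ^ 3 ≠ α ^ 3 := pow_three_ne_of_norm hα3 (by linarith)
  have e1' : lam ^ 3 ≠ -α ^ 3 := pow_three_ne_of_norm (by rwa [norm_neg]) (by linarith)
  have hn' : ‖((starRingEnd ℂ) lam)⁻¹‖ ≠ 1 := by
    rw [norm_inv, RCLike.norm_conj, ne_eq, inv_eq_one]
    linarith
  have h1 := congrFun (congrFun (hτ lam hl (Or.inl hn)) 2) 2
  rw [simpleG_eq hs (pow_three_ne_of_norm hα3 hn'), simpleG_eq hs e1, tau_smul, tau_eq] at h1
  simp [numG, conj_eq_inv_of_norm_one hα] at h1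
  have e2 := sub_ne_zero.2 e1
  have e3 : (lam ^ 3)⁻¹ - (α ^ 3)⁻¹ ≠ 0 := fun h0 => e1 (by
    rwa [sub_eq_zero, inv_inj] at h0)
  have e4 : α ^ 3 - lam ^ 3 ≠ 0 := sub_ne_zero.2 e1.symm
  field_simp at h1
  refine e1' ?_
  have h3 : (lam ^ 3 + α ^ 3) * (2 * (lam ^ 3 - α ^ 3)) = 0 := by linear_combination h1
  exact eq_neg_of_add_eq_zero_left ((mul_eq_zero.1 h3).resolve_right (mul_ne_zero two_ne_zero e2))

/-- The line `ℓ E(z, β)`, `|β| = 1`, inherits the reality condition of `ℓ`. -/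
theorem conj_lineVec {H : ℝ} {b c β z : ℂ} {E : ℂ → ℂ → Matrix (Fin 3) (Fin 3) ℂ}
    (hE : tau H (E z β) = E z β) (hc : c = kap H * (starRingEnd ℂ) b) :
    (starRingEnd ℂ) (lineVec b c β E z 0) = kap H * lineVec b c β E z 1 ∧
    (starRingEnd ℂ) (lineVec b c β E z 2) = lineVec b c β E z 2 := by
  have hk := kap_mul_self H
  rw [tau_eq] at hE
  have e := fun i j => congrFun (congrFun hE i) j
  have e01 := e 0 1
  have e11 := e 1 1
  have e21 := e 2 1
  have e02 := e 0 2
  have e12 := e 1 2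
  have e22 := e 2 2
  simp at e01 e11 e21 e02 e12 e22
  simp only [lineVec_apply, map_add, map_mul, hc, conj_kap, Complex.conj_conj]
  constructor
  · linear_combination (starRingEnd ℂ) b * e11 + kap H * b * e01 + kap H * e21 -
      ((starRingEnd ℂ) b * E z β 1 1 + (starRingEnd ℂ) (E z β 2 0)) * hk
  · linear_combination kap H * (starRingEnd ℂ) b * e12 + b * e02 + e22 -
      (starRingEnd ℂ) b * (starRingEnd ℂ) (E z β 0 2) * hk

/-- The dressed loop inherits the reality condition. -/
theorem tau_dress {H : ℝ} (hH : H < 0) {β b d bt dt v : ℂ} {g : ℂ → Matrix (Fin 3) (Fin 3) ℂ}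
    (hβ : ‖β‖ = 1) (hg : IsTwistedLoop H g) (hv : v ≠ 0)
    (h : ![b, (starRingEnd ℂ) b, 1] ᵥ* g β = v • ![bt, (starRingEnd ℂ) bt, 1])
    (hs : 2 * b * (starRingEnd ℂ) b - 1 ≠ 0)
    (hd : d * (starRingEnd ℂ) d = 2 * b * (starRingEnd ℂ) b - 1)
    (hst : 2 * bt * (starRingEnd ℂ) bt - 1 ≠ 0)
    (hdt : dt * (starRingEnd ℂ) dt = 2 * bt * (starRingEnd ℂ) bt - 1) {lam : ℂ} (hl : lam ≠ 0) :
    tau H (dress β b ((starRingEnd ℂ) b) d bt ((starRingEnd ℂ) bt) dt g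
        ((starRingEnd ℂ) lam)⁻¹) =
      dress β b ((starRingEnd ℂ) b) d bt ((starRingEnd ℂ) bt) dt g lam := by
  have hβ0 := ne_zero_of_norm_one hβ
  have hdt0 : dt ≠ 0 := fun h => by rw [h, zero_mul] at hdt; exact hst hdt.symm
  have hinv : ∀ l : ℂ, l ≠ 0 → ((starRingEnd ℂ) l)⁻¹ ≠ 0 := fun l hl =>
    inv_ne_zero ((map_ne_zero _).2 hl)
  have hhol := differentiableOn_dress (d := d) (dt := dt) hβ0 hg.1 hv h
  refine matrix_eq_of_eq_off_roots β
    (f := fun lam => tau H (dress β b ((starRingEnd ℂ) b) d bt ((starRingEnd ℂ) bt) dt g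
        ((starRingEnd ℂ) lam)⁻¹))
    (g := dress β b ((starRingEnd ℂ) b) d bt ((starRingEnd ℂ) bt) dt g) (fun i j => ?_)
    (fun i j => (hhol i j).continuousOn) (fun l hl h6 => ?_) hl
  · have hc : ContinuousOn (fun l : ℂ => ((starRingEnd ℂ) l)⁻¹) {0}ᶜ :=
      Complex.continuous_conj.continuousOn.inv₀ fun l hl => (map_ne_zero _).2 hl
    simp only [tau, Matrix.mul_apply, Matrix.map_apply]
    refine continuousOn_finsetSum _ fun k _ => ContinuousOn.mul
      (continuousOn_finsetSum _ fun m _ => continuousOn_const.mul ?_) continuousOn_const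
    exact Complex.continuous_conj.comp_continuousOn
      ((hhol m k).continuousOn.comp hc fun l hl => hinv l hl)
  · have h1 := congrArg (tau H) (numG_mul_eq_dress_mul (d := d) hβ0 hg.1 hv h hst hdt0 (hinv l hl))
    rw [tau_mul, tau_mul, tau_numG hH hβ hs hd hl, tau_numG hH hβ hst hdt hl, hg.2 l hl,
      Matrix.smul_mul, Matrix.mul_smul,
      numG_mul_eq_dress_mul (d := d) hβ0 hg.1 hv h hst hdt0 hl] at h1
    have h2 := smul_right_injective _ (inv_ne_zero (mul_ne_zero (pow_ne_zero 3 hl)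
      (pow_ne_zero 3 hβ0))) h1
    exact (matrix_mul_right_cancel (det_numG_ne_zero hst hdt0 h6) h2).symm

/-! ### The transformation formula -/

theorem wz_pi {f : ℂ → Fin 3 → ℂ} {a b : Fin 3 → ℂ} {z : ℂ}
    (h : ∀ i, HasW (fun w => f w i) (a i) (b i) z) : wz f z = a ∧ wzb f z = b := by
  have hf : HasFDerivAt f (ContinuousLinearMap.pi fun i => wlin (a i) (b i)) z :=
    hasFDerivAt_pi.2 h
  constructor
  · funext i
    rw [← (h i).wz_eq, wz, wz, hf.fderiv, HasFDerivAt.fderiv (h i)]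
    simp
  · funext i
    rw [← (h i).wzb_eq, wzb, wzb, hf.fderiv, HasFDerivAt.fderiv (h i)]
    simp

/-- `φ` is the last component of the moving row vector up to a constant. Hence it does not vanish
off `Δ`, and its logarithmic derivatives are multiples of `b̃` and `c̃`. -/
theorem scalarSol_eq (H : ℝ) (b c β : ℂ) (E : ℂ → ℂ → Matrix (Fin 3) (Fin 3) ℂ) (z : ℂ) :
    scalarSol H b c β E z = (-(H : ℂ))⁻¹ * lineVec b c β E z 2 := by
  rw [lineVec_apply]
  simp [scalarSol, framePos, thirdCol, dotProduct, Fin.sum_univ_three]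
  ring

theorem mul_connZ_two (X : Matrix (Fin 3) (Fin 3) ℂ) (H : ℝ) (p U : ℂ → ℂ) (lam z : ℂ)
    (i : Fin 3) : (X * connZ H p U lam z) i 2 = X i 0 * (lam * (rootH H / 2 * p z)) ∧
      (X * connZbar H p U lam z) i 2 = X i 1 * (lam⁻¹ * (rootH H / 2 * p z)) := by
  constructor <;> simp [Matrix.mul_apply, Fin.sum_univ_three, connZ, connZbar] <;>
    exact Or.inl (by ring)

/-- The transformation formula in terms of frames. -/
theorem tzitzeica_eq {D : Set ℂ} (hD : IsOpen D) {H : ℝ} (hH : H ≠ 0) {ψ : ℂ → ℝ} {U : ℂ → ℂ}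
    {E : ℂ → ℂ → Matrix (Fin 3) (Fin 3) ℂ} {X : ℂ → Matrix (Fin 3) (Fin 3) ℂ} {b c β lam z : ℂ}
    (hX : Solves D H (expHalf ψ) U lam X) (hE : Solves D H (expHalf ψ) U β fun z => E z β)
    {f : ℂ → Fin 3 → ℂ} (hf : ∀ z ∈ D, f z = (-(H : ℂ))⁻¹ • thirdCol (X z)) (hz : z ∈ D)
    (hv : lineVec b c β E z 2 ≠ 0) (hβ : β ≠ 0) (hl3 : lam ^ 3 ≠ β ^ 3) :
    tzitzeica H ψ (scalarSol H b c β E) f (-β) lam z =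
      (lam ^ 3 - β ^ 3)⁻¹ • (X z *ᵥ ![2 * β ^ 2 * lam * cTilde b c β E z,
        -(2 * β * lam ^ 2 * bTilde b c β E z), lam ^ 3 - β ^ 3]) := by
  have hHc : (H : ℂ) ≠ 0 := Complex.ofReal_ne_zero.2 hH
  have hp := expHalf_ne_zero ψ z
  have h3 := sub_ne_zero.2 hl3
  have hr := rootH_sq H
  have hφ : HasW (scalarSol H b c β E) _ _ z :=
    ((hasW_lineVec (b := b) (c := c) hE hz 2).const_mul (-(H : ℂ))⁻¹).congr
      (Filter.Eventually.of_forall fun w => scalarSol_eq H b c β E w)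
  have hfw : ∀ i, HasW (fun w => f w i)
      ((-(H : ℂ))⁻¹ * (X z i 0 * (lam * (rootH H / 2 * expHalf ψ z))))
      ((-(H : ℂ))⁻¹ * (X z i 1 * (lam⁻¹ * (rootH H / 2 * expHalf ψ z)))) z := fun i => by
    obtain ⟨e1, e2⟩ := mul_connZ_two (X z) H (expHalf ψ) U lam z i
    rw [← e1, ← e2]
    refine ((hX z hz i 2).const_mul (-(H : ℂ))⁻¹).congr ?_
    filter_upwards [hD.mem_nhds hz] with w hw
    rw [hf w hw]
    rfl
  obtain ⟨w1, w2⟩ := wz_pi hfw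
  obtain ⟨-, -, v1⟩ := vecMul_connZ (lineVec b c β E z) H (expHalf ψ) U β z
  obtain ⟨-, -, v2⟩ := vecMul_connZbar (lineVec b c β E z) H (expHalf ψ) U β z
  rw [tzitzeica, w1, w2, hφ.wz_eq, hφ.wzb_eq, v1, v2, scalarSol_eq, hf z hz, ← expHalf_sq]
  -- The third component of the row equation gives `(ln φ)_z` in terms of `b̃` and `(ln φ)_z̄` in
  -- terms of `c̃`.
  have e1 : (-(H : ℂ))⁻¹ * (lineVec b c β E z 0 * (β * (rootH H / 2 * expHalf ψ z))) /
      ((-(H : ℂ))⁻¹ * lineVec b c β E z 2) =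
      bTilde b c β E z * (β * (rootH H / 2 * expHalf ψ z)) := by
    rw [bTilde]; field_simp
  have e2 : (-(H : ℂ))⁻¹ * (lineVec b c β E z 1 * (β⁻¹ * (rootH H / 2 * expHalf ψ z))) /
      ((-(H : ℂ))⁻¹ * lineVec b c β E z 2) =
      cTilde b c β E z * (β⁻¹ * (rootH H / 2 * expHalf ψ z)) := by
    rw [cTilde]; field_simp
  rw [e1, e2]
  generalize bTilde b c β E z = bt, cTilde b c β E z = ct, expHalf ψ z = p at *
  have h3' : lam ^ 3 + (-β) ^ 3 = lam ^ 3 - β ^ 3 := by ring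
  rw [h3']
  funext i
  simp [Matrix.mulVec, dotProduct, Fin.sum_univ_three, thirdCol]
  have h3'' : lam ^ 3 - β ^ 3 ≠ 0 := h3
  generalize lam ^ 3 - β ^ 3 = q at h3''
  field_simp
  linear_combination (4 * lam * β * (-X z i 0 * β * ct + X z i 1 * lam * bt)) * hr

theorem thirdCol_mul (X Y : Matrix (Fin 3) (Fin 3) ℂ) : thirdCol (X * Y) = X *ᵥ thirdCol Y := rfl

theorem thirdCol_smul (k : ℂ) (X : Matrix (Fin 3) (Fin 3) ℂ) :
    thirdCol (k • X) = k • thirdCol X := rfl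

/-- The inverse of a simple element, applied to the third column of the dressed loop. -/
theorem inv_mulVec_thirdCol {β γ b c d bt ct dt lam : ℂ} {g E Et : Matrix (Fin 3) (Fin 3) ℂ}
    (hs : 2 * b * c - 1 ≠ 0) (hd : d ≠ 0) (hst : 2 * bt * ct - 1 ≠ 0) (hdt : dt ≠ 0)
    (hg : g = (lam ^ 3 - γ)⁻¹ • numG β b c d lam) (hγ : lam ^ 3 ≠ γ) (hl : lam ^ 3 ≠ β ^ 3)
    (hl' : lam ^ 3 ≠ -β ^ 3) (h : numG β b c d lam * E = Et * numG β bt ct dt lam) :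
    g⁻¹ *ᵥ thirdCol Et = ((lam ^ 3 - γ) / (lam ^ 3 + β ^ 3)) • ((lam ^ 3 - β ^ 3)⁻¹ •
      (E *ᵥ ![2 * β ^ 2 * lam * ct, -(2 * β * lam ^ 2 * bt), lam ^ 3 - β ^ 3])) := by
  have h1 := sub_ne_zero.2 hγ
  have h2 := sub_ne_zero.2 hl
  have h3 : lam ^ 3 + β ^ 3 ≠ 0 := fun h0 => hl' (eq_neg_of_add_eq_zero_left h0)
  have h6 : β ^ 6 - lam ^ 6 ≠ 0 := by
    have : β ^ 6 - lam ^ 6 = -((lam ^ 3 - β ^ 3) * (lam ^ 3 + β ^ 3)) := by ring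
    rw [this]
    exact neg_ne_zero.2 (mul_ne_zero h2 h3)
  have hdet : IsUnit g.det := by
    rw [hg, det_smul_three]
    exact isUnit_iff_ne_zero.2 (mul_ne_zero (pow_ne_zero 3 (inv_ne_zero h1))
      (det_numG_ne_zero hs hd h6))
  -- The third column of the adjoint does not contain `d̃`, which is why the transformation formula
  -- needs only `φ`.
  have e : thirdCol (adjG β bt ct dt lam) =
      (-1 : ℂ) • ![2 * β ^ 2 * lam * ct, -(2 * β * lam ^ 2 * bt), lam ^ 3 - β ^ 3] := by
    funext i
    fin_cases i <;> simp [thirdCol, adjG]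
  have h4 : numG β b c d lam *ᵥ (E *ᵥ thirdCol (adjG β bt ct dt lam)) =
      (β ^ 6 - lam ^ 6) • thirdCol Et := by
    rw [Matrix.mulVec_mulVec, ← thirdCol_mul, h, Matrix.mul_assoc, numG_mul_adjG hst hdt,
      Matrix.mul_smul, Matrix.mul_one, thirdCol_smul]
  rw [e, Matrix.mulVec_smul, Matrix.mulVec_smul] at h4
  generalize E *ᵥ ![2 * β ^ 2 * lam * ct, -(2 * β * lam ^ 2 * bt), lam ^ 3 - β ^ 3] = y at h4 ⊢
  have h5 : thirdCol Et =
      g *ᵥ (((lam ^ 3 - γ) / (lam ^ 3 + β ^ 3)) • ((lam ^ 3 - β ^ 3)⁻¹ • y)) := by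
    have : thirdCol Et = (β ^ 6 - lam ^ 6)⁻¹ • ((-1 : ℂ) • numG β b c d lam *ᵥ y) := by
      rw [h4, smul_smul, inv_mul_cancel₀ h6, one_smul]
    rw [this, hg, Matrix.mulVec_smul, Matrix.mulVec_smul, Matrix.smul_mulVec, smul_smul, smul_smul,
      smul_smul]
    congr 1
    have : β ^ 6 - lam ^ 6 = -((lam ^ 3 - β ^ 3) * (lam ^ 3 + β ^ 3)) := by ring
    rw [this]
    field_simp
  rw [h5, Matrix.mulVec_mulVec, Matrix.nonsing_inv_mul _ hdet, Matrix.one_mulVec]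

theorem expHalf_add_log {ψ δ : ℂ → ℝ} {z : ℂ} (h : 0 < δ z) :
    expHalf (fun z => ψ z + Real.log (δ z ^ 2)) z = (δ z : ℂ) * expHalf ψ z := by
  rw [expHalf, expHalf, ← Complex.ofReal_mul, add_div, Real.exp_add, Real.log_pow]
  have e : ((2 : ℕ) : ℝ) * Real.log (δ z) / 2 = Real.log (δ z) := by push_cast; ring
  rw [e, Real.exp_log h, mul_comm]

theorem conn_congr {V : Set ℂ} (hV : IsOpen V) {H : ℝ} {p p' U : ℂ → ℂ}
    (h : ∀ z ∈ V, p z = p' z) (lam : ℂ) {z : ℂ} (hz : z ∈ V) :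
    connZ H p U lam z = connZ H p' U lam z ∧ connZbar H p U lam z = connZbar H p' U lam z := by
  have e : p =ᶠ[nhds z] p' := Filter.eventually_of_mem (hV.mem_nhds hz) h
  rw [connZ, connZ, connZbar, connZbar, wz_congr e, wzb_congr e, h z hz]
  exact ⟨rfl, rfl⟩

theorem IsFrame.congr {V : Set ℂ} (hV : IsOpen V) {H : ℝ} {p p' U : ℂ → ℂ}
    {E : ℂ → ℂ → Matrix (Fin 3) (Fin 3) ℂ} (hE : IsFrame V H p U E)
    (h : ∀ z ∈ V, p z = p' z) : IsFrame V H p' U E where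
  smooth := hE.smooth
  eqZ lam hl z hz := by rw [hE.eqZ lam hl z hz, (conn_congr hV h lam hz).1]
  eqZbar lam hl z hz := by rw [hE.eqZbar lam hl z hz, (conn_congr hV h lam hz).2]

theorem contDiffOn_lineVec {V : Set ℂ} {H : ℝ} {p U : ℂ → ℂ}
    {E : ℂ → ℂ → Matrix (Fin 3) (Fin 3) ℂ} (hE : IsFrame V H p U E) (b c : ℂ) {β : ℂ} (hβ : β ≠ 0)
    (j : Fin 3) : ContDiffOn ℝ ∞ (fun z => lineVec b c β E z j) V := by
  simp only [lineVec_apply]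
  exact ((contDiffOn_const.mul (hE.smooth β hβ 0 j)).add
    (contDiffOn_const.mul (hE.smooth β hβ 1 j))).add (hE.smooth β hβ 2 j)

theorem IsFrame.mono {V D : Set ℂ} {H : ℝ} {p U : ℂ → ℂ} {E : ℂ → ℂ → Matrix (Fin 3) (Fin 3) ℂ}
    (hE : IsFrame D H p U E) (hV : V ⊆ D) : IsFrame V H p U E where
  smooth lam hl i j := (hE.smooth lam hl i j).mono hV
  eqZ lam hl z hz := hE.eqZ lam hl z (hV hz)
  eqZbar lam hl z hz := hE.eqZbar lam hl z (hV hz)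

theorem isOpen_dressingDomain {D : Set ℂ} (hD : IsOpen D) {H : ℝ} {p U : ℂ → ℂ}
    {E : ℂ → ℂ → Matrix (Fin 3) (Fin 3) ℂ} (hE : IsFrame D H p U E) (b c : ℂ) {β : ℂ}
    (hβ : β ≠ 0) : IsOpen (dressingDomain D b c β E) := by
  refine isOpen_iff_mem_nhds.2 fun z hz => ?_
  obtain ⟨hzD, hcone, hpos⟩ := hz
  have hc : ∀ j, ContinuousAt (fun w => lineVec b c β E w j) z := fun j =>
    (contDiffOn_lineVec hE b c hβ j).continuousOn.continuousAt (hD.mem_nhds hzD)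
  have hv := lineVec_two_ne hcone
  have hb : ContinuousAt (bTilde b c β E) z := (hc 0).div (hc 2) hv
  have h1 : ∀ᶠ w in nhds z, 2 * lineVec b c β E w 0 * lineVec b c β E w 1 -
      lineVec b c β E w 2 ^ 2 ≠ 0 := by
    refine ContinuousAt.eventually_ne ?_ fun h0 => hcone (Or.inl (sub_eq_zero.1 h0))
    exact ((continuousAt_const.mul (hc 0)).mul (hc 1)).sub ((hc 2).pow 2)
  have h2 : ∀ᶠ w in nhds z, 0 < 2 * ‖bTilde b c β E w‖ ^ 2 - 1 :=
    ((continuousAt_const.mul (hb.norm.pow 2)).sub continuousAt_const).eventually_const_lt hpos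
  filter_upwards [hD.mem_nhds hzD, h1, h2, (hc 2).eventually_ne hv] with w a1 a2 a3 a4
  exact ⟨a1, fun h => h.elim (fun h => a2 (sub_eq_zero.2 h)) a4, a3⟩

theorem dTilde_pos {D : Set ℂ} {b c β z : ℂ} {E : ℂ → ℂ → Matrix (Fin 3) (Fin 3) ℂ}
    (hz : z ∈ dressingDomain D b c β E) : 0 < dTilde b c β E z := Real.sqrt_pos.2 hz.2.2

theorem mul_conj_norm (w : ℂ) : w * (starRingEnd ℂ) w = (‖w‖ ^ 2 : ℝ) := by
  rw [Complex.mul_conj, Complex.normSq_eq_norm_sq]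

theorem dTilde_sq {D : Set ℂ} {b c β z : ℂ} {E : ℂ → ℂ → Matrix (Fin 3) (Fin 3) ℂ}
    (hz : z ∈ dressingDomain D b c β E) : (dTilde b c β E z : ℂ) ^ 2 =
      2 * bTilde b c β E z * (starRingEnd ℂ) (bTilde b c β E z) - 1 := by
  rw [mul_assoc, mul_conj_norm, ← Complex.ofReal_pow, dTilde, Real.sq_sqrt hz.2.2.le]
  push_cast
  ring

theorem contDiffOn_dTilde {D : Set ℂ} {H : ℝ} {p U : ℂ → ℂ}
    {E : ℂ → ℂ → Matrix (Fin 3) (Fin 3) ℂ} (hE : IsFrame D H p U E) (b c : ℂ) {β : ℂ}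
    (hβ : β ≠ 0) : ContDiffOn ℝ ∞ (dTilde b c β E) (dressingDomain D b c β E) := by
  have hsub : dressingDomain D b c β E ⊆ D := fun z hz => hz.1
  have hb : ContDiffOn ℝ ∞ (bTilde b c β E) (dressingDomain D b c β E) :=
    contDiffOn_div ((contDiffOn_lineVec hE b c hβ 0).mono hsub)
      ((contDiffOn_lineVec hE b c hβ 2).mono hsub) fun z hz => lineVec_two_ne hz.2.1
  exact ((contDiffOn_const.mul (hb.norm_sq ℝ)).sub contDiffOn_const).sqrt fun z hz => hz.2.2.ne'

theorem IsNormalizedFrame.tau_eq_self {D : Set ℂ} {H : ℝ} {ψ : ℂ → ℝ} {U : ℂ → ℂ}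
    {E : ℂ → ℂ → Matrix (Fin 3) (Fin 3) ℂ} (hE : IsNormalizedFrame D H ψ U E) {z lam : ℂ}
    (hz : z ∈ D) (hl : ‖lam‖ = 1) : tau H (E z lam) = E z lam := by
  have h := (hE.loop z hz).2 lam (ne_zero_of_norm_one hl)
  rwa [conj_inv_of_norm_one hl] at h

/-- Serves both signs of `H`: it yields `c̃` as the conjugate of `b̃` in the hyperbolic case and as
minus the conjugate in the elliptic one. -/
theorem cTilde_eq_kap_mul {H : ℝ} {b c β z : ℂ} {E : ℂ → ℂ → Matrix (Fin 3) (Fin 3) ℂ}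
    (hE : tau H (E z β) = E z β) (hc : c = kap H * (starRingEnd ℂ) b) :
    cTilde b c β E z = kap H * (starRingEnd ℂ) (bTilde b c β E z) := by
  obtain ⟨h0, h2⟩ := conj_lineVec hE hc
  rw [bTilde, map_div₀, h0, h2, cTilde, ← mul_div_assoc, ← mul_assoc, kap_mul_self, one_mul]

theorem lineVec_zero {D : Set ℂ} {H : ℝ} {ψ : ℂ → ℝ} {U : ℂ → ℂ}
    {E : ℂ → ℂ → Matrix (Fin 3) (Fin 3) ℂ} (hE : IsNormalizedFrame D H ψ U E) (b c : ℂ) {β : ℂ}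
    (hβ : β ≠ 0) : lineVec b c β E 0 = ![b, c, 1] := by
  rw [lineVec, hE.normalized β hβ, Matrix.vecMul_one]

theorem two_mul_sub_one_ne {b c : ℂ} (h : ![b, c, 1] ∉ coneDelta) : 2 * b * c - 1 ≠ 0 :=
  fun h0 => h (Or.inl (by simpa using sub_eq_zero.1 h0))

/-- At the base point the line is the original one and `2|b|² - 1 = |d|²`, which is positive because
`d ≠ 0`. -/
theorem zero_mem_dressingDomain {D : Set ℂ} (h0 : (0 : ℂ) ∈ D) {H : ℝ} {ψ : ℂ → ℝ} {U : ℂ → ℂ}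
    {E : ℂ → ℂ → Matrix (Fin 3) (Fin 3) ℂ} (hE : IsNormalizedFrame D H ψ U E) {b c d β : ℂ}
    (hβ : β ≠ 0) (h : ![b, c, 1] ∉ coneDelta) (hc : c = (starRingEnd ℂ) b)
    (hd : d * (starRingEnd ℂ) d = 2 * b * c - 1) : (0 : ℂ) ∈ dressingDomain D b c β E := by
  have hv := lineVec_zero hE b c hβ
  refine ⟨h0, hv ▸ h, ?_⟩
  have hs := two_mul_sub_one_ne h
  have hd0 : d ≠ 0 := fun h => by rw [h, zero_mul] at hd; exact hs hd.symm
  have hb : bTilde b c β E 0 = b := by simp [bTilde, hv]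
  rw [hc, mul_assoc, mul_conj_norm, mul_conj_norm] at hd
  have e : ‖d‖ ^ 2 = 2 * ‖b‖ ^ 2 - 1 := by exact_mod_cast hd
  rw [hb, ← e]
  exact pow_pos (norm_pos_iff.2 hd0) 2

/-! ### Dressing of hyperbolic affine spheres. -/

section Hyperbolic

variable {D : Set ℂ} {H : ℝ} {ψ : ℂ → ℝ} {U : ℂ → ℂ} {E : ℂ → ℂ → Matrix (Fin 3) (Fin 3) ℂ}
  {b d β z : ℂ}

theorem cTilde_eq_conj (hH : H < 0) (hE : IsNormalizedFrame D H ψ U E) (hβ : ‖β‖ = 1)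
    (hz : z ∈ D) : cTilde b ((starRingEnd ℂ) b) β E z =
      (starRingEnd ℂ) (bTilde b ((starRingEnd ℂ) b) β E z) := by
  have h := cTilde_eq_kap_mul (hE.tau_eq_self hz hβ) (c := (starRingEnd ℂ) b) (b := b)
    (by rw [kap_of_neg hH, one_mul])
  rwa [kap_of_neg hH, one_mul] at h

theorem conj_tilde_ne (hz : z ∈ dressingDomain D b ((starRingEnd ℂ) b) β E) :
    2 * bTilde b ((starRingEnd ℂ) b) β E z *
      (starRingEnd ℂ) (bTilde b ((starRingEnd ℂ) b) β E z) - 1 ≠ 0 := by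
  rw [← dTilde_sq hz]
  exact pow_ne_zero 2 (Complex.ofReal_ne_zero.2 (dTilde_pos hz).ne')

theorem dTilde_mul_conj (hz : z ∈ dressingDomain D b ((starRingEnd ℂ) b) β E) :
    (dTilde b ((starRingEnd ℂ) b) β E z : ℂ) *
      (starRingEnd ℂ) (dTilde b ((starRingEnd ℂ) b) β E z : ℂ) =
    2 * bTilde b ((starRingEnd ℂ) b) β E z *
      (starRingEnd ℂ) (bTilde b ((starRingEnd ℂ) b) β E z) - 1 := by
  rw [Complex.conj_ofReal, ← sq, dTilde_sq hz]

theorem isTwistedLoop_dressFrame (hH : H < 0) (hE : IsNormalizedFrame D H ψ U E) (hβ : ‖β‖ = 1)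
    (hs : 2 * b * (starRingEnd ℂ) b - 1 ≠ 0)
    (hd : d * (starRingEnd ℂ) d = 2 * b * (starRingEnd ℂ) b - 1)
    (hz : z ∈ dressingDomain D b ((starRingEnd ℂ) b) β E) :
    IsTwistedLoop H (dressFrame β b ((starRingEnd ℂ) b) d
      (fun z => (dTilde b ((starRingEnd ℂ) b) β E z : ℂ)) E z) := by
  have hc := cTilde_eq_conj (b := b) hH hE hβ hz.1
  have hv := lineVec_two_ne hz.2.1
  have hl := lineVec_eq_smul hv
  have hd0 : d ≠ 0 := fun h => by rw [h, zero_mul] at hd; exact hs hd.symm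
  have hdt0 : (dTilde b ((starRingEnd ℂ) b) β E z : ℂ) ≠ 0 :=
    Complex.ofReal_ne_zero.2 (dTilde_pos hz).ne'
  rw [dressFrame, hc]
  rw [hc] at hl
  exact ⟨isSigmaLoop_dress (ne_zero_of_norm_one hβ) (hE.loop z hz.1).1 hv hl hs hd0
    (conj_tilde_ne hz) hdt0, fun lam hlam => tau_dress hH hβ (hE.loop z hz.1) hv hl hs hd
    (conj_tilde_ne hz) (dTilde_mul_conj hz) hlam⟩

theorem numG_mul_eq_dressFrame_mul (hH : H < 0) (hE : IsNormalizedFrame D H ψ U E) (hβ : ‖β‖ = 1)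
    (hz : z ∈ dressingDomain D b ((starRingEnd ℂ) b) β E) {lam : ℂ} (hlam : lam ≠ 0) :
    numG β b ((starRingEnd ℂ) b) d lam * E z lam = dressFrame β b ((starRingEnd ℂ) b) d
        (fun z => (dTilde b ((starRingEnd ℂ) b) β E z : ℂ)) E z lam *
      numG β (bTilde b ((starRingEnd ℂ) b) β E z)
        ((starRingEnd ℂ) (bTilde b ((starRingEnd ℂ) b) β E z))
        (dTilde b ((starRingEnd ℂ) b) β E z) lam := by
  have hc := cTilde_eq_conj (b := b) hH hE hβ hz.1
  have hv := lineVec_two_ne hz.2.1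
  have hl := lineVec_eq_smul hv
  rw [dressFrame, hc]
  rw [hc] at hl
  exact numG_mul_eq_dress_mul (ne_zero_of_norm_one hβ) (hE.loop z hz.1).1 hv hl
    (conj_tilde_ne hz) (Complex.ofReal_ne_zero.2 (dTilde_pos hz).ne') hlam

theorem isFrame_dressFrame_dTilde (hD : IsOpen D) (hH : H < 0) (hψ : ContDiffOn ℝ ∞ ψ D)
    (hU : ContDiffOn ℝ ∞ U D) (hE : IsNormalizedFrame D H ψ U E) (hβ : ‖β‖ = 1) :
    IsFrame (dressingDomain D b ((starRingEnd ℂ) b) β E) H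
      (expHalf fun z => ψ z + Real.log (dTilde b ((starRingEnd ℂ) b) β E z ^ 2)) U
      (dressFrame β b ((starRingEnd ℂ) b) d
        (fun z => (dTilde b ((starRingEnd ℂ) b) β E z : ℂ)) E) := by
  have hβ0 := ne_zero_of_norm_one hβ
  have hsub : dressingDomain D b ((starRingEnd ℂ) b) β E ⊆ D := fun z hz => hz.1
  have hW := isOpen_dressingDomain hD hE.frame b ((starRingEnd ℂ) b) hβ0
  refine (isFrame_dressFrame (hE.frame.mono hsub) (fun z hz => (hE.loop z hz.1).1) hβ0 hW
    ((contDiffOn_expHalf hψ).mono hsub) (fun z _ => expHalf_ne_zero ψ z) (hU.mono hsub)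
    (fun z hz => hz.2.1)
    (Complex.ofRealCLM.contDiff.comp_contDiffOn (contDiffOn_dTilde hE.frame b _ hβ0))
    fun z hz => ?_).congr hW fun z hz => (expHalf_add_log (dTilde_pos hz)).symm
  rw [cTilde_eq_conj hH hE hβ hz.1]
  exact dTilde_sq hz

end Hyperbolic

theorem tau_inv {H : ℝ} {g : Matrix (Fin 3) (Fin 3) ℂ} (hg : tau H g = g) (h : g.det ≠ 0) :
    tau H g⁻¹ = g⁻¹ := by
  have e : tau H g⁻¹ * g = 1 := calc
    tau H g⁻¹ * g = tau H (g⁻¹ * g) := by rw [tau_mul, hg]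
    _ = 1 := by rw [Matrix.nonsing_inv_mul _ (isUnit_iff_ne_zero.2 h), tau_one]
  exact (Matrix.inv_eq_left_inv e).symm

/-- `k F g Ẽ` solves the same equation as `Ẽ`, is in real form since `g` and `Ẽ` are `τ`-fixed and
`k` is real, and keeps the determinant of `F` because `k³ det g = 1`. It is used with `g = 1` and
with `g` the inverse of the simple element. -/
theorem exists_sphere_of_smul_frame {W : Set ℂ} (hW : IsOpen W) {H : ℝ} (hH : H ≠ 0)
    {ψ : ℂ → ℝ} {U : ℂ → ℂ} {lam : ℂ} (hl : ‖lam‖ = 1) (hψ : ContDiffOn ℝ ∞ ψ W)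
    (hU : ContDiffOn ℝ ∞ U W) {Et : ℂ → ℂ → Matrix (Fin 3) (Fin 3) ℂ}
    (hEt : IsFrame W H (expHalf ψ) U Et) (hloop : ∀ z ∈ W, IsTwistedLoop H (Et z))
    {F g : Matrix (Fin 3) (Fin 3) ℂ} (hF : RealForm H F) (hFdet : F.det = -(Complex.I * (H : ℂ)))
    (hg : tau H g = g) {k : ℝ} (hk : (k : ℂ) ^ 3 * g.det = 1) :
    ∃ R : ℂ → Fin 3 → ℝ, IsAffineSphere W R H ψ (fun z => lam ^ 3 * U z) ∧
      ∀ z ∈ W, cx R z = (k : ℂ) • (F *ᵥ (g *ᵥ framePos H Et lam z)) := by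
  have hl0 := ne_zero_of_norm_one hl
  have htau : ∀ z ∈ W, tau H (g * Et z lam) = g * Et z lam := fun z hz => by
    have h := (hloop z hz).2 lam hl0
    rw [conj_inv_of_norm_one hl] at h
    rw [tau_mul, hg, h]
  obtain ⟨R, h1, h2, -⟩ := exists_isAffineSphere_of_solves hW hH hl hψ hU
    ((hEt.solves hW hl0).const_mul ((k : ℂ) • (F * g)))
    (fun z hz => by
      rw [Matrix.smul_mul, Matrix.mul_assoc]
      exact (hF.mul_tau (htau z hz)).real_smul k)
    (fun z hz => by
      rw [Matrix.det_mul, det_smul_three, Matrix.det_mul, (hloop z hz).1.det lam hl0, hFdet]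
      linear_combination (-(Complex.I * (H : ℂ))) * hk)
  refine ⟨R, h2, fun z hz => ?_⟩
  rw [h1 z hz, framePos, Matrix.mulVec_mulVec, Matrix.mulVec_smul, smul_comm, thirdCol_mul,
    Matrix.smul_mulVec]

/-- For distinct points of the unit circle, `(x + y)/(x - y)` is purely imaginary. -/
theorem norm_ratio_sq {x y : ℂ} (hx : ‖x‖ = 1) (hy : ‖y‖ = 1) (h : x ≠ y) :
    ((x + y) / (x - y)) ^ 2 = -((‖(x + y) / (x - y)‖ : ℝ) : ℂ) ^ 2 := by
  have hx0 := ne_zero_of_norm_one hx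
  have hy0 := ne_zero_of_norm_one hy
  have hxy := sub_ne_zero.2 h
  have hyx : y - x ≠ 0 := sub_ne_zero.2 h.symm
  have e : (starRingEnd ℂ) ((x + y) / (x - y)) = -((x + y) / (x - y)) := by
    rw [map_div₀, map_add, map_sub, conj_eq_inv_of_norm_one hx, conj_eq_inv_of_norm_one hy]
    have : x⁻¹ - y⁻¹ = (y - x) / (x * y) := by field_simp
    rw [this]
    field_simp
    ring
  have := mul_conj_norm ((x + y) / (x - y))
  rw [e] at this
  push_cast at this
  linear_combination -this

theorem pow_three_rpow {q : ℝ} (hq : 0 ≤ q) : (q ^ (2 / 3 : ℝ)) ^ 3 = q ^ 2 := by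
  rw [← Real.rpow_natCast, ← Real.rpow_mul hq, ← Real.rpow_natCast]
  norm_num

theorem det_simpleM {α b c d lam : ℂ} (hs : 2 * b * c - 1 ≠ 0) (hd : d ≠ 0)
    (hl : lam ^ 3 ≠ α ^ 3) :
    (simpleM α b c d lam).det = ((lam ^ 3 + α ^ 3) / (lam ^ 3 - α ^ 3)) ^ 2 := by
  have h := sub_ne_zero.2 hl
  rw [simpleM_eq hs hl, det_smul_three, det_numG hs hd]
  field_simp
  ring

/-- Dressing of hyperbolic affine spheres by the simple elements of rank 2 type. -/
theorem dressing_hyperbolic {D : Set ℂ} (hD : IsOpen D) (hDc : IsPreconnected D)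
    (h0 : (0 : ℂ) ∈ D) {H : ℝ} (hH : H < 0) {ψ : ℂ → ℝ} {U : ℂ → ℂ}
    (hψ : ContDiffOn ℝ ∞ ψ D) (hU : ContDiffOn ℝ ∞ U D)
    {E : ℂ → ℂ → Matrix (Fin 3) (Fin 3) ℂ} (hE : IsNormalizedFrame D H ψ U E) {α b c d : ℂ}
    (hα : ‖α‖ = 1) (hcone : ![b, c, 1] ∉ coneDelta) (hgerm : IsTwistedGerm H (simpleM α b c d))
    {W : Set ℂ} {bt : ℂ → ℂ} {dt ψt : ℂ → ℝ} {φ : ℂ → ℂ}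
    (hW : W = dressingDomain D b c (-α) E) (hbt : bt = bTilde b c (-α) E)
    (hdt : dt = dTilde b c (-α) E) (hψt : ψt = (fun z => ψ z + Real.log (dt z ^ 2)))
    (hφ : φ = scalarSol H b ((starRingEnd ℂ) b) (-α) E) :
    IsOpen W ∧ (0 : ℂ) ∈ W ∧
      ∃ Et : ℂ → ℂ → Matrix (Fin 3) (Fin 3) ℂ,
        (∀ z ∈ W, cTilde b c (-α) E z = (starRingEnd ℂ) (bt z) ∧
          IsTwistedLoop H (Et z) ∧
          IsTwistedGerm H (simpleM α (bt z) ((starRingEnd ℂ) (bt z)) (dt z)) ∧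
          ∀ lam : ℂ, lam ≠ 0 → lam ^ 3 ≠ α ^ 3 →
            simpleM α b c d lam * E z lam =
              Et z lam * simpleM α (bt z) ((starRingEnd ℂ) (bt z)) (dt z) lam) ∧
        IsFrame W H (expHalf ψt) U Et ∧
        (∀ z ∈ W, φ z ≠ 0 ∧ ∀ lam : ℂ, lam ≠ 0 → lam ^ 3 ≠ α ^ 3 → lam ^ 3 ≠ -α ^ 3 →
          (simpleM α b c d lam)⁻¹ *ᵥ thirdCol (Et z lam) =
            tzitzeica H ψ φ (framePos H E lam) α lam z) ∧
        ∀ lam : ℂ, ‖lam‖ = 1 → ∀ R : ℂ → Fin 3 → ℝ,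
          IsAffineSphere D R H ψ (fun z => lam ^ 3 * U z) →
          (∃ Rt : ℂ → Fin 3 → ℝ, IsAffineSphere W Rt H ψt (fun z => lam ^ 3 * U z) ∧
            ∀ z ∈ W, cx Rt z = sphereFrame H ψ R lam 0 *ᵥ framePos H Et lam z) ∧
          (lam ^ 3 ≠ α ^ 3 → lam ^ 3 ≠ -α ^ 3 → ∃ Rh : ℂ → Fin 3 → ℝ,
            (∀ z ∈ W, cx Rh z = tzitzeica H ψ φ (cx R) α lam z) ∧
            IsAffineSphere W
              (fun z => (H⁻¹ * ‖(lam ^ 3 + α ^ 3) / (lam ^ 3 - α ^ 3)‖ ^ (2 / 3 : ℝ)) • Rh z)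
              H ψt (fun z => lam ^ 3 * U z)) := by
  have hs := two_mul_sub_one_ne hcone
  -- The reality of the germ enters only through these two relations.
  obtain ⟨hc, hd⟩ := hgerm.simpleM_params hH hα hs
  have hd0 : d ≠ 0 := fun h => by rw [h, zero_mul] at hd; exact hs hd.symm
  have hβ : ‖-α‖ = 1 := by rwa [norm_neg]
  have hβ0 := ne_zero_of_norm_one hβ
  have hα3 : (-α) ^ 3 = -α ^ 3 := by ring
  have h0W := zero_mem_dressingDomain h0 hE hβ0 hcone hc hd
  subst hW hbt hdt hψt hφ hc
  have hWo := isOpen_dressingDomain hD hE.frame b ((starRingEnd ℂ) b) hβ0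
  have hsub : dressingDomain D b ((starRingEnd ℂ) b) (-α) E ⊆ D := fun z hz => hz.1
  have hfr := isFrame_dressFrame_dTilde (b := b) (d := d) hD hH hψ hU hE hβ
  have hloop := fun z (hz : z ∈ dressingDomain D b ((starRingEnd ℂ) b) (-α) E) =>
    isTwistedLoop_dressFrame hH hE hβ hs hd hz
  have hfac := fun z (hz : z ∈ dressingDomain D b ((starRingEnd ℂ) b) (-α) E) lam hl =>
    numG_mul_eq_dressFrame_mul (d := d) hH hE hβ hz (lam := lam) hl
  have hψt : ContDiffOn ℝ ∞
      (fun z => ψ z + Real.log (dTilde b ((starRingEnd ℂ) b) (-α) E z ^ 2))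
      (dressingDomain D b ((starRingEnd ℂ) b) (-α) E) :=
    (hψ.mono hsub).add (((contDiffOn_dTilde hE.frame b _ hβ0).pow 2).log
      fun z hz => pow_ne_zero 2 (dTilde_pos hz).ne')
  -- Both sides of the transformation formula are reduced to one expression in a frame and `b̃`,
  -- `c̃`: `hvec` by the algebra of the factorization, `htz` by differentiation. As `htz` holds for
  -- any solution, it applies to `E` and to the frame of `R`.
  have hvec : ∀ z ∈ dressingDomain D b ((starRingEnd ℂ) b) (-α) E, ∀ lam, lam ≠ 0 →
      lam ^ 3 ≠ α ^ 3 → lam ^ 3 ≠ -α ^ 3 →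
      (simpleM α b ((starRingEnd ℂ) b) d lam)⁻¹ *ᵥ thirdCol (dressFrame (-α) b
        ((starRingEnd ℂ) b) d (fun z => (dTilde b ((starRingEnd ℂ) b) (-α) E z : ℂ)) E z lam) =
      (lam ^ 3 - (-α) ^ 3)⁻¹ • (E z lam *ᵥ
        ![2 * (-α) ^ 2 * lam * cTilde b ((starRingEnd ℂ) b) (-α) E z,
          -(2 * (-α) * lam ^ 2 * bTilde b ((starRingEnd ℂ) b) (-α) E z),
          lam ^ 3 - (-α) ^ 3]) := by
    intro z hz lam hl h1 h2
    rw [inv_mulVec_thirdCol (γ := α ^ 3) hs hd0 (conj_tilde_ne hz)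
      (Complex.ofReal_ne_zero.2 (dTilde_pos hz).ne') (simpleM_eq hs h1) h1 (by rwa [hα3])
      (by rwa [hα3, neg_neg]) (hfac z hz lam hl), cTilde_eq_conj hH hE hβ hz.1]
    rw [hα3, ← sub_eq_add_neg, div_self (sub_ne_zero.2 h1), one_smul]
  have htz : ∀ z ∈ dressingDomain D b ((starRingEnd ℂ) b) (-α) E, ∀ lam,
      lam ^ 3 ≠ -α ^ 3 → ∀ (X : ℂ → Matrix (Fin 3) (Fin 3) ℂ) (f : ℂ → Fin 3 → ℂ),
      Solves D H (expHalf ψ) U lam X → (∀ z ∈ D, f z = (-(H : ℂ))⁻¹ • thirdCol (X z)) →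
      tzitzeica H ψ (scalarSol H b ((starRingEnd ℂ) b) (-α) E) f α lam z =
      (lam ^ 3 - (-α) ^ 3)⁻¹ • (X z *ᵥ
        ![2 * (-α) ^ 2 * lam * cTilde b ((starRingEnd ℂ) b) (-α) E z,
          -(2 * (-α) * lam ^ 2 * bTilde b ((starRingEnd ℂ) b) (-α) E z),
          lam ^ 3 - (-α) ^ 3]) := by
    intro z hz lam h2 X f hX hf
    have h := tzitzeica_eq hD hH.ne hX (hE.frame.solves hD hβ0) hf hz.1
      (lineVec_two_ne hz.2.1) hβ0 (by rwa [hα3])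
    rwa [neg_neg] at h
  refine ⟨hWo, h0W, dressFrame (-α) b ((starRingEnd ℂ) b) d
    (fun z => (dTilde b ((starRingEnd ℂ) b) (-α) E z : ℂ)) E, fun z hz =>
    ⟨cTilde_eq_conj hH hE hβ hz.1, hloop z hz,
      isTwistedGerm_simpleM hH hα (conj_tilde_ne hz) (dTilde_mul_conj hz), fun lam hl hl3 => ?_⟩,
    hfr, fun z hz => ⟨?_, fun lam hl h1 h2 => ?_⟩, fun lam hl R hR => ⟨?_, fun h1 h2 => ?_⟩⟩
  · rw [simpleM_eq hs hl3, simpleM_eq (conj_tilde_ne hz) hl3, Matrix.smul_mul, hfac z hz lam hl,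
      Matrix.mul_smul]
  · rw [scalarSol_eq]
    exact mul_ne_zero (inv_ne_zero (neg_ne_zero.2 (Complex.ofReal_ne_zero.2 hH.ne)))
      (lineVec_two_ne hz.2.1)
  · rw [hvec z hz lam hl h1 h2,
      htz z hz lam h2 _ (framePos H E lam) (hE.frame.solves hD hl) fun _ _ => rfl]
  · have hl0 := ne_zero_of_norm_one hl
    obtain ⟨Rt, h3, h4⟩ := exists_sphere_of_smul_frame hWo hH.ne hl hψt (hU.mono hsub) hfr hloop
      (realForm_sphereFrame H ψ hl (differentiableAt_of_contDiffOn hD hR.smooth h0))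
      (hR.det_sphereFrame_eq hD hl0 h0) (tau_one H) (k := 1) (by simp)
    exact ⟨Rt, h3, fun z hz => by rw [h4 z hz, Complex.ofReal_one, one_smul, Matrix.one_mulVec]⟩
  · have hl0 := ne_zero_of_norm_one hl
    have hMdet := det_simpleM hs hd0 h1
    have hn3 : lam ^ 3 + α ^ 3 ≠ 0 := fun h => h2 (eq_neg_of_add_eq_zero_left h)
    have hq : (lam ^ 3 + α ^ 3) / (lam ^ 3 - α ^ 3) ≠ 0 := div_ne_zero hn3 (sub_ne_zero.2 h1)
    have hq2 := norm_ratio_sq (x := lam ^ 3) (y := α ^ 3) (by rw [norm_pow, hl, one_pow])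
      (by rw [norm_pow, hα, one_pow]) h1
    generalize (lam ^ 3 + α ^ 3) / (lam ^ 3 - α ^ 3) = q at hMdet hq hq2 ⊢
    have hM0 : (simpleM α b ((starRingEnd ℂ) b) d lam).det ≠ 0 := by
      rw [hMdet]; exact pow_ne_zero 2 hq
    have hMtau : tau H (simpleM α b ((starRingEnd ℂ) b) d lam)⁻¹ =
        (simpleM α b ((starRingEnd ℂ) b) d lam)⁻¹ := by
      refine tau_inv ?_ hM0
      have := tau_simpleM hH hα hs hd hl0 h1
      rwa [conj_inv_of_norm_one hl] at this
    -- The determinant of the simple element is `q² = -|q|²`, with real cube root `-|q|^(2/3)`; this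
    -- factor gives the inverse element determinant one.
    have hk3 : (((-(‖q‖ ^ (2 / 3 : ℝ)) : ℝ)) : ℂ) ^ 3 *
        (simpleM α b ((starRingEnd ℂ) b) d lam)⁻¹.det = 1 := by
      rw [Matrix.det_nonsing_inv, hMdet, Ring.inverse_eq_inv', hq2]
      have : (-(‖q‖ ^ (2 / 3 : ℝ))) ^ 3 = -‖q‖ ^ 2 := by
        rw [Odd.neg_pow (by decide), pow_three_rpow (norm_nonneg q)]
      rw [← Complex.ofReal_pow, this]
      push_cast
      exact mul_inv_cancel₀ (by simpa using hq)
    obtain ⟨Rs, h3, h4⟩ := exists_sphere_of_smul_frame hWo hH.ne hl hψt (hU.mono hsub) hfr hloop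
      (realForm_sphereFrame H ψ hl (differentiableAt_of_contDiffOn hD hR.smooth h0))
      (hR.det_sphereFrame_eq hD hl0 h0) hMtau hk3
    have hk0 : H⁻¹ * ‖q‖ ^ (2 / 3 : ℝ) ≠ 0 :=
      mul_ne_zero (inv_ne_zero hH.ne) (Real.rpow_pos_of_pos (norm_pos_iff.2 hq) _).ne'
    -- `Rh` undoes the scaling of the real sphere `Rs`, hence is real; the signs of the cube root
    -- and of `-H` cancel in the comparison with the formula.
    refine ⟨fun z => (H⁻¹ * ‖q‖ ^ (2 / 3 : ℝ))⁻¹ • Rs z, fun z hz => ?_, ?_⟩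
    · have e : cx (fun z => (H⁻¹ * ‖q‖ ^ (2 / 3 : ℝ))⁻¹ • Rs z) z =
          (((H⁻¹ * ‖q‖ ^ (2 / 3 : ℝ))⁻¹ : ℝ) : ℂ) • cx Rs z := by
        funext i
        simp [cx]
      have hf : ∀ z ∈ D, cx R z = (-(H : ℂ))⁻¹ • thirdCol (sphereFrame H ψ R lam z) :=
        fun z _ => by
        have h5 : thirdCol (sphereFrame H ψ R lam z) = (-(H : ℂ)) • cx R z := rfl
        rw [h5, smul_smul, inv_mul_cancel₀ (neg_ne_zero.2 (Complex.ofReal_ne_zero.2 hH.ne)),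
          one_smul]
      rw [e, h4 z hz, framePos, Matrix.mulVec_smul, hvec z hz lam hl0 h1 h2,
        htz z hz lam h2 _ _ (hR.solves hD hl) hf,
        ← sphereFrame_eq_mul hD hDc h0 hE hl hR hH.ne hz.1, Matrix.mulVec_smul,
        Matrix.mulVec_smul, Matrix.mulVec_mulVec, smul_smul, smul_smul]
      have : (((H⁻¹ * ‖q‖ ^ (2 / 3 : ℝ))⁻¹ : ℝ) : ℂ) *
          ((-(‖q‖ ^ (2 / 3 : ℝ)) : ℝ) : ℂ) * (-(H : ℂ))⁻¹ = 1 := by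
        have h6 : (H⁻¹ * ‖q‖ ^ (2 / 3 : ℝ))⁻¹ * (-(‖q‖ ^ (2 / 3 : ℝ))) * (-H)⁻¹ = 1 := by
          rw [inv_neg, mul_assoc, neg_mul_neg, mul_comm _ H⁻¹, inv_mul_cancel₀ hk0]
        exact_mod_cast h6
      rw [this, one_smul]
    · simpa only [smul_smul, mul_inv_cancel₀ hk0, one_smul] using h3

/-! ### Real forms of complex frames, and dressing of elliptic affine spheres. -/

theorem isAffineSphere_empty (r : ℂ → Fin 3 → ℝ) (H : ℝ) (ψ : ℂ → ℝ) (U : ℂ → ℂ) :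
    IsAffineSphere ∅ r H ψ U where
  smooth := contDiffOn_empty
  smooth_psi := contDiffOn_empty
  smooth_U := contDiffOn_empty
  metric _ hz := hz.elim
  shape _ hz := hz.elim
  center _ hz := hz.elim
  cubic _ hz := hz.elim

/-- A matrix in real form with the determinant of the frame of an affine sphere. -/
def realModel (H : ℝ) : Matrix (Fin 3) (Fin 3) ℂ :=
  !![1, kap H, 0; Complex.I, -(kap H * Complex.I), 0; 0, 0, kap H * (H / 2)]

theorem det_realModel (H : ℝ) : (realModel H).det = -(Complex.I * (H : ℂ)) := by
  rw [realModel, Matrix.det_fin_three]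
  simp only [Matrix.of_apply, Matrix.cons_val', Matrix.cons_val_zero, Matrix.cons_val_one,
    Matrix.cons_val]
  linear_combination (-(Complex.I * (H : ℂ))) * kap_mul_self H

theorem realForm_realModel (H : ℝ) : RealForm H (realModel H) := by
  have hk := kap_mul_self H
  refine realForm_iff.2 fun i => ?_
  fin_cases i
  · simp [realModel, conj_kap, hk]
  · simp [realModel, conj_kap, ← mul_assoc, hk]
  · simp [realModel, conj_kap, conj_two]

/-- Being in real form is being fixed by `X ↦ κ T τ(X)`, which for `|λ| = 1` preserves solutions of
the frame equation; uniqueness then propagates it from one point. -/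
theorem RealForm.smul_matT_mul_tau {H : ℝ} {X : Matrix (Fin 3) (Fin 3) ℂ} :
    kap H • matT H * tau H X = X ↔ RealForm H X := by
  have hT := matT_mul_self H
  have hk := kap_mul_self H
  have e : kap H • matT H * tau H X = kap H • (X.map (starRingEnd ℂ) * matT H) := by
    rw [tau, inv_matT, Matrix.smul_mul, ← Matrix.mul_assoc, ← Matrix.mul_assoc, hT, Matrix.one_mul]
  rw [e, RealForm]
  constructor
  · intro h
    rw [← h, Matrix.smul_mul, smul_smul, hk, one_smul, Matrix.mul_assoc, hT, Matrix.mul_one, h]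
  · intro h
    rw [h, Matrix.smul_mul, smul_smul, hk, one_smul, Matrix.mul_assoc, hT, Matrix.mul_one]

/-- On a connected domain every invertible solution of the frame equation with `|λ| = 1` is a
complex linear image of the frame of a real affine sphere. -/
theorem exists_real_form {V : Set ℂ} (hV : IsOpen V) (hVc : IsPreconnected V) {H : ℝ} (hH : H ≠ 0)
    {ψ : ℂ → ℝ} {U : ℂ → ℂ} (hψ : ContDiffOn ℝ ∞ ψ V) (hU : ContDiffOn ℝ ∞ U V) {lam : ℂ}
    (hl : ‖lam‖ = 1) {X : ℂ → Matrix (Fin 3) (Fin 3) ℂ} (hX : Solves V H (expHalf ψ) U lam X)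
    (hdet : ∀ z ∈ V, (X z).det ≠ 0) :
    ∃ (M : Matrix (Fin 3) (Fin 3) ℂ) (R : ℂ → Fin 3 → ℝ), M.det ≠ 0 ∧
      (∀ z ∈ V, cx R z = M *ᵥ thirdCol (X z)) ∧
      IsAffineSphere V R H ψ (fun z => lam ^ 3 * U z) := by
  rcases V.eq_empty_or_nonempty with rfl | ⟨w, hw⟩
  -- A preconnected set may be empty, and then there is no base point to normalise at.
  · exact ⟨1, 0, by simp, fun z hz => hz.elim, isAffineSphere_empty _ _ _ _⟩
  have hHc : (H : ℂ) ≠ 0 := Complex.ofReal_ne_zero.2 hH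
  have hu : IsUnit (X w).det := isUnit_iff_ne_zero.2 (hdet w hw)
  -- The solution is normalised to equal `realModel` at `w`; reality and determinant hold there and
  -- spread over `V`.
  have hY := hX.const_mul (realModel H * (X w)⁻¹)
  have hYw : realModel H * (X w)⁻¹ * X w = realModel H := by
    rw [Matrix.mul_assoc, Matrix.nonsing_inv_mul _ hu, Matrix.mul_one]
  have hYdet : ∀ z ∈ V, (realModel H * (X w)⁻¹ * X z).det = -(Complex.I * (H : ℂ)) :=
    fun z hz => by rw [hY.det_eq hV hVc hz hw, hYw, det_realModel]
  have hne : -(Complex.I * (H : ℂ)) ≠ 0 := neg_ne_zero.2 (mul_ne_zero Complex.I_ne_zero hHc)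
  have hY' : Solves V H (expHalf ψ) U lam
      (fun z => kap H • matT H * tau H (realModel H * (X w)⁻¹ * X z)) := by
    refine (Solves.tau hV hψ ?_).const_mul _
    rw [conj_inv_of_norm_one hl]
    exact hY
  have hreal : ∀ z ∈ V, RealForm H (realModel H * (X w)⁻¹ * X z) := fun z hz =>
    RealForm.smul_matT_mul_tau.1 (hY'.eqOn hV hVc hY (fun z hz => by rw [hYdet z hz]; exact hne) hw
      (by rw [hYw]; exact RealForm.smul_matT_mul_tau.2 (realForm_realModel H)) hz)
  obtain ⟨R, h1, h2, -⟩ := exists_isAffineSphere_of_solves hV hH hl hψ hU hY hreal hYdet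
  refine ⟨(-(H : ℂ))⁻¹ • (realModel H * (X w)⁻¹), R, ?_, fun z hz => ?_, h2⟩
  · rw [det_smul_three, Matrix.det_mul, det_realModel, Matrix.det_nonsing_inv,
      Ring.inverse_eq_inv']
    exact mul_ne_zero (pow_ne_zero 3 (inv_ne_zero (neg_ne_zero.2 hHc)))
      (mul_ne_zero hne (inv_ne_zero (hdet w hw)))
  · rw [h1 z hz, thirdCol_mul, Matrix.smul_mulVec]

theorem rootH_neg {H : ℝ} (hH : 0 < H) : Complex.I * rootH H = -rootH (-H) := by
  rw [rootH, rootH, if_neg hH.le.not_gt, if_pos (neg_neg_of_pos hH), ← mul_assoc, Complex.I_mul_I]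
  simp

/-- Multiplying the conformal factor by `i` is the same as changing the signs of `H` and `U`. -/
theorem Solves.mul_I {V : Set ℂ} (hV : IsOpen V) {H : ℝ} (hH : 0 < H) {p U : ℂ → ℂ}
    (hp : ContDiffOn ℝ ∞ p V) {lam : ℂ} {X : ℂ → Matrix (Fin 3) (Fin 3) ℂ}
    (hX : Solves V H (fun z => Complex.I * p z) U lam X) :
    Solves V (-H) p (fun z => -U z) lam (fun z => X z * Matrix.diagonal ![1, 1, -1]) := by
  intro z hz
  have hr := rootH_neg hH
  have hw := (hasW_of_contDiffOn hV hp hz).const_mul Complex.I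
  have hq : ∀ x : ℂ, Complex.I * x / (Complex.I * p z) = x / p z := fun x =>
    mul_div_mul_left _ _ Complex.I_ne_zero
  have hq2 : (Complex.I * p z) ^ 2 = -p z ^ 2 := by rw [mul_pow, Complex.I_sq, neg_one_mul]
  -- This leaves a minus sign in the off-diagonal entries of the third row and column, which
  -- conjugation by `diag(1, 1, -1)` removes; the sign in `(i p)² = -p²` moves to `U`.
  have e1 : ∀ l : ℂ, l * (rootH H / 2) * (Complex.I * p z) = -(l * (rootH (-H) / 2) * p z) :=
    fun l => by linear_combination (l / 2 * p z) * hr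
  refine ((hX z hz).mul_const _).of_eq ?_ ?_
  · rw [Matrix.mul_assoc, Matrix.mul_assoc]
    congr 1
    rw [connZ, connZ, hw.wz_eq, hq, hq2, e1, Matrix.diagonal_fin_three]
    ext i j
    fin_cases i <;> fin_cases j <;>
      simp [Matrix.mul_apply, Fin.sum_univ_three, div_neg, neg_div]
  · rw [Matrix.mul_assoc, Matrix.mul_assoc]
    congr 1
    rw [connZbar, connZbar, hw.wzb_eq, hq, hq2, e1]
    ext i j
    fin_cases i <;> fin_cases j <;>
      simp [Matrix.mul_apply, Fin.sum_univ_three, div_neg, neg_div]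

/-- The real forms of a complex dressed frame of an elliptic affine sphere. -/
theorem exists_real_forms_of_frame {V : Set ℂ} (hV : IsOpen V) (hVc : IsPreconnected V) {H : ℝ}
    (hH : 0 < H) {ψ : ℂ → ℝ} {U dt : ℂ → ℂ} (hψ : ContDiffOn ℝ ∞ ψ V) (hU : ContDiffOn ℝ ∞ U V)
    (hdt : ContDiffOn ℝ ∞ dt V) {Et : ℂ → ℂ → Matrix (Fin 3) (Fin 3) ℂ}
    (hEt : IsFrame V H (fun z => dt z * expHalf ψ z) U Et)
    (hloop : ∀ z ∈ V, IsSigmaLoop (Et z)) {δ : ℂ → ℝ} (hδ : ∀ z ∈ V, 0 < δ z) {lam : ℂ}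
    (hl : ‖lam‖ = 1) :
    ((∀ z ∈ V, dt z = (δ z : ℂ)) →
      ∃ (M : Matrix (Fin 3) (Fin 3) ℂ) (Rt : ℂ → Fin 3 → ℝ), M.det ≠ 0 ∧
        (∀ z ∈ V, cx Rt z = M *ᵥ thirdCol (Et z lam)) ∧
        IsAffineSphere V Rt H (fun z => ψ z + Real.log (δ z ^ 2)) (fun z => lam ^ 3 * U z)) ∧
    ((∀ z ∈ V, dt z = Complex.I * (δ z : ℂ)) →
      ∃ (M : Matrix (Fin 3) (Fin 3) ℂ) (Rt : ℂ → Fin 3 → ℝ), M.det ≠ 0 ∧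
        (∀ z ∈ V, cx Rt z = M *ᵥ thirdCol (Et z lam)) ∧
        IsAffineSphere V Rt (-H) (fun z => ψ z + Real.log (δ z ^ 2))
          (fun z => -(lam ^ 3 * U z))) := by
  have hl0 := ne_zero_of_norm_one hl
  have hsmooth : ContDiffOn ℝ ∞ δ V → ContDiffOn ℝ ∞ (fun z => ψ z + Real.log (δ z ^ 2)) V :=
    fun h => hψ.add ((h.pow 2).log fun z hz => pow_ne_zero 2 (hδ z hz).ne')
  constructor
  · intro h
    have hs := hsmooth ((Complex.reCLM.contDiff.comp_contDiffOn hdt).congr fun z hz => by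
      simp [h z hz])
    have hX := (hEt.congr hV (p' := expHalf fun z => ψ z + Real.log (δ z ^ 2)) fun z hz => by
      rw [expHalf_add_log (hδ z hz), h z hz]).solves hV hl0
    exact exists_real_form hV hVc hH.ne' hs hU hl hX fun z hz => by
      rw [(hloop z hz).det lam hl0]; exact one_ne_zero
  · intro h
    have hs := hsmooth ((Complex.imCLM.contDiff.comp_contDiffOn hdt).congr fun z hz => by
      simp [h z hz])
    have hX := (hEt.congr hV
      (p' := fun z => Complex.I * expHalf (fun z => ψ z + Real.log (δ z ^ 2)) z) fun z hz => by
        rw [expHalf_add_log (hδ z hz), h z hz, mul_assoc]).solves hV hl0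
    have hJ : (Matrix.diagonal ![1, 1, (-1 : ℂ)]).det ≠ 0 := by
      simp [Matrix.det_diagonal, Fin.prod_univ_three]
    obtain ⟨M, R, h1, h2, h3⟩ := exists_real_form hV hVc (neg_ne_zero.2 hH.ne') hs hU.neg hl
      (hX.mul_I hV hH (contDiffOn_expHalf hs)) fun z hz => by
        rw [Matrix.det_mul, (hloop z hz).det lam hl0, one_mul]; exact hJ
    -- The diagonal factor reverses the third column, so the constant matrix changes sign.
    refine ⟨-M, R, ?_, fun z hz => ?_, by simpa only [mul_neg] using h3⟩
    · rw [Matrix.det_neg]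
      exact mul_ne_zero (by norm_num) h1
    · have e : thirdCol (Et z lam * Matrix.diagonal ![1, 1, -1]) = -thirdCol (Et z lam) := by
        funext i
        simp [thirdCol]
      rw [h2 z hz, e, Matrix.mulVec_neg, Matrix.neg_mulVec]

/-- Dressing of elliptic affine spheres by the simple elements of rank 1 type. -/
theorem dressing_elliptic {D : Set ℂ} (hD : IsOpen D) {H : ℝ} (hH : 0 < H) {ψ : ℂ → ℝ}
    {U : ℂ → ℂ} (hψ : ContDiffOn ℝ ∞ ψ D) (hU : ContDiffOn ℝ ∞ U D)
    {E : ℂ → ℂ → Matrix (Fin 3) (Fin 3) ℂ} (hE : IsNormalizedFrame D H ψ U E) {α b c d : ℂ}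
    (hα : ‖α‖ = 1) (hcone : ![b, c, 1] ∉ coneDelta) (hd : d ≠ 0)
    {V : Set ℂ} {bt ct dt φ : ℂ → ℂ} (hVD : V ⊆ D) (hV : IsOpen V)
    (hVcone : ∀ z ∈ V, lineVec b c α E z ∉ coneDelta) (hbt : bt = bTilde b c α E)
    (hct : ct = cTilde b c α E) (hdt : ContDiffOn ℝ ∞ dt V)
    (hdt2 : ∀ z ∈ V, dt z ^ 2 = 2 * bt z * ct z - 1) (hφ : φ = scalarSol H b c α E) :
    ∃ Et : ℂ → ℂ → Matrix (Fin 3) (Fin 3) ℂ,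
        (∀ z ∈ V, IsSigmaLoop (Et z) ∧ IsSigmaGerm (simpleG α (bt z) (ct z) (dt z)) ∧
          ∀ lam : ℂ, lam ≠ 0 → lam ^ 3 ≠ α ^ 3 →
            simpleG α b c d lam * E z lam = Et z lam * simpleG α (bt z) (ct z) (dt z) lam) ∧
        (IsTwistedGerm H (simpleG α b c d) → ∀ z ∈ V,
          0 < 2 * ‖bt z‖ ^ 2 - 1 → dt z = (dTilde b c α E z : ℂ) →
          ct z = (starRingEnd ℂ) (bt z) ∧ IsTwistedLoop H (Et z) ∧
            IsTwistedGerm H (simpleG α (bt z) (ct z) (dt z))) ∧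
        (c = -(starRingEnd ℂ) b → ∀ z ∈ V, ct z = -(starRingEnd ℂ) (bt z)) ∧
        IsFrame V H (fun z => dt z * expHalf ψ z) U Et ∧
        (∀ z ∈ V, φ z ≠ 0 ∧ ∀ lam : ℂ, lam ≠ 0 → lam ^ 3 ≠ α ^ 3 → lam ^ 3 ≠ -α ^ 3 →
          (simpleG α b c d lam)⁻¹ *ᵥ thirdCol (Et z lam) =
            ((lam ^ 3 - α ^ 3) / (lam ^ 3 + α ^ 3)) •
              tzitzeica H ψ φ (framePos H E lam) (-α) lam z) ∧
        (IsPreconnected V → ∀ δ : ℂ → ℝ, (∀ z ∈ V, 0 < δ z) → ∀ lam : ℂ, ‖lam‖ = 1 →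
          ((∀ z ∈ V, dt z = (δ z : ℂ)) →
            ∃ (M : Matrix (Fin 3) (Fin 3) ℂ) (Rt : ℂ → Fin 3 → ℝ), M.det ≠ 0 ∧
              (∀ z ∈ V, cx Rt z = M *ᵥ thirdCol (Et z lam)) ∧
              IsAffineSphere V Rt H (fun z => ψ z + Real.log (δ z ^ 2))
                (fun z => lam ^ 3 * U z)) ∧
          ((∀ z ∈ V, dt z = Complex.I * (δ z : ℂ)) →
            ∃ (M : Matrix (Fin 3) (Fin 3) ℂ) (Rt : ℂ → Fin 3 → ℝ), M.det ≠ 0 ∧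
              (∀ z ∈ V, cx Rt z = M *ᵥ thirdCol (Et z lam)) ∧
              IsAffineSphere V Rt (-H) (fun z => ψ z + Real.log (δ z ^ 2))
                (fun z => -(lam ^ 3 * U z)))) := by
  have hs := two_mul_sub_one_ne hcone
  have hα0 := ne_zero_of_norm_one hα
  subst hbt hct hφ
  have hst := fun z (hz : z ∈ V) => tilde_ne (hVcone z hz)
  have hv := fun z (hz : z ∈ V) => lineVec_two_ne (hVcone z hz)
  have hdt0 : ∀ z ∈ V, dt z ≠ 0 := fun z hz h => hst z hz (by
    rw [← hdt2 z hz, h]; norm_num)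
  have hfac := fun z (hz : z ∈ V) lam (hl : lam ≠ 0) => numG_mul_eq_dress_mul (d := d) hα0
    (hE.loop z (hVD hz)).1 (hv z hz) (lineVec_eq_smul (hv z hz)) (hst z hz) (hdt0 z hz) hl
  have hloop : ∀ z ∈ V, IsSigmaLoop (dressFrame α b c d dt E z) := fun z hz =>
    isSigmaLoop_dress hα0 (hE.loop z (hVD hz)).1 (hv z hz) (lineVec_eq_smul (hv z hz)) hs hd
      (hst z hz) (hdt0 z hz)
  have hfr : IsFrame V H (fun z => dt z * expHalf ψ z) U (dressFrame α b c d dt E) :=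
    isFrame_dressFrame (hE.frame.mono hVD) (fun z hz => (hE.loop z (hVD hz)).1) hα0 hV
      ((contDiffOn_expHalf hψ).mono hVD) (fun z _ => expHalf_ne_zero ψ z) (hU.mono hVD) hVcone hdt
      hdt2
  -- The clause on real germs is vacuous, as no rank 1 element with `|α| = 1` satisfies the
  -- `τ`-condition.
  refine ⟨dressFrame α b c d dt E, fun z hz => ⟨hloop z hz,
    isSigmaGerm_simpleG hα (hst z hz) (hdt0 z hz), fun lam hl hl3 => ?_⟩,
    fun h => (not_isTwistedGerm_simpleG hα hs h).elim, fun hc z hz => ?_, hfr,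
    fun z hz => ⟨?_, fun lam hl h1 h2 => ?_⟩, fun hVc δ hδ lam hl =>
      exists_real_forms_of_frame hV hVc hH (hψ.mono hVD) (hU.mono hVD) hdt hfr hloop hδ hl⟩
  · rw [simpleG_eq hs hl3, simpleG_eq (hst z hz) hl3, Matrix.smul_mul, hfac z hz lam hl,
      Matrix.mul_smul, dressFrame]
  · have h := cTilde_eq_kap_mul (hE.tau_eq_self (hVD hz) hα) (c := c) (b := b)
      (by rw [kap_of_pos hH, neg_one_mul, hc])
    rwa [kap_of_pos hH, neg_one_mul] at h
  · rw [scalarSol_eq]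
    exact mul_ne_zero (inv_ne_zero (neg_ne_zero.2 (Complex.ofReal_ne_zero.2 hH.ne'))) (hv z hz)
  · rw [dressFrame, inv_mulVec_thirdCol (γ := α ^ 3) hs hd (hst z hz) (hdt0 z hz) (simpleG_eq hs h1)
      h1 h1 h2 (hfac z hz lam hl), tzitzeica_eq (f := framePos H E lam) hD hH.ne'
      (hE.frame.solves hD hl)
      (hE.frame.solves hD hα0) (fun _ _ => rfl) (hVD hz) (hv z hz) hα0 h1]

end DefiniteAffine

end

theorem theorem5p4 (D : Set ℂ) (hD : IsOpen D) (hDc : IsPreconnected D) (h0 : (0 : ℂ) ∈ D)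
    (r : ℂ → Fin 3 → ℝ) (H : ℝ) (hH : H ≠ 0) (ψ : ℂ → ℝ) (U : ℂ → ℂ)
    (hr : IsAffineSphere D r H ψ U) :
    -- the associated family and its normalized extended frame
    (∀ V : Set ℂ, V ⊆ D → IsOpen V → (0 : ℂ) ∈ V → StarConvex ℝ 0 V →
      ∃ (E : ℂ → ℂ → Matrix (Fin 3) (Fin 3) ℂ) (R : ℂ → ℂ → Fin 3 → ℝ),
        IsNormalizedFrame V H ψ U E ∧ Set.EqOn (R 1) r V ∧
        ∀ lam : ℂ, ‖lam‖ = 1 →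
          IsAffineSphere V (R lam) H ψ (fun z => lam ^ 3 * U z) ∧
          ∀ z ∈ V, sphereFrame H ψ (R lam) lam z = sphereFrame H ψ (R lam) lam 0 * E z lam) ∧
    -- dressing of hyperbolic affine spheres
    (H < 0 → ∀ E : ℂ → ℂ → Matrix (Fin 3) (Fin 3) ℂ, IsNormalizedFrame D H ψ U E →
      ∀ α b c d : ℂ, ‖α‖ = 1 → ![b, c, 1] ∉ coneDelta → IsTwistedGerm H (simpleM α b c d) →
      ∀ (W : Set ℂ) (bt : ℂ → ℂ) (dt ψt : ℂ → ℝ) (φ : ℂ → ℂ),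
        W = dressingDomain D b c (-α) E → bt = bTilde b c (-α) E → dt = dTilde b c (-α) E →
        ψt = (fun z => ψ z + Real.log (dt z ^ 2)) →
        φ = scalarSol H b ((starRingEnd ℂ) b) (-α) E →
      IsOpen W ∧ (0 : ℂ) ∈ W ∧
      ∃ Et : ℂ → ℂ → Matrix (Fin 3) (Fin 3) ℂ,
        (∀ z ∈ W, cTilde b c (-α) E z = (starRingEnd ℂ) (bt z) ∧
          IsTwistedLoop H (Et z) ∧
          IsTwistedGerm H (simpleM α (bt z) ((starRingEnd ℂ) (bt z)) (dt z)) ∧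
          ∀ lam : ℂ, lam ≠ 0 → lam ^ 3 ≠ α ^ 3 →
            simpleM α b c d lam * E z lam =
              Et z lam * simpleM α (bt z) ((starRingEnd ℂ) (bt z)) (dt z) lam) ∧
        IsFrame W H (expHalf ψt) U Et ∧
        (∀ z ∈ W, φ z ≠ 0 ∧ ∀ lam : ℂ, lam ≠ 0 → lam ^ 3 ≠ α ^ 3 → lam ^ 3 ≠ -α ^ 3 →
          (simpleM α b c d lam)⁻¹ *ᵥ thirdCol (Et z lam) =
            tzitzeica H ψ φ (framePos H E lam) α lam z) ∧
        ∀ lam : ℂ, ‖lam‖ = 1 → ∀ R : ℂ → Fin 3 → ℝ,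
          IsAffineSphere D R H ψ (fun z => lam ^ 3 * U z) →
          (∃ Rt : ℂ → Fin 3 → ℝ, IsAffineSphere W Rt H ψt (fun z => lam ^ 3 * U z) ∧
            ∀ z ∈ W, cx Rt z = sphereFrame H ψ R lam 0 *ᵥ framePos H Et lam z) ∧
          (lam ^ 3 ≠ α ^ 3 → lam ^ 3 ≠ -α ^ 3 → ∃ Rh : ℂ → Fin 3 → ℝ,
            (∀ z ∈ W, cx Rh z = tzitzeica H ψ φ (cx R) α lam z) ∧
            IsAffineSphere W
              (fun z => (H⁻¹ * ‖(lam ^ 3 + α ^ 3) / (lam ^ 3 - α ^ 3)‖ ^ (2 / 3 : ℝ)) • Rh z)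
              H ψt (fun z => lam ^ 3 * U z))) ∧
    -- dressing of elliptic affine spheres
    (0 < H → ∀ E : ℂ → ℂ → Matrix (Fin 3) (Fin 3) ℂ, IsNormalizedFrame D H ψ U E →
      ∀ α b c d : ℂ, ‖α‖ = 1 → ![b, c, 1] ∉ coneDelta → d ≠ 0 →
      ∀ (V : Set ℂ) (bt ct dt φ : ℂ → ℂ),
        V ⊆ D → IsOpen V → (∀ z ∈ V, lineVec b c α E z ∉ coneDelta) →
        bt = bTilde b c α E → ct = cTilde b c α E → ContDiffOn ℝ ∞ dt V →
        (∀ z ∈ V, dt z ^ 2 = 2 * bt z * ct z - 1) → φ = scalarSol H b c α E →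
      ∃ Et : ℂ → ℂ → Matrix (Fin 3) (Fin 3) ℂ,
        (∀ z ∈ V, IsSigmaLoop (Et z) ∧ IsSigmaGerm (simpleG α (bt z) (ct z) (dt z)) ∧
          ∀ lam : ℂ, lam ≠ 0 → lam ^ 3 ≠ α ^ 3 →
            simpleG α b c d lam * E z lam = Et z lam * simpleG α (bt z) (ct z) (dt z) lam) ∧
        (IsTwistedGerm H (simpleG α b c d) → ∀ z ∈ V,
          0 < 2 * ‖bt z‖ ^ 2 - 1 → dt z = (dTilde b c α E z : ℂ) →
          ct z = (starRingEnd ℂ) (bt z) ∧ IsTwistedLoop H (Et z) ∧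
            IsTwistedGerm H (simpleG α (bt z) (ct z) (dt z))) ∧
        (c = -(starRingEnd ℂ) b → ∀ z ∈ V, ct z = -(starRingEnd ℂ) (bt z)) ∧
        IsFrame V H (fun z => dt z * expHalf ψ z) U Et ∧
        (∀ z ∈ V, φ z ≠ 0 ∧ ∀ lam : ℂ, lam ≠ 0 → lam ^ 3 ≠ α ^ 3 → lam ^ 3 ≠ -α ^ 3 →
          (simpleG α b c d lam)⁻¹ *ᵥ thirdCol (Et z lam) =
            ((lam ^ 3 - α ^ 3) / (lam ^ 3 + α ^ 3)) •
              tzitzeica H ψ φ (framePos H E lam) (-α) lam z) ∧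
        -- real forms, according to the sign of `dt ^ 2`
        (IsPreconnected V → ∀ δ : ℂ → ℝ, (∀ z ∈ V, 0 < δ z) → ∀ lam : ℂ, ‖lam‖ = 1 →
          ((∀ z ∈ V, dt z = (δ z : ℂ)) →
            ∃ (M : Matrix (Fin 3) (Fin 3) ℂ) (Rt : ℂ → Fin 3 → ℝ), M.det ≠ 0 ∧
              (∀ z ∈ V, cx Rt z = M *ᵥ thirdCol (Et z lam)) ∧
              IsAffineSphere V Rt H (fun z => ψ z + Real.log (δ z ^ 2))
                (fun z => lam ^ 3 * U z)) ∧
          ((∀ z ∈ V, dt z = Complex.I * (δ z : ℂ)) →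
            ∃ (M : Matrix (Fin 3) (Fin 3) ℂ) (Rt : ℂ → Fin 3 → ℝ), M.det ≠ 0 ∧
              (∀ z ∈ V, cx Rt z = M *ᵥ thirdCol (Et z lam)) ∧
              IsAffineSphere V Rt (-H) (fun z => ψ z + Real.log (δ z ^ 2))
                (fun z => -(lam ^ 3 * U z))))) := by
  refine ⟨fun V hVD hV h0V hs => exists_associated_family hV h0V hs hH (hr.mono hVD), ?_, ?_⟩
  · intro hneg E hE α b c d hα hcone hgerm W bt dt ψt φ hW hbt hdt hψt hφ
    exact dressing_hyperbolic hD hDc h0 hneg hr.smooth_psi hr.smooth_U hE hα hcone hgerm hW hbt hdt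
      hψt hφ
  · intro hpos E hE α b c d hα hcone hd V bt ct dt φ hVD hV hVcone hbt hct hdt hdt2 hφ
    exact dressing_elliptic hD hpos hr.smooth_psi hr.smooth_U hE hα hcone hd hVD hV hVcone hbt hct
      hdt hdt2 hφ
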